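/- Let $\Omega\subset\mathbb{R}^2$ be an open set (bounded or unbounded, possibly multiply connected) with $\operatorname{int}(\overline{\Omega})=\Omega$, whose boundary $\partial\Omega$ is the disjoint union of finitely many regular simple closed curves of class $C^5$, and let $\sigma:\partial\Omega\to\mathbb{R}$ be of class $C^4$ (as a function of the curve parameters). For $\delta>0$ the local single layer heat potential is $$\mathcal S_L[\sigma](x)=\int_0^{\delta}\int_{\partial\Omega}\frac{e^{-\|x-y\|^2/4t}}{4\pi t}\,\sigma(y)\,\mathrm{d}s_y\,\mathrm{d}t .$$ Let $x\in\mathbb{R}^2$ have a unique closest point $b$ on $\partial\Omega$, and put $r=\|b-x\|$, $c=r/\sqrt\delta$, and $\operatorname{sgn}(x)=1,0,-1$ according as $x\in\Omega$, $x\in\partial\Omega$, $x\notin\overline\Omega$. Let $\tau$ be a unit tangent and $n$ the inward unit normal of $\partial\Omega$ at $b$, and near $b$ write $\partial\Omega$ as the graph $\{b+\xi\tau+\gamma(\xi)n\}$ with $\gamma(0)=\gamma'(0)=0$ (so that $\Omega$ lies above the graph in the direction $n$). Put $\kappa_b=\gamma''(0)$ (the curvature at $b$), $\gamma_b^{(3)}=\gamma^{(3)}(0)$,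 $\gamma_b^{(4)}=\gamma^{(4)}(0)$, $\sigma_b=\sigma(b)$, and let $\sigma_b',\sigma_b''$ be the first and second derivatives at $\xi=0$ of $\xi\mapsto\sigma(b+\xi\tau+\gamma(\xi)n)$. With $\operatorname{erfc}(s)=\frac{2}{\sqrt\pi}\int_s^\infty e^{-u^2}\,\mathrm{d}u$, abbreviate $$A=c\,\operatorname{erfc}\!\left(\tfrac c2\right)-\frac{2e^{-c^2/4}}{\sqrt\pi},\qquad P=\frac{2(c^2-2)e^{-c^2/4}}{\sqrt\pi}-c^3\operatorname{erfc}\!\left(\tfrac c2\right).$$ Then the integral over $t$ converges and $$\begin{aligned} \mathcal S_L[\sigma](x)=-\Big\{&\sqrt\delta\,\frac{\sigma_b}{2}A+\operatorname{sgn}(x)\,\delta\,\frac{c\,\kappa_b\sigma_b}{4}A\\ &+\delta^{3/2}\frac{\sigma_b\kappa_b^2}{12}\Big(2c^3\operatorname{erfc}\!\left(\tfrac c2\right)-\frac{(4c^2+1)e^{-c^2/4}}{\sqrt\pi}\Big)+\delta^{3/2}\frac{\sigma_b''}{12}P\\ &+\delta^2\operatorname{sgn}(x)\Big[\frac{c\,\kappa_b^3\sigma_b}{16}\Big(3c^3\operatorname{erfc}\!\left(\tfrac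 c2\right)-\frac{(6c^2-2)e^{-c^2/4}}{\sqrt\pi}\Big)+\frac{c\,\kappa_b\sigma_b''}{8}P\Big]\\ &+\delta^2\operatorname{sgn}(x)\Big[\frac{c\,\sigma_b\gamma_b^{(4)}}{48}P+\frac{c\,\sigma_b'\gamma_b^{(3)}}{12}P\Big]\Big\}+O\big(\delta^{5/2}\big)\qquad(\delta\to0^+), \end{aligned}$$ where the $O$ is uniform in $x$: there are $C,\delta_0>0$, depending only on $\Omega$ and $\sigma$, such that for all $0<\delta<\delta_0$ and all $x$ with a unique closest boundary point the remainder is at most $C\delta^{5/2}$ in absolute value. -/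

import Mathlib

open MeasureTheory Set Filter Topology

noncomputable section

/-- The Euclidean plane. -/
abbrev Plane := EuclideanSpace ℝ (Fin 2)

/-- The fundamental solution of the heat equation `u_t - Δu = 0` in the plane. -/
def heatKernel (x : Plane) (t : ℝ) : ℝ :=
  Real.exp (-(‖x‖ ^ 2) / (4 * t)) / (4 * Real.pi * t)

/-- The complementary error function. -/
def erfc (x : ℝ) : ℝ :=
  2 / Real.sqrt Real.pi * ∫ t in Ioi x, Real.exp (-t ^ 2)

/-- `Ω` is a planar region (interior, exterior, possibly multiply connected) whose boundary is
the disjoint union of the finitely many regular simple closed `C⁵` curves `p i`, each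
parametrized with period one; the region lies locally on one side of its boundary. -/
structure IsC5Region {ι : Type*} (Ω : Set Plane) (p : ι → ℝ → Plane) : Prop where
  isOpen : IsOpen Ω
  /-- `Ω` has no slits: it does not lie on both sides of a boundary curve. -/
  oneSided : interior (closure Ω) = Ω
  frontier_eq : frontier Ω = ⋃ i, range (p i)
  contDiff : ∀ i, ContDiff ℝ 5 (p i)
  periodic : ∀ i, Function.Periodic (p i) 1
  regular : ∀ i s, deriv (p i) s ≠ 0
  simple : ∀ i, InjOn (p i) (Ico 0 1)
  disjoint : ∀ i j, i ≠ j → Disjoint (range (p i)) (range (p j))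

/-- Integral of `f` with respect to arc length over the union of the closed curves `p i`. -/
def boundaryIntegral {ι : Type*} [Fintype ι] (p : ι → ℝ → Plane) (f : Plane → ℝ) : ℝ :=
  ∑ i, ∫ s in (0 : ℝ)..1, f (p i s) * ‖deriv (p i) s‖

/-- The layer heat potential density in time: the integral over the boundary of the heat kernel,
centred at the target `x` and at time `t`, against `σ`. -/
def layerAtTime {ι : Type*} [Fintype ι] (p : ι → ℝ → Plane) (σ : Plane → ℝ) (x : Plane)
    (t : ℝ) : ℝ :=
  boundaryIntegral p fun y => heatKernel (x - y) t * σ y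

/-- The local single layer heat potential with short-time cutoff `δ`. -/
def localSingleLayer {ι : Type*} [Fintype ι] (p : ι → ℝ → Plane) (σ : Plane → ℝ) (δ : ℝ)
    (x : Plane) : ℝ :=
  ∫ t in (0 : ℝ)..δ, layerAtTime p σ x t

open Classical in
/-- `1` in `Ω`, `0` on the boundary, `-1` in the exterior. -/
def sideSign (Ω : Set Plane) (x : Plane) : ℝ :=
  if x ∈ Ω then 1 else if x ∈ frontier Ω then 0 else -1

/-- `b` is the unique point of `S` closest to `x`. -/
def IsUniqueClosest (S : Set Plane) (x b : Plane) : Prop :=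
  b ∈ S ∧ ∀ y ∈ S, y ≠ b → dist x b < dist x y

/-- Tangent line parametrization at the boundary point `b`: in the orthonormal frame `(τ, n)`
centred at `b`, the boundary of `Ω` is near `b` the graph of `γ`, tangent to the `τ`-axis at `b`,
and `Ω` is the part above the graph. So `τ` is a unit tangent and `n` the inward unit normal. -/
structure IsTangentGraph (Ω : Set Plane) (b τ n : Plane) (γ : ℝ → ℝ) : Prop where
  norm_tangent : ‖τ‖ = 1
  norm_normal : ‖n‖ = 1
  orthogonal : inner ℝ τ n = 0
  contDiffAt : ContDiffAt ℝ 5 γ 0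
  map_zero : γ 0 = 0
  deriv_zero : deriv γ 0 = 0
  eventually_mem_iff : ∀ᶠ y in 𝓝 b, (y ∈ Ω ↔ γ (inner ℝ τ (y - b)) < inner ℝ n (y - b))

/-- A function on the boundary, as a function of the excursion `ξ` along the tangent line. -/
def alongTangent (σ : Plane → ℝ) (b τ n : Plane) (γ : ℝ → ℝ) (ξ : ℝ) : ℝ :=
  σ (b + ξ • τ + γ ξ • n)

end

/-!
Why the expansion holds. Let `ρ` be the signed distance of the target `x` from the boundary, so that
`x - b = ρ n`. The expansion comes from an estimate at each fixed time `0 < t ≤ 1`,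

  `layerAtTime p σ x t = exp (-ρ² / 4t) / (2 √(π t)) * (m₀ ρ + m₁ ρ * t) + O(t ^ (3/2))`,

uniform in `x` (`IsC5Region.exists_layerAtTime_bound`). Integration over `0 < t < δ` turns the
remainder into `O(δ ^ (5/2))`, and the leading part has an elementary primitive in terms of `erfc`
(`integral_lineKernel`, `integral_lineKernel_mul`); with `r = c √δ` this is the stated formula.

At a fixed time, let `ξ` be the tangential coordinate of a boundary point near `b` and `γ ξ` its
height. The squared distance to the target is `ξ² + (γ ξ - ρ)²`, so the heat kernel is the Gaussian
`exp (-(ξ² + ρ²) / 4t)` times `exp w` with `w = (2 ρ γ - γ²) / 4t`. In the scaled variables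
`ξ = √t z`, `ρ = √t ρ'` the exponent `w`, the density and the arc length element are power series in
`q = √t` with coefficients polynomial in `z` and `ρ'`. They are multiplied modulo `q ^ 4`
(`ExpandsTo.mul`); the remainder is `q ^ 4` times a polynomial weight, which the Gaussian absorbs
because `|w| ≤ z² / 8` on a short arc with a close target
(`ScaledData.exists_abs_sub_expansion_le`). The Gaussian moments of the truncated product are
`m₀ ρ + m₁ ρ * t` (`BoundaryJet.hasGaussianMean`): odd powers of `ξ` drop out.

Uniformity in `b` is obtained on the curves themselves, without inverting the tangential coordinate
`X h` of the point with parameter `s + h`. The arc integral is compared with the integral of the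
explicit polynomial composed with `X`, times `X'`, and only the latter is substituted
(`ArcModel.exists_integral_bound`). The required Taylor bounds in powers of `X` follow from chains
of functions with `(G k)' = G (k + 1) * X'`, bounded by compactness (`UniformlySmooth.exists_chain`,
`abs_sub_taylor_le`); near `b` such a chain consists of the derivatives of `γ`, or of the density
along the tangent, composed with `X` (`iteratedDeriv_eq_chain`).

All other parts of the boundary, and all boundary points if `x` is not close to the boundary, keep a
fixed distance from `x`, and the heat kernel is smaller than any power of `t` there
(`IsC5Region.exists_dist_lower_bound`, `heatKernel_le`).
-/

/-! ### Expansions in the square root of time with polynomially weighted remainders -/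

/-- A family `f` is of weighted order `k` in the small parameter `q` if
`|f| ≤ C q ^ k (1 + |z| + |ρ|) ^ N`, uniformly, for some constant `C` and some exponent `N`. -/
def WeightedOrder {V : Type*} (q z ρ : V → ℝ) (k : ℕ) (f : V → ℝ) : Prop :=
  ∃ C : ℝ, 0 ≤ C ∧ ∃ N : ℕ, ∀ v, |f v| ≤ C * q v ^ k * (1 + |z v| + |ρ v|) ^ N

namespace WeightedOrder

variable {V : Type*} {q z ρ : V → ℝ} {k l : ℕ} {f g : V → ℝ}

lemma one_le_weight (z ρ : ℝ) : 1 ≤ 1 + |z| + |ρ| := by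
  have := abs_nonneg z; have := abs_nonneg ρ; linarith

lemma of_abs_le (hf : WeightedOrder q z ρ k f) (h : ∀ v, |g v| ≤ |f v|) :
    WeightedOrder q z ρ k g := by
  obtain ⟨C, hC, N, hN⟩ := hf
  exact ⟨C, hC, N, fun v => (h v).trans (hN v)⟩

lemma add (hq : ∀ v, 0 < q v) (hf : WeightedOrder q z ρ k f) (hg : WeightedOrder q z ρ k g) :
    WeightedOrder q z ρ k (fun v => f v + g v) := by
  obtain ⟨C, hC, N, hN⟩ := hf
  obtain ⟨D, hD, M, hM⟩ := hg
  refine ⟨C + D, by positivity, N + M, fun v => ?_⟩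
  have hw := one_le_weight (z v) (ρ v)
  have hq' := (hq v).le
  have h1 : (1 + |z v| + |ρ v|) ^ N ≤ (1 + |z v| + |ρ v|) ^ (N + M) :=
    pow_le_pow_right₀ hw (by omega)
  have h2 : (1 + |z v| + |ρ v|) ^ M ≤ (1 + |z v| + |ρ v|) ^ (N + M) :=
    pow_le_pow_right₀ hw (by omega)
  calc |f v + g v| ≤ |f v| + |g v| := abs_add_le _ _
    _ ≤ C * q v ^ k * (1 + |z v| + |ρ v|) ^ N + D * q v ^ k * (1 + |z v| + |ρ v|) ^ M :=
        add_le_add (hN v) (hM v)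
    _ ≤ C * q v ^ k * (1 + |z v| + |ρ v|) ^ (N + M)
        + D * q v ^ k * (1 + |z v| + |ρ v|) ^ (N + M) := by gcongr
    _ = _ := by ring

lemma mul (hq : ∀ v, 0 < q v) (hf : WeightedOrder q z ρ k f) (hg : WeightedOrder q z ρ l g) :
    WeightedOrder q z ρ (k + l) (fun v => f v * g v) := by
  obtain ⟨C, hC, N, hN⟩ := hf
  obtain ⟨D, hD, M, hM⟩ := hg
  refine ⟨C * D, by positivity, N + M, fun v => ?_⟩
  have hw := one_le_weight (z v) (ρ v)
  have hq' := (hq v).le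
  calc |f v * g v| = |f v| * |g v| := abs_mul _ _
    _ ≤ (C * q v ^ k * (1 + |z v| + |ρ v|) ^ N) * (D * q v ^ l * (1 + |z v| + |ρ v|) ^ M) :=
        mul_le_mul (hN v) (hM v) (abs_nonneg _) (by positivity)
    _ = _ := by ring

lemma mono (hq : ∀ v, 0 < q v) (hq1 : ∀ v, q v ≤ 1) (hf : WeightedOrder q z ρ l f) (h : k ≤ l) :
    WeightedOrder q z ρ k f := by
  obtain ⟨C, hC, N, hN⟩ := hf
  refine ⟨C, hC, N, fun v => (hN v).trans ?_⟩
  have hw := one_le_weight (z v) (ρ v)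
  have : q v ^ l ≤ q v ^ k := pow_le_pow_of_le_one (hq v).le (hq1 v) h
  gcongr

lemma of_bounded {K : ℝ} (h : ∀ v, |f v| ≤ K) : WeightedOrder q z ρ 0 f := by
  refine ⟨max K 0, le_max_right _ _, 0, fun v => ?_⟩
  simpa using Or.inl (h v)

lemma const (c : ℝ) : WeightedOrder q z ρ 0 (fun _ => c) := of_bounded (K := |c|) fun _ => le_rfl

lemma self_left : WeightedOrder q z ρ 0 z := by
  refine ⟨1, zero_le_one, 1, fun v => ?_⟩
  have := abs_nonneg (ρ v); simp; linarith

lemma self_right : WeightedOrder q z ρ 0 ρ := by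
  refine ⟨1, zero_le_one, 1, fun v => ?_⟩
  have := abs_nonneg (z v); simp; linarith

lemma pow_parameter (hq : ∀ v, 0 < q v) (k : ℕ) : WeightedOrder q z ρ k (fun v => q v ^ k) := by
  refine ⟨1, zero_le_one, 0, fun v => ?_⟩
  simp [abs_of_pos (hq v)]

lemma mul₀ (hq : ∀ v, 0 < q v) (hf : WeightedOrder q z ρ 0 f) (hg : WeightedOrder q z ρ 0 g) :
    WeightedOrder q z ρ 0 (fun v => f v * g v) := mul hq hf hg

lemma const_mul (hq : ∀ v, 0 < q v) (c : ℝ) (hf : WeightedOrder q z ρ k f) :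
    WeightedOrder q z ρ k (fun v => c * f v) := by
  simpa using mul hq (const c) hf

lemma pow₀ (hq : ∀ v, 0 < q v) (hf : WeightedOrder q z ρ 0 f) (n : ℕ) :
    WeightedOrder q z ρ 0 (fun v => f v ^ n) := by
  induction n with
  | zero => simpa using const (q := q) (z := z) (ρ := ρ) 1
  | succ n ih => simpa [pow_succ] using mul₀ hq ih hf

end WeightedOrder

/-- `f` has the third order expansion `a₀ + q a₁ + q² a₂ + q³ a₃` in the small parameter `q`, with
coefficients of polynomial growth in the weights and a remainder of weighted order four. -/
structure ExpandsTo {V : Type*} (q z ρ : V → ℝ) (f a₀ a₁ a₂ a₃ : V → ℝ) : Prop where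
  coeff₀ : WeightedOrder q z ρ 0 a₀
  coeff₁ : WeightedOrder q z ρ 0 a₁
  coeff₂ : WeightedOrder q z ρ 0 a₂
  coeff₃ : WeightedOrder q z ρ 0 a₃
  remainder : WeightedOrder q z ρ 4
    (fun v => f v - (a₀ v + q v * a₁ v + q v ^ 2 * a₂ v + q v ^ 3 * a₃ v))

namespace ExpandsTo

variable {V : Type*} {q z ρ : V → ℝ} {f g a₀ a₁ a₂ a₃ b₀ b₁ b₂ b₃ : V → ℝ}

lemma congr (hf : ExpandsTo q z ρ f a₀ a₁ a₂ a₃) (hg : ∀ v, g v = f v) (h₀ : ∀ v, b₀ v = a₀ v)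
    (h₁ : ∀ v, b₁ v = a₁ v) (h₂ : ∀ v, b₂ v = a₂ v) (h₃ : ∀ v, b₃ v = a₃ v) :
    ExpandsTo q z ρ g b₀ b₁ b₂ b₃ := by
  obtain rfl := funext hg
  obtain rfl := funext h₀
  obtain rfl := funext h₁
  obtain rfl := funext h₂
  obtain rfl := funext h₃
  exact hf

lemma add (hq : ∀ v, 0 < q v) (hf : ExpandsTo q z ρ f a₀ a₁ a₂ a₃)
    (hg : ExpandsTo q z ρ g b₀ b₁ b₂ b₃) :
    ExpandsTo q z ρ (fun v => f v + g v) (fun v => a₀ v + b₀ v) (fun v => a₁ v + b₁ v)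
      (fun v => a₂ v + b₂ v) (fun v => a₃ v + b₃ v) where
  coeff₀ := hf.coeff₀.add hq hg.coeff₀
  coeff₁ := hf.coeff₁.add hq hg.coeff₁
  coeff₂ := hf.coeff₂.add hq hg.coeff₂
  coeff₃ := hf.coeff₃.add hq hg.coeff₃
  remainder := (hf.remainder.add hq hg.remainder).of_abs_le fun v => le_of_eq <| by
    congr 1; ring

/-- The truncated Cauchy product: the discarded part is `q ^ 4` times the coefficients of order
four to six, plus products with the remainders. -/
lemma mul (hq : ∀ v, 0 < q v) (hq1 : ∀ v, q v ≤ 1) (hf : ExpandsTo q z ρ f a₀ a₁ a₂ a₃)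
    (hg : ExpandsTo q z ρ g b₀ b₁ b₂ b₃) :
    ExpandsTo q z ρ (fun v => f v * g v) (fun v => a₀ v * b₀ v)
      (fun v => a₀ v * b₁ v + a₁ v * b₀ v)
      (fun v => a₀ v * b₂ v + (a₁ v * b₁ v + a₂ v * b₀ v))
      (fun v => a₀ v * b₃ v + (a₁ v * b₂ v + (a₂ v * b₁ v + a₃ v * b₀ v))) where
  coeff₀ := hf.coeff₀.mul₀ hq hg.coeff₀
  coeff₁ := (hf.coeff₀.mul₀ hq hg.coeff₁).add hq (hf.coeff₁.mul₀ hq hg.coeff₀)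
  coeff₂ := (hf.coeff₀.mul₀ hq hg.coeff₂).add hq ((hf.coeff₁.mul₀ hq hg.coeff₁).add hq
    (hf.coeff₂.mul₀ hq hg.coeff₀))
  coeff₃ := (hf.coeff₀.mul₀ hq hg.coeff₃).add hq ((hf.coeff₁.mul₀ hq hg.coeff₂).add hq
    ((hf.coeff₂.mul₀ hq hg.coeff₁).add hq (hf.coeff₃.mul₀ hq hg.coeff₀)))
  remainder := by
    have hQ (n : ℕ) : WeightedOrder q z ρ 0 (fun v => q v ^ n) :=
      (WeightedOrder.pow_parameter hq n).mono hq hq1 (Nat.zero_le n)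
    have hQ1 : WeightedOrder q z ρ 0 q := by simpa using hQ 1
    -- the two truncations are bounded by the weights
    have hA : WeightedOrder q z ρ 0
        (fun v => a₀ v + q v * a₁ v + q v ^ 2 * a₂ v + q v ^ 3 * a₃ v) :=
      ((hf.coeff₀.add hq (hQ1.mul₀ hq hf.coeff₁)).add hq ((hQ 2).mul₀ hq hf.coeff₂)).add hq
        ((hQ 3).mul₀ hq hf.coeff₃)
    have hB : WeightedOrder q z ρ 0
        (fun v => b₀ v + q v * b₁ v + q v ^ 2 * b₂ v + q v ^ 3 * b₃ v) :=
      ((hg.coeff₀.add hq (hQ1.mul₀ hq hg.coeff₁)).add hq ((hQ 2).mul₀ hq hg.coeff₂)).add hq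
        ((hQ 3).mul₀ hq hg.coeff₃)
    have h1 := hf.remainder.mul hq hB
    have h2 := hA.mul hq hg.remainder
    have h3 := (hf.remainder.mul hq hg.remainder).mono hq hq1 (k := 4) (by norm_num)
    have h4 := (WeightedOrder.pow_parameter (z := z) (ρ := ρ) hq 4).mul hq
      (((((hf.coeff₁.mul₀ hq hg.coeff₃).add hq (hf.coeff₂.mul₀ hq hg.coeff₂)).add hq
        (hf.coeff₃.mul₀ hq hg.coeff₁)).add hq
        (hQ1.mul₀ hq ((hf.coeff₂.mul₀ hq hg.coeff₃).add hq (hf.coeff₃.mul₀ hq hg.coeff₂)))).add hq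
        ((hQ 2).mul₀ hq (hf.coeff₃.mul₀ hq hg.coeff₃)))
    refine (((h1.add hq (h2.mono hq hq1 (k := 4) (by norm_num))).add hq h3).add hq h4).of_abs_le
      fun v => le_of_eq ?_
    congr 1; ring

lemma of_weightedOrder (hf : WeightedOrder q z ρ 0 f) :
    ExpandsTo q z ρ f f (fun _ => 0) (fun _ => 0) (fun _ => 0) where
  coeff₀ := hf
  coeff₁ := .const 0
  coeff₂ := .const 0
  coeff₃ := .const 0
  remainder := ⟨0, le_rfl, 0, fun v => by simp⟩

lemma const_mul (hq : ∀ v, 0 < q v) (c : ℝ) (hf : ExpandsTo q z ρ f a₀ a₁ a₂ a₃) :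
    ExpandsTo q z ρ (fun v => c * f v) (fun v => c * a₀ v) (fun v => c * a₁ v)
      (fun v => c * a₂ v) (fun v => c * a₃ v) where
  coeff₀ := hf.coeff₀.const_mul hq c
  coeff₁ := hf.coeff₁.const_mul hq c
  coeff₂ := hf.coeff₂.const_mul hq c
  coeff₃ := hf.coeff₃.const_mul hq c
  remainder := (hf.remainder.const_mul hq c).of_abs_le fun v => le_of_eq <| by congr 1; ring

lemma weightedOrder (hq : ∀ v, 0 < q v) (hq1 : ∀ v, q v ≤ 1)
    (hf : ExpandsTo q z ρ f a₀ a₁ a₂ a₃) : WeightedOrder q z ρ 0 f := by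
  have hQ (n : ℕ) : WeightedOrder q z ρ 0 (fun v => q v ^ n) :=
    (WeightedOrder.pow_parameter hq n).mono hq hq1 (Nat.zero_le n)
  have hQ1 : WeightedOrder q z ρ 0 q := by simpa using hQ 1
  have hA := ((hf.coeff₀.add hq (hQ1.mul₀ hq hf.coeff₁)).add hq ((hQ 2).mul₀ hq hf.coeff₂)).add hq
        ((hQ 3).mul₀ hq hf.coeff₃)
  refine (hA.add hq (hf.remainder.mono hq hq1 (Nat.zero_le 4))).of_abs_le fun v => le_of_eq ?_
  congr 1; ring

/-- An expansion without constant term is of weighted order one. -/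
lemma weightedOrder_one (hq : ∀ v, 0 < q v) (hq1 : ∀ v, q v ≤ 1)
    (hf : ExpandsTo q z ρ f (fun _ => 0) a₁ a₂ a₃) : WeightedOrder q z ρ 1 f := by
  have hP (n : ℕ) := WeightedOrder.pow_parameter (z := z) (ρ := ρ) hq n
  have h1 := ((hP 1).mul hq hf.coeff₁)
  have h2 := ((hP 2).mul hq hf.coeff₂).mono hq hq1 (k := 1) (by norm_num)
  have h3 := ((hP 3).mul hq hf.coeff₃).mono hq hq1 (k := 1) (by norm_num)
  refine (((h1.add hq h2).add hq h3).add hq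
    (hf.remainder.mono hq hq1 (k := 1) (by norm_num))).of_abs_le fun v => le_of_eq ?_
  congr 1; ring

end ExpandsTo

/-- The Taylor data of a boundary arc and a density at a boundary point, in the rescaled variables
in which `q` is the square root of time, `q * z` the tangential coordinate of a point of the arc
and `q * ρ` the signed distance of the target. At that point `Y` is the height of the arc above its
tangent, `U` its slope and `S` the density; `κ, γ₃, γ₄` and `σ₀, …, σ₃` are the derivatives at the
base point. All bounds are by one constant `K`. -/
structure ScaledData (K : ℝ) where
  (q z ρ Y U S κ γ₃ γ₄ σ₀ σ₁ σ₂ σ₃ : ℝ)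
  q_pos : 0 < q
  q_le : q ≤ 1
  κ_le : |κ| ≤ K
  γ₃_le : |γ₃| ≤ K
  γ₄_le : |γ₄| ≤ K
  σ₀_le : |σ₀| ≤ K
  σ₁_le : |σ₁| ≤ K
  σ₂_le : |σ₂| ≤ K
  σ₃_le : |σ₃| ≤ K
  Y_le : |Y - (κ * (q * z) ^ 2 / 2 + γ₃ * (q * z) ^ 3 / 6 + γ₄ * (q * z) ^ 4 / 24)|
    ≤ K * |q * z| ^ 5
  U_le : |U - (κ * (q * z) + γ₃ * (q * z) ^ 2 / 2 + γ₄ * (q * z) ^ 3 / 6)| ≤ K * |q * z| ^ 4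
  S_le : |S - (σ₀ + σ₁ * (q * z) + σ₂ * (q * z) ^ 2 / 2 + σ₃ * (q * z) ^ 3 / 6)|
    ≤ K * |q * z| ^ 4

namespace ScaledData

variable {K : ℝ}

/-- Coefficient of `q` in the exponent. -/
noncomputable def w₁ (v : ScaledData K) : ℝ := v.ρ * v.κ * v.z ^ 2 / 4

/-- Coefficient of `q ^ 2` in the exponent. -/
noncomputable def w₂ (v : ScaledData K) : ℝ := v.ρ * v.γ₃ * v.z ^ 3 / 12 - v.κ ^ 2 * v.z ^ 4 / 16

/-- Coefficient of `q ^ 3` in the exponent. -/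
noncomputable def w₃ (v : ScaledData K) : ℝ := v.ρ * v.γ₄ * v.z ^ 4 / 48 - v.κ * v.γ₃ * v.z ^ 5 / 24

/-- The third order expansion in `q` of the integrand, without its Gaussian factor. -/
noncomputable def expansion (v : ScaledData K) : ℝ :=
  v.σ₀
  + v.q * (v.σ₁ * v.z + v.σ₀ * v.w₁)
  + v.q ^ 2 * ((v.σ₂ / 2 + v.σ₀ * v.κ ^ 2 / 2) * v.z ^ 2 + v.σ₁ * v.z * v.w₁
      + v.σ₀ * (v.w₂ + v.w₁ ^ 2 / 2))
  + v.q ^ 3 * ((v.σ₃ / 6 + v.σ₁ * v.κ ^ 2 / 2 + v.σ₀ * v.κ * v.γ₃ / 2) * v.z ^ 3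
      + (v.σ₂ / 2 + v.σ₀ * v.κ ^ 2 / 2) * v.z ^ 2 * v.w₁
      + v.σ₁ * v.z * (v.w₂ + v.w₁ ^ 2 / 2)
      + v.σ₀ * (v.w₃ + v.w₁ * v.w₂ + v.w₁ ^ 3 / 6))


/-- The height divided by `2 q`, whose expansion starts at order one. -/
noncomputable def y (v : ScaledData K) : ℝ := v.Y / (2 * v.q)

lemma weightedOrder_expansion_coeffs :
    WeightedOrder (V := ScaledData K) q z ρ 0 κ ∧ WeightedOrder (V := ScaledData K) q z ρ 0 γ₃ ∧
    WeightedOrder (V := ScaledData K) q z ρ 0 γ₄ ∧ WeightedOrder (V := ScaledData K) q z ρ 0 σ₀ ∧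
    WeightedOrder (V := ScaledData K) q z ρ 0 σ₁ ∧ WeightedOrder (V := ScaledData K) q z ρ 0 σ₂ ∧
    WeightedOrder (V := ScaledData K) q z ρ 0 σ₃ :=
  ⟨.of_bounded κ_le, .of_bounded γ₃_le, .of_bounded γ₄_le, .of_bounded σ₀_le, .of_bounded σ₁_le,
    .of_bounded σ₂_le, .of_bounded σ₃_le⟩

lemma weightedOrder_of_abs_le {f : ScaledData K → ℝ} (C : ℝ) (hC : 0 ≤ C) (n : ℕ)
    (h : ∀ v, |f v| ≤ C * v.q ^ 4 * |v.z| ^ n) : WeightedOrder q z ρ 4 f := by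
  refine ⟨C, hC, n, fun v => (h v).trans ?_⟩
  have h1 := v.q_pos
  have h2 : |v.z| ≤ 1 + |v.z| + |v.ρ| := by have := abs_nonneg v.ρ; linarith
  gcongr

lemma y_expandsTo : ExpandsTo (V := ScaledData K) q z ρ y (fun _ => 0) (fun v => v.κ * v.z ^ 2 / 4)
    (fun v => v.γ₃ * v.z ^ 3 / 12) (fun v => v.γ₄ * v.z ^ 4 / 48) := by
  have hq (v : ScaledData K) : 0 < v.q := v.q_pos
  obtain ⟨hκ, h3, h4, -⟩ := weightedOrder_expansion_coeffs (K := K)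
  have hz (n : ℕ) : WeightedOrder (V := ScaledData K) q z ρ 0 (fun v => v.z ^ n) :=
    WeightedOrder.self_left.pow₀ hq n
  refine ⟨.const 0, ?_, ?_, ?_, ?_⟩
  · exact ((hκ.mul₀ hq (hz 2)).const_mul hq (1 / 4)).of_abs_le fun v => by
      apply le_of_eq; congr 1; ring
  · exact ((h3.mul₀ hq (hz 3)).const_mul hq (1 / 12)).of_abs_le fun v => by
      apply le_of_eq; congr 1; ring
  · exact ((h4.mul₀ hq (hz 4)).const_mul hq (1 / 48)).of_abs_le fun v => by
      apply le_of_eq; congr 1; ring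
  · refine weightedOrder_of_abs_le (|K| / 2) (by positivity) 5 fun v => ?_
    have h0 := v.q_pos
    have h1 : v.y - (0 + v.q * (v.κ * v.z ^ 2 / 4) + v.q ^ 2 * (v.γ₃ * v.z ^ 3 / 12)
        + v.q ^ 3 * (v.γ₄ * v.z ^ 4 / 48)) = (v.Y - (v.κ * (v.q * v.z) ^ 2 / 2
        + v.γ₃ * (v.q * v.z) ^ 3 / 6 + v.γ₄ * (v.q * v.z) ^ 4 / 24)) / (2 * v.q) := by
      unfold y; field_simp; ring
    rw [h1, abs_div, abs_of_pos (show 0 < 2 * v.q by positivity), div_le_iff₀ (by positivity)]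
    refine v.Y_le.trans ?_
    rw [abs_mul, abs_of_pos h0]
    calc K * (v.q * |v.z|) ^ 5 ≤ |K| * (v.q * |v.z|) ^ 5 := by gcongr; exact le_abs_self K
      _ = _ := by ring

/-- The exponent `w = (2 (q ρ) Y - Y²) / (4 q²)`, written through `y = Y / (2 q)`. -/
lemma exponent_expandsTo : ExpandsTo (V := ScaledData K) q z ρ (fun v => v.ρ * v.y - v.y ^ 2)
    (fun _ => 0) w₁ w₂ w₃ := by
  have hq (v : ScaledData K) : 0 < v.q := v.q_pos
  have hq1 (v : ScaledData K) : v.q ≤ 1 := v.q_le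
  refine (((ExpandsTo.of_weightedOrder WeightedOrder.self_right).mul hq hq1 y_expandsTo).add hq
    ((y_expandsTo.mul hq hq1 y_expandsTo).const_mul hq (-1))).congr (fun v => by ring)
    (fun v => by ring) (fun v => by simp only [w₁]; ring) (fun v => by simp only [w₂]; ring)
    (fun v => by simp only [w₃]; ring)

/-- The cubic Taylor polynomial of the exponential. -/
noncomputable def cubicExp (w : ℝ) : ℝ := 1 + w + w ^ 2 / 2 + w ^ 3 / 6

lemma abs_exp_sub_cubicExp_le (w : ℝ) : |Real.exp w - cubicExp w| ≤ w ^ 4 * Real.exp |w| := by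
  have h := Complex.norm_exp_sub_sum_le_norm_mul_exp (w : ℂ) 4
  have h2 : Complex.exp w - ∑ m ∈ Finset.range 4, (w : ℂ) ^ m / (m.factorial : ℂ)
      = ((Real.exp w - cubicExp w : ℝ) : ℂ) := by
    simp [Finset.sum_range_succ, cubicExp, Nat.factorial]
  rw [h2, Complex.norm_real, Complex.norm_real, Real.norm_eq_abs, Real.norm_eq_abs] at h
  rwa [← abs_pow, abs_of_nonneg (by positivity : 0 ≤ w ^ 4)] at h

lemma cubicExp_expandsTo : ExpandsTo (V := ScaledData K) q z ρ
    (fun v => cubicExp (v.ρ * v.y - v.y ^ 2)) (fun _ => 1) w₁ (fun v => v.w₂ + v.w₁ ^ 2 / 2)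
    (fun v => v.w₃ + v.w₁ * v.w₂ + v.w₁ ^ 3 / 6) := by
  have hq (v : ScaledData K) : 0 < v.q := v.q_pos
  have hq1 (v : ScaledData K) : v.q ≤ 1 := v.q_le
  have hw := exponent_expandsTo (K := K)
  have hw2 := hw.mul hq hq1 hw
  have hw3 := hw.mul hq hq1 hw2
  refine ((((ExpandsTo.of_weightedOrder (.const 1)).add hq hw).add hq
    (hw2.const_mul hq (1 / 2))).add hq (hw3.const_mul hq (1 / 6))).congr
    (fun v => by simp only [cubicExp]; ring) ?_ ?_ ?_ ?_ <;> intro v <;> ring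

lemma slope_expandsTo : ExpandsTo (V := ScaledData K) q z ρ U (fun _ => 0) (fun v => v.κ * v.z)
    (fun v => v.γ₃ * v.z ^ 2 / 2) (fun v => v.γ₄ * v.z ^ 3 / 6) := by
  have hq (v : ScaledData K) : 0 < v.q := v.q_pos
  obtain ⟨hκ, h3, h4, -⟩ := weightedOrder_expansion_coeffs (K := K)
  have hz (n : ℕ) : WeightedOrder (V := ScaledData K) q z ρ 0 (fun v => v.z ^ n) :=
    WeightedOrder.self_left.pow₀ hq n
  refine ⟨.const 0, hκ.mul₀ hq .self_left, ?_, ?_, ?_⟩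
  · exact ((h3.mul₀ hq (hz 2)).const_mul hq (1 / 2)).of_abs_le fun v => by
      apply le_of_eq; congr 1; ring
  · exact ((h4.mul₀ hq (hz 3)).const_mul hq (1 / 6)).of_abs_le fun v => by
      apply le_of_eq; congr 1; ring
  · refine weightedOrder_of_abs_le |K| (by positivity) 4 fun v => ?_
    have h0 := v.q_pos
    have h := v.U_le
    rw [abs_mul, abs_of_pos h0] at h
    calc _ = |v.U - (v.κ * (v.q * v.z) + v.γ₃ * (v.q * v.z) ^ 2 / 2
            + v.γ₄ * (v.q * v.z) ^ 3 / 6)| := by congr 1; ring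
      _ ≤ K * (v.q * |v.z|) ^ 4 := h
      _ ≤ |K| * (v.q * |v.z|) ^ 4 := by gcongr; exact le_abs_self K
      _ = _ := by ring

lemma density_expandsTo : ExpandsTo (V := ScaledData K) q z ρ S σ₀ (fun v => v.σ₁ * v.z)
    (fun v => v.σ₂ * v.z ^ 2 / 2) (fun v => v.σ₃ * v.z ^ 3 / 6) := by
  have hq (v : ScaledData K) : 0 < v.q := v.q_pos
  obtain ⟨-, -, -, h0, h1, h2, h3⟩ := weightedOrder_expansion_coeffs (K := K)
  have hz (n : ℕ) : WeightedOrder (V := ScaledData K) q z ρ 0 (fun v => v.z ^ n) :=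
    WeightedOrder.self_left.pow₀ hq n
  refine ⟨h0, h1.mul₀ hq .self_left, ?_, ?_, ?_⟩
  · exact ((h2.mul₀ hq (hz 2)).const_mul hq (1 / 2)).of_abs_le fun v => by
      apply le_of_eq; congr 1; ring
  · exact ((h3.mul₀ hq (hz 3)).const_mul hq (1 / 6)).of_abs_le fun v => by
      apply le_of_eq; congr 1; ring
  · refine weightedOrder_of_abs_le |K| (by positivity) 4 fun v => ?_
    have h0 := v.q_pos
    have h := v.S_le
    rw [abs_mul, abs_of_pos h0] at h
    calc _ = |v.S - (v.σ₀ + v.σ₁ * (v.q * v.z) + v.σ₂ * (v.q * v.z) ^ 2 / 2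
            + v.σ₃ * (v.q * v.z) ^ 3 / 6)| := by congr 1; ring
      _ ≤ K * (v.q * |v.z|) ^ 4 := h
      _ ≤ |K| * (v.q * |v.z|) ^ 4 := by gcongr; exact le_abs_self K
      _ = _ := by ring

lemma abs_sqrt_one_add_sub_le {u : ℝ} (hu : 0 ≤ u) : |√(1 + u) - (1 + u / 2)| ≤ u ^ 2 := by
  have h1 : √(1 + u) ≤ 1 + u / 2 := by
    rw [Real.sqrt_le_left (by positivity)]; nlinarith
  have h2 : 1 + u / 2 - u ^ 2 ≤ √(1 + u) := by
    by_cases h : 1 + u / 2 - u ^ 2 ≤ 0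
    · exact h.trans (Real.sqrt_nonneg _)
    · push Not at h
      apply Real.le_sqrt_of_sq_le
      have : u ≤ 2 := by nlinarith
      nlinarith [pow_nonneg hu 3, pow_nonneg hu 2, mul_nonneg (pow_nonneg hu 3) (sub_nonneg.2 this)]
  rw [abs_le]
  constructor <;> linarith

lemma arclength_expandsTo : ExpandsTo (V := ScaledData K) q z ρ (fun v => √(1 + v.U ^ 2))
    (fun _ => 1) (fun _ => 0) (fun v => v.κ ^ 2 * v.z ^ 2 / 2)
    (fun v => v.κ * v.γ₃ * v.z ^ 3 / 2) := by
  have hq (v : ScaledData K) : 0 < v.q := v.q_pos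
  have hq1 (v : ScaledData K) : v.q ≤ 1 := v.q_le
  have hU2 := slope_expandsTo (K := K).mul hq hq1 slope_expandsTo
  have hlin := ((ExpandsTo.of_weightedOrder (.const 1)).add hq
    (hU2.const_mul hq (1 / 2))).congr (g := fun v => 1 + v.U ^ 2 / 2) (b₀ := fun _ => 1)
    (b₁ := fun _ => 0) (b₂ := fun v => v.κ ^ 2 * v.z ^ 2 / 2)
    (b₃ := fun v => v.κ * v.γ₃ * v.z ^ 3 / 2) (fun v => by ring) (fun v => by ring)
    (fun v => by ring) (fun v => by ring) (fun v => by ring)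
  refine ⟨hlin.coeff₀, hlin.coeff₁, hlin.coeff₂, hlin.coeff₃, ?_⟩
  have hU := slope_expandsTo (K := K).weightedOrder_one hq hq1
  have hU4 := (hU.mul hq hU).mul hq (hU.mul hq hU)
  have hrem : WeightedOrder (V := ScaledData K) q z ρ 4
      (fun v => √(1 + v.U ^ 2) - (1 + v.U ^ 2 / 2)) := hU4.of_abs_le fun v => by
    refine (abs_sqrt_one_add_sub_le (sq_nonneg v.U)).trans (le_of_eq ?_)
    rw [abs_of_nonneg (by nlinarith [sq_nonneg (v.U * v.U)])]; ring
  refine (hrem.add hq hlin.remainder).of_abs_le fun v => le_of_eq ?_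
  congr 1; ring

/-- Everything but the remainder of the exponential series is covered by the truncated product. -/
lemma product_expandsTo : WeightedOrder (V := ScaledData K) q z ρ 4
    (fun v => cubicExp (v.ρ * v.y - v.y ^ 2) * (v.S * √(1 + v.U ^ 2)) - v.expansion) ∧
    WeightedOrder (V := ScaledData K) q z ρ 0 expansion := by
  have hq (v : ScaledData K) : 0 < v.q := v.q_pos
  have hq1 (v : ScaledData K) : v.q ≤ 1 := v.q_le
  have h := cubicExp_expandsTo (K := K).mul hq hq1
    (density_expandsTo.mul hq hq1 arclength_expandsTo)
  have h4 := h.remainder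
  have h0 := (h.weightedOrder hq hq1).add hq
    ((h4.mono hq hq1 (Nat.zero_le 4)).const_mul hq (-1))
  refine ⟨h4.of_abs_le fun v => le_of_eq ?_, h0.of_abs_le fun v => le_of_eq ?_⟩
  · congr 1; simp only [expansion]; ring
  · congr 1; simp only [expansion]; ring

lemma weight_mul_exp_le (N : ℕ) (z ρ : ℝ) :
    (1 + |z| + |ρ|) ^ N * Real.exp (-ρ ^ 2 / 4 - z ^ 2 / 8)
      ≤ N.factorial * Real.exp 13 * Real.exp (-z ^ 2 / 16) := by
  set s := 1 + |z| + |ρ| with hs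
  have h0 : 0 ≤ s := by positivity
  have h1 : s ^ N ≤ N.factorial * Real.exp s := by
    have := Real.pow_div_factorial_le_exp s h0 N
    rwa [div_le_iff₀ (by positivity), mul_comm] at this
  have h2 : s + (-ρ ^ 2 / 4 - z ^ 2 / 8) ≤ 13 + -z ^ 2 / 16 := by
    rw [← sq_abs z, ← sq_abs ρ]
    nlinarith [sq_nonneg (|z| - 8), sq_nonneg (|ρ| - 2), abs_nonneg z, abs_nonneg ρ]
  calc s ^ N * Real.exp (-ρ ^ 2 / 4 - z ^ 2 / 8)
      ≤ (N.factorial * Real.exp s) * Real.exp (-ρ ^ 2 / 4 - z ^ 2 / 8) := by gcongr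
    _ = N.factorial * Real.exp (s + (-ρ ^ 2 / 4 - z ^ 2 / 8)) := by
        rw [Real.exp_add s, mul_assoc]
    _ ≤ N.factorial * Real.exp (13 + -z ^ 2 / 16) := by gcongr
    _ = _ := by rw [Real.exp_add]; ring

lemma exists_abs_mul_exp_le {k : ℕ} {f : ScaledData K → ℝ} (hf : WeightedOrder q z ρ k f) :
    ∃ C, 0 ≤ C ∧ ∀ v, |f v| * Real.exp (-v.ρ ^ 2 / 4 - v.z ^ 2 / 8)
      ≤ C * v.q ^ k * Real.exp (-v.z ^ 2 / 16) := by
  obtain ⟨C, hC, N, h⟩ := hf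
  refine ⟨C * (N.factorial * Real.exp 13), by positivity, fun v => ?_⟩
  have h0 := v.q_pos
  calc |f v| * Real.exp (-v.ρ ^ 2 / 4 - v.z ^ 2 / 8)
      ≤ (C * v.q ^ k * (1 + |v.z| + |v.ρ|) ^ N) * Real.exp (-v.ρ ^ 2 / 4 - v.z ^ 2 / 8) := by
        gcongr; exact h v
    _ = C * v.q ^ k * ((1 + |v.z| + |v.ρ|) ^ N * Real.exp (-v.ρ ^ 2 / 4 - v.z ^ 2 / 8)) := by ring
    _ ≤ C * v.q ^ k * (N.factorial * Real.exp 13 * Real.exp (-v.z ^ 2 / 16)) := by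
        exact mul_le_mul_of_nonneg_left (weight_mul_exp_le N v.z v.ρ) (by positivity)
    _ = _ := by ring

/-- Where the exponent `w` is at most `z² / 8`, half of the Gaussian in `z` absorbs it, and the
integrand agrees with its expansion up to `q ^ 4` times a Gaussian. -/
theorem exists_abs_sub_expansion_le (K : ℝ) : ∃ C, 0 ≤ C ∧ ∀ v : ScaledData K,
    |2 * (v.q * v.ρ) * v.Y - v.Y ^ 2| ≤ (v.q * v.z) ^ 2 / 2 →
    |Real.exp ((2 * (v.q * v.ρ) * v.Y - v.Y ^ 2) / (4 * v.q ^ 2)) * (v.S * √(1 + v.U ^ 2))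
        - v.expansion| * Real.exp (-v.ρ ^ 2 / 4 - v.z ^ 2 / 4)
      ≤ C * v.q ^ 4 * Real.exp (-v.z ^ 2 / 16) := by
  have hq (v : ScaledData K) : 0 < v.q := v.q_pos
  have hq1 (v : ScaledData K) : v.q ≤ 1 := v.q_le
  have hw := exponent_expandsTo (K := K).weightedOrder_one hq hq1
  have hw4 := ((hw.mul hq hw).mul hq (hw.mul hq hw)).mul hq
    ((density_expandsTo.mul hq hq1 arclength_expandsTo).weightedOrder hq hq1)
  obtain ⟨C, hC, hCb⟩ := exists_abs_mul_exp_le (product_expandsTo (K := K)).1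
  obtain ⟨D, hD, hDb⟩ := exists_abs_mul_exp_le hw4
  refine ⟨C + D, by positivity, fun v hv => ?_⟩
  specialize hCb v
  specialize hDb v
  have h0 := v.q_pos
  have hwv : (2 * (v.q * v.ρ) * v.Y - v.Y ^ 2) / (4 * v.q ^ 2) = v.ρ * v.y - v.y ^ 2 := by
    unfold y; field_simp; ring
  have hwz : |v.ρ * v.y - v.y ^ 2| ≤ v.z ^ 2 / 8 := by
    rw [← hwv, abs_div, abs_of_pos (show 0 < 4 * v.q ^ 2 by positivity),
      div_le_iff₀ (by positivity)]
    linarith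
  rw [hwv]
  generalize v.ρ * v.y - v.y ^ 2 = w at *
  generalize v.S * √(1 + v.U ^ 2) = g at *
  have he := abs_exp_sub_cubicExp_le w
  have hsplit : |Real.exp w * g - v.expansion|
      ≤ |cubicExp w * g - v.expansion| + |w * w * (w * w) * g| * Real.exp (v.z ^ 2 / 8) := by
    have : Real.exp w * g - v.expansion
      = (cubicExp w * g - v.expansion) + (Real.exp w - cubicExp w) * g := by ring
    rw [this]
    refine (abs_add_le _ _).trans (add_le_add le_rfl ?_)
    rw [abs_mul, abs_mul (w * w * (w * w)),
      abs_of_nonneg (show 0 ≤ w * w * (w * w) by nlinarith [sq_nonneg (w * w)])]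
    calc |Real.exp w - cubicExp w| * |g| ≤ (w ^ 4 * Real.exp |w|) * |g| := by gcongr
      _ ≤ (w ^ 4 * Real.exp (v.z ^ 2 / 8)) * |g| := by gcongr
      _ = _ := by ring
  have hexp : Real.exp (-v.ρ ^ 2 / 4 - v.z ^ 2 / 4) ≤ Real.exp (-v.ρ ^ 2 / 4 - v.z ^ 2 / 8) := by
    rw [Real.exp_le_exp]; nlinarith [sq_nonneg v.z]
  have hexp2 : Real.exp (v.z ^ 2 / 8) * Real.exp (-v.ρ ^ 2 / 4 - v.z ^ 2 / 4)
      = Real.exp (-v.ρ ^ 2 / 4 - v.z ^ 2 / 8) := by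
    rw [← Real.exp_add]; congr 1; ring
  calc _ ≤ (|cubicExp w * g - v.expansion| + |w * w * (w * w) * g| * Real.exp (v.z ^ 2 / 8))
        * Real.exp (-v.ρ ^ 2 / 4 - v.z ^ 2 / 4) := by gcongr
    _ = |cubicExp w * g - v.expansion| * Real.exp (-v.ρ ^ 2 / 4 - v.z ^ 2 / 4)
        + |w * w * (w * w) * g| * (Real.exp (v.z ^ 2 / 8)
          * Real.exp (-v.ρ ^ 2 / 4 - v.z ^ 2 / 4)) := by ring
    _ ≤ |cubicExp w * g - v.expansion| * Real.exp (-v.ρ ^ 2 / 4 - v.z ^ 2 / 8)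
        + |w * w * (w * w) * g| * Real.exp (-v.ρ ^ 2 / 4 - v.z ^ 2 / 8) := by
        rw [hexp2]; gcongr
    _ ≤ C * v.q ^ 4 * Real.exp (-v.z ^ 2 / 16) + D * v.q ^ 4 * Real.exp (-v.z ^ 2 / 16) :=
        add_le_add hCb (by simpa using hDb)
    _ = _ := by ring

/-- At distance `a` from the base point the expansion itself is of fourth order, because there
`1 ≤ (q z / a) ^ 4`. -/
theorem exists_abs_expansion_le (K : ℝ) {a : ℝ} (ha : 0 < a) : ∃ C, 0 ≤ C ∧ ∀ v : ScaledData K,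
    a ≤ |v.q * v.z| → |v.expansion| * Real.exp (-v.ρ ^ 2 / 4 - v.z ^ 2 / 4)
      ≤ C * v.q ^ 4 * Real.exp (-v.z ^ 2 / 16) := by
  have hq (v : ScaledData K) : 0 < v.q := v.q_pos
  have hz : WeightedOrder (V := ScaledData K) q z ρ 0 (fun v => v.z ^ 4) :=
    WeightedOrder.self_left.pow₀ hq 4
  obtain ⟨C, hC, hCb⟩ := exists_abs_mul_exp_le ((product_expandsTo (K := K)).2.mul₀ hq hz)
  refine ⟨C / a ^ 4, by positivity, fun v hv => ?_⟩
  specialize hCb v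
  have h0 := v.q_pos
  have h1 : 1 ≤ v.q ^ 4 * v.z ^ 4 / a ^ 4 := by
    rw [le_div_iff₀ (by positivity), one_mul, ← mul_pow]
    calc a ^ 4 ≤ |v.q * v.z| ^ 4 := by gcongr
      _ = _ := by rw [← abs_pow, abs_of_nonneg (by positivity)]
  have hexp : Real.exp (-v.ρ ^ 2 / 4 - v.z ^ 2 / 4) ≤ Real.exp (-v.ρ ^ 2 / 4 - v.z ^ 2 / 8) := by
    rw [Real.exp_le_exp]; nlinarith [sq_nonneg v.z]
  rw [abs_mul, abs_of_nonneg (show 0 ≤ v.z ^ 4 by positivity)] at hCb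
  calc |v.expansion| * Real.exp (-v.ρ ^ 2 / 4 - v.z ^ 2 / 4)
      ≤ |v.expansion| * Real.exp (-v.ρ ^ 2 / 4 - v.z ^ 2 / 8) * 1 := by rw [mul_one]; gcongr
    _ ≤ |v.expansion| * Real.exp (-v.ρ ^ 2 / 4 - v.z ^ 2 / 8)
        * (v.q ^ 4 * v.z ^ 4 / a ^ 4) := by gcongr
    _ = |v.expansion| * v.z ^ 4 * Real.exp (-v.ρ ^ 2 / 4 - v.z ^ 2 / 8)
        * (v.q ^ 4 / a ^ 4) := by ring
    _ ≤ C * v.q ^ 0 * Real.exp (-v.z ^ 2 / 16) * (v.q ^ 4 / a ^ 4) := by gcongr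
    _ = _ := by ring

end ScaledData

/-! ### Gaussian moments and the contribution of an arc near the target -/

lemma integrable_pow_mul_gaussian {t : ℝ} (ht : 0 < t) (n : ℕ) :
    Integrable fun ξ : ℝ => ξ ^ n * Real.exp (-ξ ^ 2 / (4 * t)) := by
  have h := integrable_rpow_mul_exp_neg_mul_sq (b := 1 / (4 * t)) (by positivity) (s := n)
    (by have := n.cast_nonneg (α := ℝ); linarith)
  refine h.congr (.of_forall fun ξ => ?_)
  simp only [Real.rpow_natCast]
  congr 2; ring

lemma integral_gaussian_time {t : ℝ} (ht : 0 < t) :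
    ∫ ξ : ℝ, Real.exp (-ξ ^ 2 / (4 * t)) = √(4 * Real.pi * t) := by
  have h := integral_gaussian (1 / (4 * t))
  rw [show Real.pi / (1 / (4 * t)) = 4 * Real.pi * t by field_simp] at h
  rw [← h]
  congr 1; ext ξ; congr 1; ring

lemma hasDerivAt_gaussian_time {t : ℝ} (ht : 0 < t) (ξ : ℝ) :
    HasDerivAt (fun ξ : ℝ => Real.exp (-ξ ^ 2 / (4 * t)))
      (-(ξ / (2 * t)) * Real.exp (-ξ ^ 2 / (4 * t))) ξ := by
  have h := (((hasDerivAt_pow 2 ξ).neg).div_const (4 * t)).exp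
  refine h.congr_deriv ?_
  simp; field_simp; norm_num

lemma integral_mul_gaussian {t : ℝ} (ht : 0 < t) :
    ∫ ξ : ℝ, ξ ^ 1 * Real.exp (-ξ ^ 2 / (4 * t)) = 0 := by
  have h := integral_eq_zero_of_hasDerivAt_of_integrable (hasDerivAt_gaussian_time ht)
    (((integrable_pow_mul_gaussian ht 1).const_mul (-(1 / (2 * t)))).congr
      (.of_forall fun ξ => by simp only [pow_one]; ring))
    ((integrable_pow_mul_gaussian ht 0).congr (.of_forall fun ξ => by simp))
  have h2 : ∀ ξ : ℝ, -(ξ / (2 * t)) * Real.exp (-ξ ^ 2 / (4 * t))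
      = -(1 / (2 * t)) * (ξ ^ 1 * Real.exp (-ξ ^ 2 / (4 * t))) := fun ξ => by ring
  simp_rw [h2, integral_const_mul] at h
  have : -(1 / (2 * t)) ≠ 0 := by simp; positivity
  exact (mul_eq_zero.1 h).resolve_left this

lemma integral_pow_add_two_mul_gaussian {t : ℝ} (ht : 0 < t) (n : ℕ) :
    ∫ ξ : ℝ, ξ ^ (n + 2) * Real.exp (-ξ ^ 2 / (4 * t))
      = 2 * t * (n + 1) * ∫ ξ : ℝ, ξ ^ n * Real.exp (-ξ ^ 2 / (4 * t)) := by
  have hd (ξ : ℝ) : HasDerivAt (fun ξ : ℝ => ξ ^ (n + 1) * Real.exp (-ξ ^ 2 / (4 * t)))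
      ((n + 1) * (ξ ^ n * Real.exp (-ξ ^ 2 / (4 * t)))
        - 1 / (2 * t) * (ξ ^ (n + 2) * Real.exp (-ξ ^ 2 / (4 * t)))) ξ := by
    refine ((hasDerivAt_pow (n + 1) ξ).mul (hasDerivAt_gaussian_time ht ξ)).congr_deriv ?_
    push_cast; ring
  have h1 := (integrable_pow_mul_gaussian ht n).const_mul ((n : ℝ) + 1)
  have h2 := (integrable_pow_mul_gaussian ht (n + 2)).const_mul (1 / (2 * t))
  have h := integral_eq_zero_of_hasDerivAt_of_integrable hd (h1.sub h2)
    (integrable_pow_mul_gaussian ht (n + 1))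
  rw [integral_sub h1 h2, integral_const_mul, integral_const_mul] at h
  have h3 := sub_eq_zero.1 h
  rw [one_div, eq_comm, inv_mul_eq_iff_eq_mul₀ (by positivity)] at h3
  rw [h3]; ring

/-- The derivatives at a boundary point that enter the expansion: `κ, γ₃, γ₄` of the boundary graph
over its tangent (of orders two to four) and `σ₀, …, σ₃` of the density along the tangent. -/
structure BoundaryJet where
  (κ γ₃ γ₄ σ₀ σ₁ σ₂ σ₃ : ℝ)

namespace BoundaryJet

/-- All entries of the jet are at most `K` in absolute value. -/
structure BoundedBy (j : BoundaryJet) (K : ℝ) : Prop where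
  κ_le : |j.κ| ≤ K
  γ₃_le : |j.γ₃| ≤ K
  γ₄_le : |j.γ₄| ≤ K
  σ₀_le : |j.σ₀| ≤ K
  σ₁_le : |j.σ₁| ≤ K
  σ₂_le : |j.σ₂| ≤ K
  σ₃_le : |j.σ₃| ≤ K

/-- The polynomial in the tangential coordinate `ξ` that multiplies `exp (-(ξ² + ρ²) / (4 t))` in
the expansion of the integrand at time `t`, for a target at signed distance `ρ`. -/
noncomputable def poly (j : BoundaryJet) (t ρ ξ : ℝ) : ℝ :=
  j.σ₀ * ξ ^ 0 + j.σ₁ * ξ ^ 1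
  + (j.σ₀ * j.κ * ρ / (4 * t) + (j.σ₂ + j.σ₀ * j.κ ^ 2) / 2) * ξ ^ 2
  + (j.σ₀ * j.γ₃ * ρ / (12 * t) + j.σ₁ * j.κ * ρ / (4 * t) + j.σ₃ / 6 + j.σ₁ * j.κ ^ 2 / 2
      + j.σ₀ * j.κ * j.γ₃ / 2) * ξ ^ 3
  + (j.σ₀ * (-j.κ ^ 2 / (16 * t) + ρ ^ 2 * j.κ ^ 2 / (32 * t ^ 2) + j.γ₄ * ρ / (48 * t))
      + j.σ₁ * j.γ₃ * ρ / (12 * t)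
      + (j.σ₂ + j.σ₀ * j.κ ^ 2) * j.κ * ρ / (8 * t)) * ξ ^ 4
  + (j.σ₀ * (-j.κ * j.γ₃ / (24 * t) + ρ ^ 2 * j.κ * j.γ₃ / (48 * t ^ 2))
      + j.σ₁ * (-j.κ ^ 2 / (16 * t) + ρ ^ 2 * j.κ ^ 2 / (32 * t ^ 2))) * ξ ^ 5
  + j.σ₀ * (-ρ * j.κ ^ 3 / (64 * t ^ 2) + ρ ^ 3 * j.κ ^ 3 / (384 * t ^ 3)) * ξ ^ 6

/-- The time independent part of the Gaussian mean of `BoundaryJet.poly`. -/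
noncomputable def mean₀ (j : BoundaryJet) (ρ : ℝ) : ℝ :=
  j.σ₀ * (1 + ρ * j.κ / 2 + 3 * j.κ ^ 2 * ρ ^ 2 / 8 + 5 * j.κ ^ 3 * ρ ^ 3 / 16)

/-- The part of the Gaussian mean of `BoundaryJet.poly` that is linear in time. -/
noncomputable def mean₁ (j : BoundaryJet) (ρ : ℝ) : ℝ :=
  j.σ₂ + j.κ ^ 2 * j.σ₀ / 4
    + ρ * (j.γ₄ * j.σ₀ / 4 + j.σ₁ * j.γ₃ + 3 * j.κ * j.σ₂ / 2 - 3 * j.κ ^ 3 * j.σ₀ / 8)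

lemma hasGaussianMean (j : BoundaryJet) {t : ℝ} (ht : 0 < t) (ρ : ℝ) :
    Integrable (fun ξ => Real.exp (-ξ ^ 2 / (4 * t)) * j.poly t ρ ξ) ∧
    ∫ ξ, Real.exp (-ξ ^ 2 / (4 * t)) * j.poly t ρ ξ
      = √(4 * Real.pi * t) * (j.mean₀ ρ + j.mean₁ ρ * t) := by
  have hI (c : Fin 7 → ℝ) (i : Fin 7) := (integrable_pow_mul_gaussian ht i).const_mul (c i)
  have hfun (c₀ c₁ c₂ c₃ c₄ c₅ c₆ : ℝ) : (fun ξ : ℝ => Real.exp (-ξ ^ 2 / (4 * t)) *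
      (c₀ * ξ ^ 0 + c₁ * ξ ^ 1 + c₂ * ξ ^ 2 + c₃ * ξ ^ 3 + c₄ * ξ ^ 4 + c₅ * ξ ^ 5 + c₆ * ξ ^ 6))
      = fun ξ => ∑ i : Fin 7, ![c₀, c₁, c₂, c₃, c₄, c₅, c₆] i *
        (ξ ^ (i : ℕ) * Real.exp (-ξ ^ 2 / (4 * t))) := by
    ext ξ; simp [Fin.sum_univ_succ]; ring
  have h0 : ∫ ξ : ℝ, ξ ^ 0 * Real.exp (-ξ ^ 2 / (4 * t)) = √(4 * Real.pi * t) := by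
    simpa using integral_gaussian_time ht
  have h1 := integral_mul_gaussian ht
  have h2 := integral_pow_add_two_mul_gaussian ht 0
  have h3 := integral_pow_add_two_mul_gaussian ht 1
  have h4 := integral_pow_add_two_mul_gaussian ht 2
  have h5 := integral_pow_add_two_mul_gaussian ht 3
  have h6 := integral_pow_add_two_mul_gaussian ht 4
  simp only [Nat.reduceAdd] at h2 h3 h4 h5 h6
  rw [h0] at h2
  rw [h2] at h4
  rw [h4] at h6
  rw [h1] at h3
  rw [h3] at h5
  constructor
  · unfold poly
    rw [hfun]
    exact integrable_finsetSum _ fun i _ => hI _ i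
  · unfold poly
    rw [hfun, integral_finsetSum _ fun i _ => hI _ i]
    simp only [integral_const_mul]
    simp only [Fin.sum_univ_seven, Fin.isValue, Matrix.cons_val, Fin.val_zero, Fin.val_one,
      Fin.val_two, show ((3 : Fin 7) : ℕ) = 3 from rfl, show ((4 : Fin 7) : ℕ) = 4 from rfl,
      show ((5 : Fin 7) : ℕ) = 5 from rfl, show ((6 : Fin 7) : ℕ) = 6 from rfl]
    rw [h0, h1, h2, h3, h4, h5, h6]
    simp only [mean₀, mean₁]
    push_cast
    field_simp
    ring

/-- The scaled data attached to a jet, in the variables `q = √t`, `z = ξ / √t`, `ρ / √t`. -/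
noncomputable def scaled {j : BoundaryJet} {K : ℝ} (hj : j.BoundedBy K) {t : ℝ} (ht : 0 < t)
    (ht1 : t ≤ 1) (ρ ξ Y U S : ℝ)
    (hY : |Y - (j.κ * ξ ^ 2 / 2 + j.γ₃ * ξ ^ 3 / 6 + j.γ₄ * ξ ^ 4 / 24)| ≤ K * |ξ| ^ 5)
    (hU : |U - (j.κ * ξ + j.γ₃ * ξ ^ 2 / 2 + j.γ₄ * ξ ^ 3 / 6)| ≤ K * |ξ| ^ 4)
    (hS : |S - (j.σ₀ + j.σ₁ * ξ + j.σ₂ * ξ ^ 2 / 2 + j.σ₃ * ξ ^ 3 / 6)| ≤ K * |ξ| ^ 4) :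
    ScaledData K where
  q := √t
  z := ξ / √t
  ρ := ρ / √t
  Y := Y
  U := U
  S := S
  κ := j.κ
  γ₃ := j.γ₃
  γ₄ := j.γ₄
  σ₀ := j.σ₀
  σ₁ := j.σ₁
  σ₂ := j.σ₂
  σ₃ := j.σ₃
  q_pos := Real.sqrt_pos.2 ht
  q_le := Real.sqrt_le_one.2 ht1
  κ_le := hj.κ_le
  γ₃_le := hj.γ₃_le
  γ₄_le := hj.γ₄_le
  σ₀_le := hj.σ₀_le
  σ₁_le := hj.σ₁_le
  σ₂_le := hj.σ₂_le
  σ₃_le := hj.σ₃_le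
  Y_le := by rwa [mul_div_cancel₀ ξ (Real.sqrt_pos.2 ht).ne']
  U_le := by rwa [mul_div_cancel₀ ξ (Real.sqrt_pos.2 ht).ne']
  S_le := by rwa [mul_div_cancel₀ ξ (Real.sqrt_pos.2 ht).ne']

lemma expansion_scaled {j : BoundaryJet} {K : ℝ} (hj : j.BoundedBy K) {t : ℝ} (ht : 0 < t)
    (ht1 : t ≤ 1) (ρ ξ Y U S : ℝ) (hY hU hS) :
    (scaled hj ht ht1 ρ ξ Y U S hY hU hS).expansion = j.poly t ρ ξ := by
  simp only [ScaledData.expansion, ScaledData.w₁, ScaledData.w₂, ScaledData.w₃, scaled, poly]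
  obtain ⟨q, hq, rfl⟩ : ∃ q : ℝ, 0 < q ∧ t = q ^ 2 :=
    ⟨√t, Real.sqrt_pos.2 ht, (Real.sq_sqrt ht.le).symm⟩
  rw [Real.sqrt_sq hq.le]
  field_simp
  ring

/-- The integrand and its polynomial approximation differ by `t²` times a wider Gaussian; far from
the base point the approximation itself is that small. -/
lemma exists_pointwise_bound (K : ℝ) {a : ℝ} (ha : 0 < a) : ∃ C, 0 ≤ C ∧
    ∀ j : BoundaryJet, j.BoundedBy K → ∀ t, 0 < t → t ≤ 1 → ∀ ρ ξ : ℝ,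
    (∀ Y U S : ℝ, |Y - (j.κ * ξ ^ 2 / 2 + j.γ₃ * ξ ^ 3 / 6 + j.γ₄ * ξ ^ 4 / 24)| ≤ K * |ξ| ^ 5 →
      |U - (j.κ * ξ + j.γ₃ * ξ ^ 2 / 2 + j.γ₄ * ξ ^ 3 / 6)| ≤ K * |ξ| ^ 4 →
      |S - (j.σ₀ + j.σ₁ * ξ + j.σ₂ * ξ ^ 2 / 2 + j.σ₃ * ξ ^ 3 / 6)| ≤ K * |ξ| ^ 4 →
      |2 * ρ * Y - Y ^ 2| ≤ ξ ^ 2 / 2 →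
      |Real.exp (-(ξ ^ 2 + (Y - ρ) ^ 2) / (4 * t)) * (S * √(1 + U ^ 2))
        - Real.exp (-ρ ^ 2 / (4 * t)) * (Real.exp (-ξ ^ 2 / (4 * t)) * j.poly t ρ ξ)|
        ≤ C * t ^ 2 * Real.exp (-ξ ^ 2 / (4 * (4 * t)))) ∧
    (a ≤ |ξ| → |Real.exp (-ρ ^ 2 / (4 * t)) * (Real.exp (-ξ ^ 2 / (4 * t)) * j.poly t ρ ξ)|
        ≤ C * t ^ 2 * Real.exp (-ξ ^ 2 / (4 * (4 * t)))) := by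
  obtain ⟨C, hC, hCb⟩ := ScaledData.exists_abs_sub_expansion_le K
  obtain ⟨D, hD, hDb⟩ := ScaledData.exists_abs_expansion_le K ha
  refine ⟨C + D, by positivity, fun j hj t ht ht1 ρ ξ => ?_⟩
  have hK : 0 ≤ K := (abs_nonneg _).trans hj.κ_le
  have hq : 0 < √t := Real.sqrt_pos.2 ht
  have hq2 : √t ^ 2 = t := Real.sq_sqrt ht.le
  have hq4 : √t ^ 4 = t ^ 2 := by rw [show (4 : ℕ) = 2 * 2 by norm_num, pow_mul, hq2]
  have he : Real.exp (-(ξ / √t) ^ 2 / 16) = Real.exp (-ξ ^ 2 / (4 * (4 * t))) := by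
    congr 1; rw [div_pow, hq2]; field_simp; norm_num
  have he2 : Real.exp (-(ρ / √t) ^ 2 / 4 - (ξ / √t) ^ 2 / 4)
      = Real.exp (-ρ ^ 2 / (4 * t)) * Real.exp (-ξ ^ 2 / (4 * t)) := by
    rw [← Real.exp_add]; congr 1; rw [div_pow, div_pow, hq2]; field_simp; ring
  constructor
  · intro Y U S hY hU hS hs
    have h := hCb (scaled hj ht ht1 ρ ξ Y U S hY hU hS)
    rw [expansion_scaled] at h
    simp only [scaled, mul_div_cancel₀ _ hq.ne', hq2, hq4, he, he2] at h
    refine (le_of_eq ?_).trans ((h hs).trans ?_)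
    · have h3 : Real.exp (-(ξ ^ 2 + (Y - ρ) ^ 2) / (4 * t))
          = Real.exp ((2 * ρ * Y - Y ^ 2) / (4 * t)) * (Real.exp (-ρ ^ 2 / (4 * t))
            * Real.exp (-ξ ^ 2 / (4 * t))) := by
        rw [← Real.exp_add, ← Real.exp_add]; congr 1; field_simp; ring
      rw [h3, ← abs_of_pos (show 0 < Real.exp (-ρ ^ 2 / (4 * t)) * Real.exp (-ξ ^ 2 / (4 * t)) by
        positivity), ← abs_mul, abs_of_pos (show 0 < Real.exp (-ρ ^ 2 / (4 * t))
        * Real.exp (-ξ ^ 2 / (4 * t)) by positivity)]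
      congr 1; ring
    · gcongr; linarith
  · intro hξ
    have h := hDb (scaled hj ht ht1 ρ ξ _ _ _ (by rw [sub_self, abs_zero]; positivity)
      (by rw [sub_self, abs_zero]; positivity) (by rw [sub_self, abs_zero]; positivity))
    rw [expansion_scaled] at h
    simp only [scaled, mul_div_cancel₀ _ hq.ne', hq4, he, he2] at h
    refine (le_of_eq ?_).trans ((h hξ).trans ?_)
    · rw [abs_mul, abs_mul, Real.abs_exp, Real.abs_exp]; ring
    · gcongr; linarith

end BoundaryJet

/-- A parametrized boundary arc over the parameter interval `[-h₀, h₀]`: its tangential coordinate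
`X` increases with speed `X'` and covers `[-a, a]`, and the height `Y`, the slope `U` and the
density `S` are, as functions of `X`, given by the jet `j` up to the error of Taylor's formula. -/
structure ArcModel (K a h₀ : ℝ) (j : BoundaryJet) (X X' Y U S : ℝ → ℝ) : Prop where
  pos : 0 < h₀
  jet_le : j.BoundedBy K
  hasDerivAt : ∀ h ∈ Icc (-h₀) h₀, HasDerivAt X (X' h) h
  deriv_pos : ∀ h ∈ Icc (-h₀) h₀, 0 < X' h
  contDeriv : ContinuousOn X' (Icc (-h₀) h₀)
  contY : ContinuousOn Y (Icc (-h₀) h₀)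
  contU : ContinuousOn U (Icc (-h₀) h₀)
  contS : ContinuousOn S (Icc (-h₀) h₀)
  left : X (-h₀) ≤ -a
  right : a ≤ X h₀
  Y_le : ∀ h ∈ Icc (-h₀) h₀, |Y h - (j.κ * X h ^ 2 / 2 + j.γ₃ * X h ^ 3 / 6
    + j.γ₄ * X h ^ 4 / 24)| ≤ K * |X h| ^ 5
  U_le : ∀ h ∈ Icc (-h₀) h₀, |U h - (j.κ * X h + j.γ₃ * X h ^ 2 / 2 + j.γ₄ * X h ^ 3 / 6)|
    ≤ K * |X h| ^ 4
  S_le : ∀ h ∈ Icc (-h₀) h₀, |S h - (j.σ₀ + j.σ₁ * X h + j.σ₂ * X h ^ 2 / 2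
    + j.σ₃ * X h ^ 3 / 6)| ≤ K * |X h| ^ 4

/-- The contribution of the near arc at time `t`. Comparing integrands before substituting
`ξ = X h` in the explicit polynomial makes an inverse of `X` unnecessary. -/
theorem ArcModel.exists_integral_bound (K : ℝ) {a : ℝ} (ha : 0 < a) : ∃ C, 0 ≤ C ∧
    ∀ (h₀ : ℝ) (j : BoundaryJet) (X X' Y U S : ℝ → ℝ), ArcModel K a h₀ j X X' Y U S →
    ∀ t, 0 < t → t ≤ 1 → ∀ ρ : ℝ,
      (∀ h ∈ Icc (-h₀) h₀, |2 * ρ * Y h - Y h ^ 2| ≤ X h ^ 2 / 2) →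
      |(∫ h in (-h₀)..h₀, Real.exp (-(X h ^ 2 + (Y h - ρ) ^ 2) / (4 * t))
          * (S h * √(1 + U h ^ 2)) * X' h)
        - Real.exp (-ρ ^ 2 / (4 * t)) * (√(4 * Real.pi * t) * (j.mean₀ ρ + j.mean₁ ρ * t))|
      ≤ C * t ^ 2 * √t := by
  obtain ⟨C, hC, hCb⟩ := BoundaryJet.exists_pointwise_bound K ha
  refine ⟨C * √(16 * Real.pi) + C * √(16 * Real.pi), by positivity,
    fun h₀ j X X' Y U S hm t ht ht1 ρ hs => ?_⟩
  have hle : -h₀ ≤ h₀ := by linarith [hm.pos]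
  have hu : uIcc (-h₀) h₀ = Icc (-h₀) h₀ := uIcc_of_le hle
  have hXc : ContinuousOn X (Icc (-h₀) h₀) := fun h hh =>
    (hm.hasDerivAt h hh).continuousAt.continuousWithinAt
  set G : ℝ → ℝ := fun ξ =>
    Real.exp (-ρ ^ 2 / (4 * t)) * (Real.exp (-ξ ^ 2 / (4 * t)) * j.poly t ρ ξ) with hG
  set E : ℝ → ℝ := fun ξ => C * t ^ 2 * Real.exp (-ξ ^ 2 / (4 * (4 * t))) with hE
  have hGc : Continuous G := by
    simp only [hG, BoundaryJet.poly]; fun_prop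
  have hEc : Continuous E := by simp only [hE]; fun_prop
  have hGi : Integrable G := (j.hasGaussianMean ht ρ).1.const_mul _
  have hGv : ∫ ξ, G ξ = Real.exp (-ρ ^ 2 / (4 * t))
      * (√(4 * Real.pi * t) * (j.mean₀ ρ + j.mean₁ ρ * t)) := by
    simp only [hG]; rw [integral_const_mul, (j.hasGaussianMean ht ρ).2]
  have hEi : Integrable E := by
    have := (integrable_pow_mul_gaussian (t := 4 * t) (by positivity) 0).const_mul (C * t ^ 2)
    simpa using this
  have hE0 (ξ : ℝ) : 0 ≤ E ξ := by simp only [hE]; positivity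
  have hEv : ∫ ξ, E ξ = C * √(16 * Real.pi) * t ^ 2 * √t := by
    simp only [hE]
    rw [integral_const_mul, integral_gaussian_time (by positivity),
      show 4 * Real.pi * (4 * t) = 16 * Real.pi * t by ring, Real.sqrt_mul (by positivity)]
    ring
  have hsub : ∫ h in (-h₀)..h₀, G (X h) * X' h = ∫ ξ in X (-h₀)..X h₀, G ξ :=
    intervalIntegral.integral_comp_mul_deriv (by rw [hu]; exact hm.hasDerivAt)
      (by rw [hu]; exact hm.contDeriv) hGc
  have hsubE : ∫ h in (-h₀)..h₀, E (X h) * X' h = ∫ ξ in X (-h₀)..X h₀, E ξ :=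
    intervalIntegral.integral_comp_mul_deriv (by rw [hu]; exact hm.hasDerivAt)
      (by rw [hu]; exact hm.contDeriv) hEc
  have hX : X (-h₀) ≤ X h₀ := by linarith [hm.left, hm.right]
  have hset (f : ℝ → ℝ) (hf : Integrable f) (hf0 : ∀ ξ, 0 ≤ f ξ) :
      ∫ ξ in X (-h₀)..X h₀, f ξ ≤ ∫ ξ, f ξ := by
    rw [intervalIntegral.integral_of_le hX]
    exact setIntegral_le_integral hf (.of_forall hf0)
  -- the near arc against the polynomial
  have hnear : |(∫ h in (-h₀)..h₀, Real.exp (-(X h ^ 2 + (Y h - ρ) ^ 2) / (4 * t))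
      * (S h * √(1 + U h ^ 2)) * X' h) - ∫ ξ in X (-h₀)..X h₀, G ξ| ≤ ∫ ξ, E ξ := by
    have hYc := hm.contY
    have hUc := hm.contU
    have hSc := hm.contS
    have hX'c := hm.contDeriv
    rw [← hsub, ← intervalIntegral.integral_sub
      (by apply ContinuousOn.intervalIntegrable; rw [hu]; fun_prop)
      (by
        apply ContinuousOn.intervalIntegrable; rw [hu]
        exact (hGc.comp_continuousOn hXc).mul hX'c)]
    refine (intervalIntegral.abs_integral_le_integral_abs hle).trans ?_
    refine (intervalIntegral.integral_mono_on (g := fun h => E (X h) * X' h) hle ?_ ?_ ?_).trans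
      (hsubE.trans_le (hset E hEi hE0))
    · apply ContinuousOn.intervalIntegrable; rw [hu]
      have := (hGc.comp_continuousOn hXc).mul hX'c
      exact ContinuousOn.abs (ContinuousOn.sub (by fun_prop) this)
    · apply ContinuousOn.intervalIntegrable; rw [hu]
      exact (hEc.comp_continuousOn hXc).mul hX'c
    · intro h hh
      rw [← sub_mul, abs_mul, abs_of_pos (hm.deriv_pos h hh)]
      refine mul_le_mul_of_nonneg_right ?_ (hm.deriv_pos h hh).le
      exact (hCb j hm.jet_le t ht ht1 ρ (X h)).1 (Y h) (U h) (S h) (hm.Y_le h hh) (hm.U_le h hh)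
        (hm.S_le h hh) (hs h hh)
  -- the Gaussian tails
  have htail : |(∫ ξ in X (-h₀)..X h₀, G ξ) - ∫ ξ, G ξ| ≤ ∫ ξ, E ξ := by
    rw [intervalIntegral.integral_of_le hX,
      ← integral_add_compl (measurableSet_Ioc (a := X (-h₀)) (b := X h₀)) hGi,
      sub_add_cancel_left, abs_neg]
    refine (abs_integral_le_integral_abs).trans ?_
    refine (setIntegral_mono_on (g := E) hGi.abs.integrableOn hEi.integrableOn
      measurableSet_Ioc.compl fun ξ hξ => ?_).trans (setIntegral_le_integral hEi (.of_forall hE0))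
    refine (hCb j hm.jet_le t ht ht1 ρ ξ).2 ?_
    rw [mem_compl_iff, mem_Ioc, not_and_or, not_lt, not_le] at hξ
    rcases hξ with h | h
    · exact le_abs.2 (Or.inr (by linarith [hm.left]))
    · exact le_abs.2 (Or.inl (by linarith [hm.right]))
  rw [hGv] at htail
  calc _ ≤ (∫ ξ, E ξ) + ∫ ξ, E ξ := (abs_sub_le _ _ _).trans (add_le_add hnear htail)
    _ = _ := by rw [hEv]; ring

/-! ### The complementary error function and the integrals in time -/

lemma integrable_exp_neg_sq : Integrable fun u : ℝ => Real.exp (-u ^ 2) := by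
  simpa using integrable_exp_neg_mul_sq (b := 1) one_pos

lemma erfc_eq_sub (x : ℝ) :
    erfc x = erfc 0 - 2 / √Real.pi * ∫ u in (0 : ℝ)..x, Real.exp (-u ^ 2) := by
  unfold erfc
  rw [← mul_sub, ← intervalIntegral.integral_interval_add_Ioi (a := 0) (b := x)
    integrable_exp_neg_sq.integrableOn integrable_exp_neg_sq.integrableOn]
  ring

lemma hasDerivAt_erfc (x : ℝ) : HasDerivAt erfc (-(2 / √Real.pi * Real.exp (-x ^ 2))) x := by
  have hc : Continuous fun u : ℝ => Real.exp (-u ^ 2) := by fun_prop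
  have h := ((hc.integral_hasStrictDerivAt 0 x).hasDerivAt.const_mul (2 / √Real.pi)).const_sub
    (erfc 0)
  exact h.congr_of_eventuallyEq (.of_forall erfc_eq_sub)

lemma erfc_nonneg (x : ℝ) : 0 ≤ erfc x :=
  mul_nonneg (by positivity) (integral_nonneg fun _ => (Real.exp_pos _).le)

/-- On `u ≥ x` one has `x exp (-u²) ≤ u exp (-u²)`, which has an elementary primitive. -/
lemma mul_erfc_le_one (x : ℝ) : x * erfc x ≤ 1 := by
  have hI := (integrable_mul_exp_neg_mul_sq (b := 1) one_pos)
  have hd (u : ℝ) : HasDerivAt (fun u : ℝ => -Real.exp (-u ^ 2) / 2)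
      (u * Real.exp (-1 * u ^ 2)) u := by
    refine (((hasDerivAt_pow 2 u).neg.exp.neg).div_const 2).congr_deriv ?_
    simp; ring
  have ht : Tendsto (fun u : ℝ => -Real.exp (-u ^ 2) / 2) atTop (𝓝 0) := by
    have h1 : Tendsto (fun u : ℝ => Real.exp (-u ^ 2)) atTop (𝓝 0) :=
      Real.tendsto_exp_atBot.comp (tendsto_neg_atTop_atBot.comp (tendsto_pow_atTop (by norm_num)))
    simpa using h1.neg.div_const 2
  have hv := integral_Ioi_of_hasDerivAt_of_tendsto' (a := x) (fun u _ => hd u) hI.integrableOn ht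
  have hle : x * ∫ u in Ioi x, Real.exp (-u ^ 2) ≤ ∫ u in Ioi x, u * Real.exp (-1 * u ^ 2) := by
    rw [← integral_const_mul]
    refine setIntegral_mono_on (integrable_exp_neg_sq.const_mul x).integrableOn hI.integrableOn
      measurableSet_Ioi fun u hu => ?_
    rw [neg_one_mul]
    exact mul_le_mul_of_nonneg_right (le_of_lt hu) (Real.exp_pos _).le
  rw [hv] at hle
  have h1 : Real.exp (-x ^ 2) ≤ 1 := Real.exp_le_one_iff.2 (by nlinarith)
  have hpi : 1 ≤ √Real.pi := Real.one_le_sqrt.2 (by linarith [Real.pi_gt_three])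
  have h2 : 2 / √Real.pi ≤ 2 := by rw [div_le_iff₀ (by positivity)]; linarith
  unfold erfc
  calc x * (2 / √Real.pi * ∫ u in Ioi x, Real.exp (-u ^ 2))
      = 2 / √Real.pi * (x * ∫ u in Ioi x, Real.exp (-u ^ 2)) := by ring
    _ ≤ 2 / √Real.pi * (1 / 2) := by gcongr; linarith
    _ ≤ 1 := by linarith

/-- The heat kernel of the plane at time `t`, integrated over a line at distance `r`. -/
noncomputable def lineKernel (r t : ℝ) : ℝ :=
  Real.exp (-r ^ 2 / (4 * t)) * (√(4 * Real.pi * t) / (4 * Real.pi * t))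

lemma lineKernel_eq {t : ℝ} (ht : 0 < t) (r : ℝ) :
    lineKernel r t = Real.exp (-r ^ 2 / (4 * t)) / (2 * √Real.pi * √t) := by
  unfold lineKernel
  have hs : √(4 * Real.pi * t) = 2 * √Real.pi * √t := by
    rw [Real.sqrt_mul (by positivity), Real.sqrt_mul (by norm_num),
      show (4 : ℝ) = 2 ^ 2 by norm_num, Real.sqrt_sq (by norm_num)]
  have h4 : 4 * Real.pi * t = (2 * √Real.pi * √t) ^ 2 := by
    rw [← hs, Real.sq_sqrt (by positivity)]
  have := Real.sqrt_pos.2 ht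
  have := Real.sqrt_pos.2 Real.pi_pos
  rw [hs, h4]; field_simp

lemma lineKernel_nonneg {t : ℝ} (ht : 0 < t) (r : ℝ) : 0 ≤ lineKernel r t := by
  unfold lineKernel; positivity

lemma lineKernel_le {t : ℝ} (ht : 0 < t) (r : ℝ) : lineKernel r t ≤ 1 / √t := by
  rw [lineKernel_eq ht]
  have h1 : Real.exp (-r ^ 2 / (4 * t)) ≤ 1 :=
    Real.exp_le_one_iff.2 (div_nonpos_of_nonpos_of_nonneg (by nlinarith) (by positivity))
  have hpi : 1 ≤ √Real.pi := Real.one_le_sqrt.2 (by linarith [Real.pi_gt_three])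
  have := Real.sqrt_pos.2 ht
  rw [div_le_div_iff₀ (by positivity) this]
  nlinarith

lemma measurable_lineKernel (r : ℝ) : Measurable (lineKernel r) := by
  unfold lineKernel; fun_prop

lemma intervalIntegrable_lineKernel (r : ℝ) {δ : ℝ} (hδ : 0 ≤ δ) :
    IntervalIntegrable (lineKernel r) volume 0 δ := by
  refine (intervalIntegral.intervalIntegrable_rpow' (a := 0) (b := δ) (r := -(1 / 2))
    (by norm_num)).mono_fun' (measurable_lineKernel r).aestronglyMeasurable ?_
  rw [uIoc_of_le hδ]
  refine (ae_restrict_mem measurableSet_Ioc).mono fun t ht => ?_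
  simp only [Real.norm_eq_abs]
  rw [abs_of_nonneg (lineKernel_nonneg ht.1 r), Real.rpow_neg ht.1.le,
    ← Real.sqrt_eq_rpow, ← one_div]
  exact lineKernel_le ht.1 r

lemma intervalIntegrable_lineKernel_mul (r : ℝ) {δ : ℝ} (hδ : 0 ≤ δ) :
    IntervalIntegrable (fun t => lineKernel r t * t) volume 0 δ :=
  (intervalIntegrable_lineKernel r hδ).mul_continuousOn continuousOn_id

/-- Primitive in time of `lineKernel`. -/
noncomputable def linePrimitive₀ (r t : ℝ) : ℝ :=
  √t * Real.exp (-r ^ 2 / (4 * t)) / √Real.pi - r / 2 * erfc (r / (2 * √t))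

/-- Primitive in time of `t * lineKernel`. -/
noncomputable def linePrimitive₁ (r t : ℝ) : ℝ :=
  (r ^ 3 * erfc (r / (2 * √t))
    - 2 * (r ^ 2 - 2 * t) * √t * Real.exp (-r ^ 2 / (4 * t)) / √Real.pi) / 12

lemma hasDerivAt_erfc_sqrt {t : ℝ} (ht : 0 < t) (r : ℝ) :
    HasDerivAt (fun t => erfc (r / (2 * √t)))
      (r * Real.exp (-r ^ 2 / (4 * t)) / (2 * √Real.pi * √t ^ 3)) t := by
  have hs := Real.sqrt_pos.2 ht
  have h1 := (((Real.hasDerivAt_sqrt ht.ne').const_mul 2).inv (by positivity)).const_mul r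
  have h2 := (hasDerivAt_erfc (r / (2 * √t))).comp t h1
  refine h2.congr_deriv ?_
  have : -(r / (2 * √t)) ^ 2 = -r ^ 2 / (4 * t) := by
    rw [div_pow, mul_pow, Real.sq_sqrt ht.le]; field_simp; norm_num
  rw [this]
  have := Real.sqrt_pos.2 Real.pi_pos
  field_simp

lemma hasDerivAt_exp_inv {t : ℝ} (ht : 0 < t) (r : ℝ) :
    HasDerivAt (fun t => Real.exp (-r ^ 2 / (4 * t)))
      (r ^ 2 / (4 * √t ^ 4) * Real.exp (-r ^ 2 / (4 * t))) t := by
  have h1 := (((hasDerivAt_id t).const_mul 4).inv (by simp; positivity)).const_mul (-r ^ 2)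
  refine h1.exp.congr_deriv ?_
  rw [show √t ^ 4 = t ^ 2 by rw [show (4 : ℕ) = 2 * 2 by norm_num, pow_mul, Real.sq_sqrt ht.le]]
  simp only [id, div_eq_mul_inv]
  simp
  field_simp

lemma hasDerivAt_linePrimitive₀ {t : ℝ} (ht : 0 < t) (r : ℝ) :
    HasDerivAt (linePrimitive₀ r) (lineKernel r t) t := by
  have hs := Real.sqrt_pos.2 ht
  have hp := Real.sqrt_pos.2 Real.pi_pos
  refine ((((Real.hasDerivAt_sqrt ht.ne').mul (hasDerivAt_exp_inv ht r)).div_const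
    (√Real.pi)).sub ((hasDerivAt_erfc_sqrt ht r).const_mul (r / 2))).congr_deriv ?_
  rw [lineKernel_eq ht]
  generalize Real.exp (-r ^ 2 / (4 * t)) = e
  generalize √t = s at *
  field_simp
  ring

lemma hasDerivAt_linePrimitive₁ {t : ℝ} (ht : 0 < t) (r : ℝ) :
    HasDerivAt (linePrimitive₁ r) (lineKernel r t * t) t := by
  have hs := Real.sqrt_pos.2 ht
  have hp := Real.sqrt_pos.2 Real.pi_pos
  refine ((((hasDerivAt_erfc_sqrt ht r).const_mul (r ^ 3)).sub
    ((((((((hasDerivAt_id t).const_mul 2).const_sub (r ^ 2)).const_mul 2).mul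
      (Real.hasDerivAt_sqrt ht.ne')).mul (hasDerivAt_exp_inv ht r)).div_const
    (√Real.pi)))).div_const 12).congr_deriv ?_
  rw [lineKernel_eq ht]
  generalize Real.exp (-r ^ 2 / (4 * t)) = e
  obtain ⟨s, hs0, rfl⟩ : ∃ s : ℝ, 0 < s ∧ t = s ^ 2 := ⟨√t, hs, (Real.sq_sqrt ht.le).symm⟩
  rw [Real.sqrt_sq hs0.le]
  simp only [id, Pi.mul_apply, Real.sqrt_sq hs0.le]
  field_simp
  ring

lemma tendsto_sqrt_nhdsGT : Tendsto (fun t : ℝ => √t) (𝓝[>] 0) (𝓝 0) := by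
  have := (Real.continuous_sqrt.tendsto 0).mono_left (nhdsWithin_le_nhds (s := Ioi 0))
  simpa using this

lemma abs_mul_erfc_le {r t : ℝ} (hr : 0 ≤ r) (ht : 0 < t) : |r * erfc (r / (2 * √t))| ≤ 2 * √t := by
  have hs := Real.sqrt_pos.2 ht
  have h := mul_erfc_le_one (r / (2 * √t))
  rw [abs_of_nonneg (mul_nonneg hr (erfc_nonneg _))]
  calc r * erfc (r / (2 * √t)) = 2 * √t * (r / (2 * √t) * erfc (r / (2 * √t))) := by field_simp
    _ ≤ 2 * √t * 1 := by gcongr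
    _ = _ := mul_one _

lemma tendsto_mul_erfc {r : ℝ} (hr : 0 ≤ r) :
    Tendsto (fun t => r * erfc (r / (2 * √t))) (𝓝[>] 0) (𝓝 0) := by
  refine squeeze_zero_norm' (a := fun t => 2 * √t) ?_
    (by simpa using tendsto_sqrt_nhdsGT.const_mul 2)
  filter_upwards [self_mem_nhdsWithin] with t ht
  exact abs_mul_erfc_le hr ht

lemma tendsto_sqrt_mul_exp (r : ℝ) :
    Tendsto (fun t => √t * Real.exp (-r ^ 2 / (4 * t))) (𝓝[>] 0) (𝓝 0) := by
  refine squeeze_zero_norm' (a := fun t => √t) ?_ tendsto_sqrt_nhdsGT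
  filter_upwards [self_mem_nhdsWithin] with t (ht : 0 < t)
  rw [Real.norm_eq_abs, abs_of_nonneg (by positivity)]
  refine mul_le_of_le_one_right (by positivity) (Real.exp_le_one_iff.2 ?_)
  exact div_nonpos_of_nonpos_of_nonneg (by nlinarith) (by positivity)

lemma tendsto_linePrimitive₀ {r : ℝ} (hr : 0 ≤ r) :
    Tendsto (linePrimitive₀ r) (𝓝[>] 0) (𝓝 0) := by
  have h := ((tendsto_sqrt_mul_exp r).div_const (√Real.pi)).sub
    ((tendsto_mul_erfc hr).const_mul (1 / 2))
  simp only [zero_div, mul_zero, sub_zero] at h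
  refine h.congr fun t => ?_
  unfold linePrimitive₀; ring

lemma tendsto_linePrimitive₁ {r : ℝ} (hr : 0 ≤ r) :
    Tendsto (linePrimitive₁ r) (𝓝[>] 0) (𝓝 0) := by
  have ht : Tendsto (fun t : ℝ => 2 * (r ^ 2 - 2 * t)) (𝓝[>] 0) (𝓝 (2 * (r ^ 2 - 2 * 0))) :=
    (Continuous.tendsto (by fun_prop) 0).mono_left nhdsWithin_le_nhds
  have h := (((tendsto_mul_erfc hr).const_mul (r ^ 2)).sub
    ((ht.mul (tendsto_sqrt_mul_exp r)).div_const (√Real.pi))).div_const 12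
  simp only [zero_div, mul_zero, sub_zero] at h
  refine h.congr fun t => ?_
  unfold linePrimitive₁; ring

lemma integral_lineKernel {r δ : ℝ} (hr : 0 ≤ r) (hδ : 0 < δ) :
    ∫ t in (0 : ℝ)..δ, lineKernel r t = linePrimitive₀ r δ := by
  rw [intervalIntegral.integral_eq_sub_of_hasDerivAt_of_tendsto hδ
    (fun t ht => hasDerivAt_linePrimitive₀ ht.1 r) (intervalIntegrable_lineKernel r hδ.le)
    (tendsto_linePrimitive₀ hr)
    ((hasDerivAt_linePrimitive₀ hδ r).continuousAt.tendsto.mono_left nhdsWithin_le_nhds), sub_zero]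

lemma integral_lineKernel_mul {r δ : ℝ} (hr : 0 ≤ r) (hδ : 0 < δ) :
    ∫ t in (0 : ℝ)..δ, lineKernel r t * t = linePrimitive₁ r δ := by
  rw [intervalIntegral.integral_eq_sub_of_hasDerivAt_of_tendsto hδ
    (fun t ht => hasDerivAt_linePrimitive₁ ht.1 r) (intervalIntegrable_lineKernel_mul r hδ.le)
    (tendsto_linePrimitive₁ hr)
    ((hasDerivAt_linePrimitive₁ hδ r).continuousAt.tendsto.mono_left nhdsWithin_le_nhds), sub_zero]

lemma sq_mul_exp_neg_le {u : ℝ} (hu : 0 ≤ u) : u ^ 2 * Real.exp (-u) ≤ 2 := by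
  have h := Real.pow_div_factorial_le_exp u hu 2
  rw [Real.exp_neg, ← div_eq_mul_inv, div_le_iff₀ (Real.exp_pos u)]
  norm_num [Nat.factorial] at h
  linarith

lemma cube_mul_exp_neg_le {u : ℝ} (hu : 0 ≤ u) : u ^ 3 * Real.exp (-u) ≤ 6 := by
  have h := Real.pow_div_factorial_le_exp u hu 3
  rw [Real.exp_neg, ← div_eq_mul_inv, div_le_iff₀ (Real.exp_pos u)]
  norm_num [Nat.factorial] at h
  linarith

namespace BoundaryJet

/-- Away from the boundary the leading part of the expansion is negligible. -/
lemma exists_far_bound (K : ℝ) {r₀ : ℝ} (hr₀ : 0 < r₀) : ∃ C, 0 ≤ C ∧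
    ∀ j : BoundaryJet, j.BoundedBy K → ∀ t, 0 < t → t ≤ 1 → ∀ ρ : ℝ, r₀ ≤ |ρ| →
      |lineKernel ρ t * (j.mean₀ ρ + j.mean₁ ρ * t)| ≤ C * (t * √t) := by
  set L := 1 + |K| with hL
  have hL1 : 1 ≤ L := by have := abs_nonneg K; linarith
  refine ⟨32 * (10 * L ^ 4 * (1 + 1 / r₀) ^ 4), by positivity, fun j hj t ht ht1 ρ hρ => ?_⟩
  have hs := Real.sqrt_pos.2 ht
  have hρ0 : 0 < |ρ| := hr₀.trans_le hρ
  set a := |ρ| with ha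
  have hKL : K ≤ L := by have := le_abs_self K; linarith
  have hκ := hj.κ_le.trans hKL
  have h3 := hj.γ₃_le.trans hKL
  have h4 := hj.γ₄_le.trans hKL
  have s0 := hj.σ₀_le.trans hKL
  have s1 := hj.σ₁_le.trans hKL
  have s2 := hj.σ₂_le.trans hKL
  have pw {m n : ℕ} (h : m ≤ n) : L ^ m ≤ L ^ n := pow_le_pow_right₀ hL1 h
  have hm0 : |j.mean₀ ρ| ≤ 2 * L ^ 4 * (1 + a) ^ 3 := by
    have : |j.mean₀ ρ| ≤ L * (1 + a * L / 2 + 3 * L ^ 2 * a ^ 2 / 8 + 5 * L ^ 3 * a ^ 3 / 16) := by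
      unfold mean₀
      rw [abs_mul]
      gcongr
      refine (abs_add_le _ _).trans (add_le_add ((abs_add_le _ _).trans (add_le_add
        ((abs_add_le _ _).trans (add_le_add (by simp) ?_)) ?_)) ?_) <;>
      simp only [abs_mul, abs_div, abs_pow, ← ha] <;> norm_num [-sq_abs] <;> gcongr
    refine this.trans ?_
    have e1 : L ≤ L ^ 4 := by simpa using pw (show 1 ≤ 4 by norm_num)
    have e2 : L ^ 2 ≤ L ^ 4 := pw (by norm_num)
    have e3 : L ^ 3 ≤ L ^ 4 := pw (by norm_num)
    calc _ = L + a / 2 * L ^ 2 + 3 * a ^ 2 / 8 * L ^ 3 + 5 * a ^ 3 / 16 * L ^ 4 := by ring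
      _ ≤ L ^ 4 + a / 2 * L ^ 4 + 3 * a ^ 2 / 8 * L ^ 4 + 5 * a ^ 3 / 16 * L ^ 4 := by gcongr
      _ = L ^ 4 * (1 + a / 2 + 3 * a ^ 2 / 8 + 5 * a ^ 3 / 16) := by ring
      _ ≤ L ^ 4 * (2 * (1 + a) ^ 3) := by
        gcongr; nlinarith [pow_pos hρ0 2, pow_pos hρ0 3]
      _ = _ := by ring
  have hm1 : |j.mean₁ ρ| ≤ 8 * L ^ 4 * (1 + a) ^ 3 := by
    have : |j.mean₁ ρ| ≤ L + L ^ 2 * L / 4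
        + a * (L * L / 4 + L * L + 3 * L * L / 2 + 3 * L ^ 3 * L / 8) := by
      unfold mean₁
      refine (abs_add_le _ _).trans (add_le_add ((abs_add_le _ _).trans (add_le_add s2 ?_)) ?_)
      · simp only [abs_mul, abs_div, abs_pow]; norm_num [-sq_abs]; gcongr
      · rw [abs_mul]
        gcongr
        refine (abs_sub _ _).trans (add_le_add ((abs_add_le _ _).trans (add_le_add
          ((abs_add_le _ _).trans (add_le_add ?_ ?_)) ?_)) ?_) <;>
        simp only [abs_mul, abs_div, abs_pow] <;> norm_num [-sq_abs] <;> gcongr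
    refine this.trans ?_
    have e1 : L ≤ L ^ 4 := by simpa using pw (show 1 ≤ 4 by norm_num)
    have e2 : L ^ 2 ≤ L ^ 4 := pw (by norm_num)
    have e3 : L ^ 3 ≤ L ^ 4 := pw (by norm_num)
    calc _ = L + L ^ 3 / 4 + a * (11 / 4 * L ^ 2 + 3 / 8 * L ^ 4) := by ring
      _ ≤ L ^ 4 + L ^ 4 / 4 + a * (11 / 4 * L ^ 4 + 3 / 8 * L ^ 4) := by gcongr
      _ = L ^ 4 * (5 / 4 + a * (25 / 8)) := by ring
      _ ≤ L ^ 4 * (8 * (1 + a) ^ 3) := by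
        gcongr; nlinarith [pow_pos hρ0 2, pow_pos hρ0 3]
      _ = _ := by ring
  have hm : |j.mean₀ ρ + j.mean₁ ρ * t| ≤ 10 * L ^ 4 * (1 + a) ^ 3 := by
    refine (abs_add_le _ _).trans ?_
    rw [abs_mul, abs_of_pos ht]
    calc _ ≤ 2 * L ^ 4 * (1 + a) ^ 3 + 8 * L ^ 4 * (1 + a) ^ 3 * 1 := by gcongr
      _ = _ := by ring
  have hk : lineKernel ρ t ≤ 32 * (t * √t) / a ^ 4 := by
    have h := sq_mul_exp_neg_le (u := a ^ 2 / (4 * t)) (by positivity)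
    have he : Real.exp (-ρ ^ 2 / (4 * t)) ≤ 32 * t ^ 2 / a ^ 4 := by
      rw [← sq_abs ρ, ← ha, neg_div]
      rw [le_div_iff₀ (by positivity)]
      have : (a ^ 2 / (4 * t)) ^ 2 = a ^ 4 / (16 * t ^ 2) := by ring
      rw [this, div_mul_eq_mul_div, div_le_iff₀ (by positivity)] at h
      linarith
    have hpi : 1 ≤ √Real.pi := Real.one_le_sqrt.2 (by linarith [Real.pi_gt_three])
    rw [lineKernel_eq ht]
    calc _ ≤ Real.exp (-ρ ^ 2 / (4 * t)) / √t := by gcongr; nlinarith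
      _ ≤ 32 * t ^ 2 / a ^ 4 / √t := by gcongr
      _ = 32 * (t * √t) / a ^ 4 := by
        have : t ^ 2 = t * √t * √t := by rw [mul_assoc, Real.mul_self_sqrt ht.le]; ring
        rw [this]; field_simp
  rw [abs_mul, abs_of_nonneg (lineKernel_nonneg ht ρ)]
  have h1a : (1 + a) ^ 3 / a ^ 4 ≤ (1 + 1 / r₀) ^ 4 := by
    have h5 : (1 + a) / a ≤ 1 + 1 / r₀ := by
      rw [add_div, div_self hρ0.ne', add_comm]; gcongr
    calc (1 + a) ^ 3 / a ^ 4 ≤ (1 + a) ^ 4 / a ^ 4 := by gcongr <;> linarith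
      _ = ((1 + a) / a) ^ 4 := by rw [div_pow]
      _ ≤ _ := by gcongr
  calc _ ≤ 32 * (t * √t) / a ^ 4 * (10 * L ^ 4 * (1 + a) ^ 3) := by gcongr
    _ = 32 * (10 * L ^ 4 * ((1 + a) ^ 3 / a ^ 4)) * (t * √t) := by ring
    _ ≤ _ := by gcongr

end BoundaryJet

/-! ### Uniformly smooth families and Taylor's formula in a coordinate -/

/-- A family of functions on the line is uniformly `C^m` on `s` if it is bounded on `s`,
uniformly in the family, together with its derivatives up to order `m`. -/
def UniformlySmooth {J : Type*} (s : Set ℝ) : ℕ → (J → ℝ → ℝ) → Prop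
  | 0, f => ∃ K, ∀ j, ∀ h ∈ s, |f j h| ≤ K
  | m + 1, f => (∃ K, ∀ j, ∀ h ∈ s, |f j h| ≤ K) ∧
      ∃ f' : J → ℝ → ℝ, (∀ j, ∀ h ∈ s, HasDerivAt (f j) (f' j h) h) ∧ UniformlySmooth s m f'

namespace UniformlySmooth

variable {J : Type*} {s : Set ℝ} {m : ℕ} {f g : J → ℝ → ℝ}

lemma bounded (hf : UniformlySmooth s m f) : ∃ K, ∀ j, ∀ h ∈ s, |f j h| ≤ K := by
  cases m with
  | zero => exact hf
  | succ m => exact hf.1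

lemma of_succ (hf : UniformlySmooth s (m + 1) f) : UniformlySmooth s m f := by
  induction m generalizing f with
  | zero => exact hf.1
  | succ m ih =>
    obtain ⟨hb, f', hd, hf'⟩ := hf
    exact ⟨hb, f', hd, ih hf'⟩

lemma of_le {n : ℕ} (hf : UniformlySmooth s n f) (h : m ≤ n) : UniformlySmooth s m f := by
  induction n, h using Nat.le_induction with
  | base => exact hf
  | succ n _ ih => exact ih hf.of_succ

lemma mono {u : Set ℝ} (hf : UniformlySmooth s m f) (h : u ⊆ s) : UniformlySmooth u m f := by
  induction m generalizing f with
  | zero => obtain ⟨K, hK⟩ := hf; exact ⟨K, fun j x hx => hK j x (h hx)⟩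
  | succ m ih =>
    obtain ⟨⟨K, hK⟩, f', hd, hf'⟩ := hf
    exact ⟨⟨K, fun j x hx => hK j x (h hx)⟩, f', fun j x hx => hd j x (h hx), ih hf'⟩

lemma add (hf : UniformlySmooth s m f) (hg : UniformlySmooth s m g) :
    UniformlySmooth s m (fun j h => f j h + g j h) := by
  have hb {f g : J → ℝ → ℝ} (hf : ∃ K, ∀ j, ∀ h ∈ s, |f j h| ≤ K)
      (hg : ∃ K, ∀ j, ∀ h ∈ s, |g j h| ≤ K) : ∃ K, ∀ j, ∀ h ∈ s, |f j h + g j h| ≤ K := by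
    obtain ⟨K, hK⟩ := hf
    obtain ⟨L, hL⟩ := hg
    exact ⟨K + L, fun j h hh => (abs_add_le _ _).trans (add_le_add (hK j h hh) (hL j h hh))⟩
  induction m generalizing f g with
  | zero => exact hb hf hg
  | succ m ih =>
    obtain ⟨hfb, f', hfd, hf'⟩ := hf
    obtain ⟨hgb, g', hgd, hg'⟩ := hg
    exact ⟨hb hfb hgb, _, fun j h hh => (hfd j h hh).add (hgd j h hh), ih hf' hg'⟩

lemma mul (hf : UniformlySmooth s m f) (hg : UniformlySmooth s m g) :
    UniformlySmooth s m (fun j h => f j h * g j h) := by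
  have hb {f g : J → ℝ → ℝ} (hf : ∃ K, ∀ j, ∀ h ∈ s, |f j h| ≤ K)
      (hg : ∃ K, ∀ j, ∀ h ∈ s, |g j h| ≤ K) : ∃ K, ∀ j, ∀ h ∈ s, |f j h * g j h| ≤ K := by
    obtain ⟨K, hK⟩ := hf
    obtain ⟨L, hL⟩ := hg
    refine ⟨K * L, fun j h hh => ?_⟩
    rw [abs_mul]
    exact mul_le_mul (hK j h hh) (hL j h hh) (abs_nonneg _) ((abs_nonneg _).trans (hK j h hh))
  induction m generalizing f g with
  | zero => exact hb hf hg
  | succ m ih =>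
    have hf0 := hf.of_succ
    have hg0 := hg.of_succ
    obtain ⟨hfb, f', hfd, hf'⟩ := hf
    obtain ⟨hgb, g', hgd, hg'⟩ := hg
    exact ⟨hb hfb hgb, _, fun j h hh => (hfd j h hh).mul (hgd j h hh),
      (ih hf' hg0).add (ih hf0 hg')⟩

lemma neg (hf : UniformlySmooth s m f) : UniformlySmooth s m (fun j h => -f j h) := by
  induction m generalizing f with
  | zero => obtain ⟨K, hK⟩ := hf; exact ⟨K, fun j x hx => by rw [abs_neg]; exact hK j x hx⟩
  | succ m ih =>
    obtain ⟨⟨K, hK⟩, f', hd, hf'⟩ := hf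
    exact ⟨⟨K, fun j x hx => by rw [abs_neg]; exact hK j x hx⟩, _, fun j x hx => (hd j x hx).neg,
      ih hf'⟩

lemma inv {c : ℝ} (hc : 0 < c) (hcf : ∀ j, ∀ h ∈ s, c ≤ f j h) (hf : UniformlySmooth s m f) :
    UniformlySmooth s m (fun j h => (f j h)⁻¹) := by
  have hb : ∃ K, ∀ j, ∀ h ∈ s, |(f j h)⁻¹| ≤ K := by
    refine ⟨c⁻¹, fun j h hh => ?_⟩
    rw [abs_of_pos (inv_pos.2 (hc.trans_le (hcf j h hh)))]
    exact inv_anti₀ hc (hcf j h hh)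
  induction m with
  | zero => exact hb
  | succ m ih =>
    have h0 := ih hf.of_succ
    obtain ⟨-, f', hd, hf'⟩ := hf
    refine ⟨hb, _, fun j h hh => ?_, hf'.neg.mul (h0.mul h0)⟩
    refine ((hd j h hh).inv (hc.trans_le (hcf j h hh)).ne').congr_deriv ?_
    rw [div_eq_mul_inv, sq, mul_inv]

/-- The successive derivatives with respect to a coordinate `X` with derivative `X'`: the chain
`G 0 = f`, `(G k)' = G (k + 1) * X'`. -/
lemma exists_chain {X' : J → ℝ → ℝ} {c : ℝ} (hc : 0 < c) (hcX : ∀ j, ∀ h ∈ s, c ≤ X' j h) {n : ℕ}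
    (hX : UniformlySmooth s n X') (hm : m ≤ n + 1) (hf : UniformlySmooth s m f) :
    ∃ G : ℕ → J → ℝ → ℝ, G 0 = f ∧
      (∀ k < m, ∀ j, ∀ h ∈ s, HasDerivAt (G k j) (G (k + 1) j h * X' j h) h) ∧
      ∀ k ≤ m, ∃ K, ∀ j, ∀ h ∈ s, |G k j h| ≤ K := by
  induction m generalizing f with
  | zero =>
    refine ⟨fun _ => f, rfl, fun k hk => absurd hk (Nat.not_lt_zero k), fun k hk => ?_⟩
    exact hf
  | succ m ih =>
    obtain ⟨hb, f', hd, hf'⟩ := hf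
    obtain ⟨G, hG0, hG, hGb⟩ := ih (by omega)
      (hf'.mul ((hX.of_le (by omega : m ≤ n)).inv hc hcX))
    refine ⟨fun k => Nat.casesOn k f G, rfl, fun k hk j h hh => ?_, fun k hk => ?_⟩
    · cases k with
      | zero =>
        refine (hd j h hh).congr_deriv ?_
        have := (hc.trans_le (hcX j h hh)).ne'
        simp only [hG0]
        field_simp
      | succ k => exact hG k (by omega) j h hh
    · cases k with
      | zero => exact hb
      | succ k => exact hGb k (by omega)

end UniformlySmooth

lemma exists_forall_of_finite {ι : Type*} [Finite ι] {P : ι → ℝ → Prop}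
    (hP : ∀ i K L, K ≤ L → P i K → P i L) (h : ∀ i, ∃ K, P i K) : ∃ K, ∀ i, P i K := by
  choose K hK using h
  obtain ⟨L, hL⟩ := (Set.finite_range K).bddAbove
  exact ⟨L, fun i => hP i _ _ (hL ⟨i, rfl⟩) (hK i)⟩

lemma exists_pos_forall_of_finite {ι : Type*} [Finite ι] {P : ι → ℝ → Prop}
    (hP : ∀ i c d, 0 < c → c ≤ d → P i d → P i c) (h : ∀ i, ∃ d, 0 < d ∧ P i d) :
    ∃ d, 0 < d ∧ ∀ i, P i d := by
  choose d hd0 hd using h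
  obtain ⟨L, hL⟩ := exists_forall_of_finite (P := fun i L => (d i)⁻¹ ≤ L)
    (fun i K L h h' => h'.trans h) (fun i => ⟨_, le_rfl⟩)
  have h0 : 0 < max L 1 := lt_max_of_lt_right one_pos
  refine ⟨(max L 1)⁻¹, inv_pos.2 h0, fun i => hP i _ _ (inv_pos.2 h0) ?_ (hd i)⟩
  rw [inv_le_comm₀ h0 (hd0 i)]
  exact (hL i).trans (le_max_left _ _)

lemma exists_norm_le_of_continuous {ι E : Type*} [Finite ι] [NormedAddCommGroup E]
    {P : ι → ℝ → E} (hP : ∀ i, Continuous (P i)) (a b : ℝ) :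
    ∃ K, ∀ i, ∀ u ∈ Icc a b, ‖P i u‖ ≤ K := by
  refine exists_forall_of_finite (fun i K L h h' u hu => (h' u hu).trans h) fun i => ?_
  exact isCompact_Icc.exists_bound_of_continuousOn (hP i).continuousOn

/-- Translates by base points in `[0, 1]` of finitely many `C^m` curves, composed with functionals
of norm at most one. -/
lemma uniformlySmooth_of_contDiff {ι E J : Type*} [Finite ι] [NormedAddCommGroup E]
    [NormedSpace ℝ E] {m : ℕ} {P : ι → ℝ → E} (hP : ∀ i, ContDiff ℝ m (P i)) (i : J → ι)
    (u : J → ℝ) (hu : ∀ j, u j ∈ Icc (0 : ℝ) 1) (l : J → E →L[ℝ] ℝ) (hl : ∀ j, ‖l j‖ ≤ 1) :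
    UniformlySmooth (Icc (-(1 / 2)) (1 / 2)) m (fun j h => l j (P (i j) (u j + h))) := by
  have hb {P : ι → ℝ → E} (hP : ∀ i, Continuous (P i)) :
      ∃ K, ∀ j, ∀ h ∈ Icc (-(1 / 2) : ℝ) (1 / 2), |l j (P (i j) (u j + h))| ≤ K := by
    obtain ⟨K, hK⟩ := exists_norm_le_of_continuous hP (-1) 2
    refine ⟨K, fun j h hh => ?_⟩
    have h1 := hK (i j) (u j + h) ⟨by linarith [(hu j).1, hh.1], by linarith [(hu j).2, hh.2]⟩
    calc |l j (P (i j) (u j + h))| ≤ ‖l j‖ * ‖P (i j) (u j + h)‖ := (l j).le_opNorm _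
      _ ≤ 1 * ‖P (i j) (u j + h)‖ := by gcongr; exact hl j
      _ ≤ K := by rwa [one_mul]
  induction m generalizing P with
  | zero => exact hb fun i => (hP i).continuous
  | succ m ih =>
    refine ⟨hb fun i => (hP i).continuous, fun j h => l j (deriv (P (i j)) (u j + h)),
      fun j h _ => ?_,
      ih (P := fun i => deriv (P i)) fun i => ?_⟩
    · have h1 : HasDerivAt (P (i j)) (deriv (P (i j)) (u j + h)) (u j + h) :=
        ((hP (i j)).differentiable (by simp) _).hasDerivAt
      have h2 : HasDerivAt (fun h => P (i j) (u j + h)) (deriv (P (i j)) (u j + h)) h :=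
        HasDerivAt.comp_const_add (u j) h h1
      exact (l j).hasFDerivAt.comp_hasDerivAt h h2
    · have := hP i
      push_cast at this
      exact (contDiff_succ_iff_deriv.1 this).2.2

/-- Taylor's formula in a coordinate `X`, by induction on the order with Cauchy's mean value
theorem. -/
lemma abs_sub_taylor_le {h₀ K : ℝ} {X X' : ℝ → ℝ} (hX0 : X 0 = 0)
    (hX : ∀ h ∈ Icc (-h₀) h₀, HasDerivAt X (X' h) h) (hX' : ∀ h ∈ Icc (-h₀) h₀, 0 < X' h) (m : ℕ)
    {G : ℕ → ℝ → ℝ}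
    (hG : ∀ k < m, ∀ h ∈ Icc (-h₀) h₀, HasDerivAt (G k) (G (k + 1) h * X' h) h)
    (hK : ∀ h ∈ Icc (-h₀) h₀, |G m h| ≤ K) :
    ∀ h ∈ Icc (-h₀) h₀,
      |G 0 h - ∑ k ∈ Finset.range m, G k 0 / k.factorial * X h ^ k| ≤ K * |X h| ^ m := by
  induction m generalizing G with
  | zero => simpa using hK
  | succ m ih =>
    intro h hh
    have hE := ih (G := fun k => G (k + 1)) (fun k hk => hG (k + 1) (by omega)) hK
    set E : ℝ → ℝ := fun h => G 1 h - ∑ k ∈ Finset.range m, G (k + 1) 0 / k.factorial * X h ^ k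
      with hEdef
    set D : ℝ → ℝ := fun h => G 0 h - ∑ k ∈ Finset.range (m + 1), G k 0 / k.factorial * X h ^ k
      with hDdef
    have hD0 : D 0 = 0 := by
      simp [hDdef, hX0, Finset.sum_range_succ', zero_pow]
    have hD (x : ℝ) (hx : x ∈ Icc (-h₀) h₀) : HasDerivAt D (E x * X' x) x := by
      have h1 := hG 0 (by omega) x hx
      have h2 : HasDerivAt (fun h => ∑ k ∈ Finset.range (m + 1), G k 0 / k.factorial * X h ^ k)
          (∑ k ∈ Finset.range (m + 1), G k 0 / k.factorial * (k * X x ^ (k - 1) * X' x)) x :=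
        HasDerivAt.fun_sum fun k _ => ((hX x hx).pow k).const_mul _
      refine (h1.sub h2).congr_deriv ?_
      rw [hEdef, Finset.sum_range_succ']
      simp only [sub_mul, Finset.sum_mul, zero_add]
      simp only [Nat.cast_zero, zero_mul, mul_zero, add_zero, Nat.add_sub_cancel]
      congr 1
      refine Finset.sum_congr rfl fun k _ => ?_
      rw [Nat.factorial_succ]
      push_cast
      field_simp
    have hmono : MonotoneOn X (Icc (-h₀) h₀) := by
      refine monotoneOn_of_deriv_nonneg (convex_Icc _ _)
        (fun x hx => (hX x hx).continuousAt.continuousWithinAt)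
        (fun x hx => (hX x (interior_subset hx)).differentiableAt.differentiableWithinAt)
        fun x hx => ?_
      rw [(hX x (interior_subset hx)).deriv]
      exact (hX' x (interior_subset hx)).le
    have h00 : (0 : ℝ) ∈ Icc (-h₀) h₀ := ⟨by linarith [hh.1, hh.2], by linarith [hh.1, hh.2]⟩
    -- the Cauchy mean value theorem on the interval between `0` and `h`
    obtain ⟨c, hc, hcX, hcD⟩ : ∃ c ∈ Icc (-h₀) h₀, |X c| ≤ |X h| ∧ D h = E c * X h := by
      rcases lt_trichotomy h 0 with hlt | rfl | hgt
      · have hsub : Icc h 0 ⊆ Icc (-h₀) h₀ := Icc_subset_Icc hh.1 h00.2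
        obtain ⟨c, hc, hcD⟩ := exists_ratio_hasDerivAt_eq_ratio_slope D (fun x => E x * X' x) hlt
          (fun x hx => (hD x (hsub hx)).continuousAt.continuousWithinAt)
          (fun x hx => hD x (hsub (Ioo_subset_Icc_self hx))) X X'
          (fun x hx => (hX x (hsub hx)).continuousAt.continuousWithinAt)
          (fun x hx => hX x (hsub (Ioo_subset_Icc_self hx)))
        have hcm := hsub (Ioo_subset_Icc_self hc)
        refine ⟨c, hcm, ?_, ?_⟩
        · have h1 := hmono hcm h00 hc.2.le
          have h2 := hmono hh hcm hc.1.le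
          rw [hX0] at h1
          rw [abs_of_nonpos h1, abs_of_nonpos (h2.trans h1)]; linarith
        · rw [hX0, hD0] at hcD
          refine mul_right_cancel₀ (hX' c hcm).ne' ?_
          linarith
      · exact ⟨0, h00, le_rfl, by rw [hD0, hX0, mul_zero]⟩
      · have hsub : Icc 0 h ⊆ Icc (-h₀) h₀ := Icc_subset_Icc h00.1 hh.2
        obtain ⟨c, hc, hcD⟩ := exists_ratio_hasDerivAt_eq_ratio_slope D (fun x => E x * X' x) hgt
          (fun x hx => (hD x (hsub hx)).continuousAt.continuousWithinAt)
          (fun x hx => hD x (hsub (Ioo_subset_Icc_self hx))) X X'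
          (fun x hx => (hX x (hsub hx)).continuousAt.continuousWithinAt)
          (fun x hx => hX x (hsub (Ioo_subset_Icc_self hx)))
        have hcm := hsub (Ioo_subset_Icc_self hc)
        refine ⟨c, hcm, ?_, ?_⟩
        · have h1 := hmono h00 hcm hc.1.le
          have h2 := hmono hcm hh hc.2.le
          rw [hX0] at h1
          rw [abs_of_nonneg h1, abs_of_nonneg (h1.trans h2)]; exact h2
        · rw [hX0, hD0] at hcD
          refine mul_right_cancel₀ (hX' c hcm).ne' ?_
          linarith
    have hK0 : 0 ≤ K := (abs_nonneg _).trans (hK h hh)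
    change |D h| ≤ _
    rw [hcD, abs_mul, pow_succ, ← mul_assoc]
    gcongr
    exact (hE c hc).trans (by gcongr)

/-- The chain of a function of `X` consists of its derivatives, as functions of `X`. -/
lemma iteratedDeriv_eq_chain {X X' φ : ℝ → ℝ} {m : ℕ} (hX0 : X 0 = 0)
    (hX : ∀ᶠ h in 𝓝 0, HasDerivAt X (X' h) h ∧ X' h ≠ 0) (hφ : ContDiffAt ℝ m φ 0)
    {G : ℕ → ℝ → ℝ} (h0 : ∀ᶠ h in 𝓝 0, φ (X h) = G 0 h)
    (hG : ∀ k < m, ∀ᶠ h in 𝓝 0, HasDerivAt (G k) (G (k + 1) h * X' h) h) {k : ℕ} (hk : k ≤ m) :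
    iteratedDeriv k φ 0 = G k 0 := by
  have hXc : Tendsto X (𝓝 0) (𝓝 0) := by
    have := hX.self_of_nhds.1.continuousAt.tendsto
    rwa [hX0] at this
  suffices h : ∀ᶠ h in 𝓝 0, iteratedDeriv k φ (X h) = G k h by
    have := h.self_of_nhds
    rwa [hX0] at this
  induction k with
  | zero => simpa using h0
  | succ k ih =>
    have hdiff : ∀ᶠ ξ in 𝓝 0, DifferentiableAt ℝ (iteratedDeriv k φ) ξ := by
      filter_upwards [hφ.eventually (by simp)] with ξ hξ
      have := (hξ.contDiffWithinAt (s := univ)).differentiableWithinAt_iteratedDerivWithin (m := k)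
        (by exact_mod_cast hk) (by simp)
      rwa [iteratedDerivWithin_univ, differentiableWithinAt_univ] at this
    filter_upwards [(ih (by omega)).eventually_nhds, hXc.eventually hdiff, hX, hG k (by omega)]
      with h h1 h2 h3 h4
    have h5 := (h2.hasDerivAt.comp h h3.1).congr_of_eventuallyEq (h1.mono fun y hy => hy.symm)
    have h6 := h5.unique h4
    rw [iteratedDeriv_succ]
    exact mul_right_cancel₀ h3.2 h6

/-- A function that is smooth after a local change of coordinate is smooth. -/
lemma contDiffAt_of_comp_eventuallyEq {X φ f : ℝ → ℝ} {m : ℕ} (hm : m ≠ 0) (hX0 : X 0 = 0)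
    (hX : ContDiffAt ℝ m X 0) {x' : ℝ} (hx' : HasDerivAt X x' 0) (hne : x' ≠ 0)
    (hf : ContDiffAt ℝ m f 0) (h : ∀ᶠ h in 𝓝 0, φ (X h) = f h) : ContDiffAt ℝ m φ 0 := by
  have hm' : ((m : ℕ) : WithTop ℕ∞) ≠ 0 := by exact_mod_cast hm
  have hd := hx'.hasFDerivAt_equiv hne
  have hG := hX.to_localInverse hd hm'
  have hG0 := hX.localInverse_apply_image hd hm'
  have hr := (hX.hasStrictFDerivAt' hd hm').eventually_right_inverse
  change ∀ᶠ ξ in 𝓝 (X 0), X (hX.localInverse hd hm' ξ) = ξ at hr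
  set g := hX.localInverse hd hm'
  rw [hX0] at hG hG0 hr
  have hgt : Tendsto g (𝓝 0) (𝓝 0) := by
    have := hG.continuousAt.tendsto
    rwa [hG0] at this
  have hfg : ContDiffAt ℝ m (f ∘ g) 0 := ContDiffAt.comp 0 (by rwa [hG0]) hG
  refine hfg.congr_of_eventuallyEq ?_
  filter_upwards [hr, hgt.eventually h] with ξ h1 h2
  rw [h1] at h2
  exact h2

/-! ### Tangent graphs, closest points and the geometry of the boundary -/

namespace Plane

variable {τ n : Plane}

lemma coordinates_sq (hτ : ‖τ‖ = 1) (hn : ‖n‖ = 1) (h : inner ℝ τ n = 0) :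
    n 0 ^ 2 + τ 0 ^ 2 = 1 ∧ n 1 ^ 2 + τ 1 ^ 2 = 1 ∧ n 0 * n 1 + τ 0 * τ 1 = 0 := by
  have h1 : τ 0 ^ 2 + τ 1 ^ 2 = 1 := by
    have := EuclideanSpace.real_norm_sq_eq τ
    rw [hτ, Fin.sum_univ_two] at this; linarith
  have h2 : n 0 ^ 2 + n 1 ^ 2 = 1 := by
    have := EuclideanSpace.real_norm_sq_eq n
    rw [hn, Fin.sum_univ_two] at this; linarith
  have h3 : τ 0 * n 0 + τ 1 * n 1 = 0 := by
    rw [PiLp.inner_apply, Fin.sum_univ_two] at h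
    simp only [RCLike.inner_apply, conj_trivial] at h
    linarith
  -- `n` is `τ` turned by a right angle, in the sense given by the determinant `D = ±1`
  set D := τ 0 * n 1 - τ 1 * n 0 with hD
  have hc : n 0 = -(τ 1 * D) := by rw [hD]; linear_combination (-n 0) * h1 + τ 0 * h3
  have hd : n 1 = τ 0 * D := by rw [hD]; linear_combination (-n 1) * h1 + τ 1 * h3
  have hD2 : D ^ 2 = 1 := by
    have : (τ 0 ^ 2 + τ 1 ^ 2) * D ^ 2 = 1 := by rw [← h2, hc, hd]; ring
    rwa [h1, one_mul] at this
  refine ⟨?_, ?_, ?_⟩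
  · rw [hc]; linear_combination τ 1 ^ 2 * hD2 + h1
  · rw [hd]; linear_combination τ 0 ^ 2 * hD2 + h1
  · rw [hc, hd]; linear_combination (-τ 0 * τ 1) * hD2

lemma inner_eq (u v : Plane) : inner ℝ u v = u 0 * v 0 + u 1 * v 1 := by
  rw [PiLp.inner_apply, Fin.sum_univ_two]
  simp only [RCLike.inner_apply, conj_trivial]
  ring

lemma eq_add (hτ : ‖τ‖ = 1) (hn : ‖n‖ = 1) (h : inner ℝ τ n = 0) (v : Plane) :
    v = (inner ℝ τ v : ℝ) • τ + (inner ℝ n v : ℝ) • n := by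
  obtain ⟨h1, h2, h3⟩ := coordinates_sq hτ hn h
  ext i
  fin_cases i
  · simp [inner_eq]; linear_combination (-v 0) * h1 - v 1 * h3
  · simp [inner_eq]; linear_combination (-v 1) * h2 - v 0 * h3

lemma norm_sq_eq (hτ : ‖τ‖ = 1) (hn : ‖n‖ = 1) (h : inner ℝ τ n = 0) (v : Plane) :
    ‖v‖ ^ 2 = (inner ℝ τ v : ℝ) ^ 2 + (inner ℝ n v : ℝ) ^ 2 := by
  obtain ⟨h1, h2, h3⟩ := coordinates_sq hτ hn h
  rw [EuclideanSpace.real_norm_sq_eq, Fin.sum_univ_two, inner_eq, inner_eq]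
  linear_combination (-v 0 ^ 2) * h1 - v 1 ^ 2 * h2 - 2 * v 0 * v 1 * h3

end Plane

namespace IsTangentGraph

variable {Ω : Set Plane} {b τ n : Plane} {γ : ℝ → ℝ}

lemma eventually_continuousAt (hγ : IsTangentGraph Ω b τ n γ) :
    ∀ᶠ y in 𝓝 b, ContinuousAt γ (inner ℝ τ (y - b)) := by
  have h1 : ∀ᶠ ξ in 𝓝 (0 : ℝ), ContinuousAt γ ξ :=
    (hγ.contDiffAt.eventually (by simp)).mono fun ξ h => h.continuousAt
  have h2 : Tendsto (fun y => (inner ℝ τ (y - b) : ℝ)) (𝓝 b) (𝓝 0) := by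
    have : Continuous fun y => (inner ℝ τ (y - b) : ℝ) := by fun_prop
    simpa using this.tendsto b
  exact h2.eventually h1

/-- Near `b`, the boundary of `Ω` lies on the graph. -/
lemma eventually_eq_of_mem_frontier (hγ : IsTangentGraph Ω b τ n γ) (hΩ : IsOpen Ω) :
    ∀ᶠ y in 𝓝 b, y ∈ frontier Ω → γ (inner ℝ τ (y - b)) = inner ℝ n (y - b) := by
  filter_upwards [hγ.eventually_mem_iff.eventually_nhds, hγ.eventually_continuousAt] with y h1 h2 hy
  rw [hΩ.frontier_eq] at hy
  refine le_antisymm ?_ (not_lt.1 fun h => hy.2 (h1.self_of_nhds.2 h))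
  by_contra! hlt
  have hc1 : ContinuousAt (fun z => γ (inner ℝ τ (z - b))) y :=
    ContinuousAt.comp (f := fun z => (inner ℝ τ (z - b) : ℝ)) h2 (by fun_prop)
  have hc2 : ContinuousAt (fun z => (inner ℝ n (z - b) : ℝ)) y := by fun_prop
  have h3 : ∀ᶠ z in 𝓝 y, z ∉ Ω := by
    filter_upwards [h1, hc2.eventually_lt hc1 hlt] with z hz hz2 hz3
    exact absurd (hz.1 hz3) (not_lt.2 hz2.le)
  obtain ⟨z, hz1, hz2⟩ := (mem_closure_iff_frequently.1 hy.1).and_eventually h3 |>.exists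
  exact hz2 hz1

/-- Reversing the tangent reflects the graph. -/
lemma neg_tangent (hγ : IsTangentGraph Ω b τ n γ) :
    IsTangentGraph Ω b (-τ) n (fun ξ => γ (-ξ)) where
  norm_tangent := by rw [norm_neg]; exact hγ.norm_tangent
  norm_normal := hγ.norm_normal
  orthogonal := by rw [inner_neg_left, hγ.orthogonal, neg_zero]
  contDiffAt := by
    have : ContDiffAt ℝ 5 γ (-0) := by rw [neg_zero]; exact hγ.contDiffAt
    exact this.comp 0 contDiffAt_id.neg
  map_zero := by rw [neg_zero]; exact hγ.map_zero
  deriv_zero := by rw [deriv_comp_neg, neg_zero, hγ.deriv_zero, neg_zero]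
  eventually_mem_iff := by simpa [inner_neg_left] using hγ.eventually_mem_iff

variable {P : ℝ → Plane} {s : ℝ}

/-- A boundary curve through `b` satisfies the equation of the graph near `b`. -/
lemma eventually_comp (hγ : IsTangentGraph Ω b τ n γ) (hΩ : IsOpen Ω) (hP : Continuous P)
    (hPs : P s = b) (hPΩ : ∀ u, P u ∈ frontier Ω) :
    ∀ᶠ h in 𝓝 (0 : ℝ), γ (inner ℝ τ (P (s + h) - b)) = inner ℝ n (P (s + h) - b) := by
  have ht : Tendsto (fun h => P (s + h)) (𝓝 0) (𝓝 b) := by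
    have : Continuous fun h => P (s + h) := by fun_prop
    simpa [hPs] using this.tendsto 0
  exact (ht.eventually (hγ.eventually_eq_of_mem_frontier hΩ)).mono fun h hh => hh (hPΩ _)

lemma inner_normal_deriv_eq_zero (hγ : IsTangentGraph Ω b τ n γ) (hΩ : IsOpen Ω)
    (hP : Differentiable ℝ P) (hPs : P s = b) (hPΩ : ∀ u, P u ∈ frontier Ω) :
    inner ℝ n (deriv P s) = 0 := by
  have hd : HasDerivAt (fun h => P (s + h)) (deriv P s) 0 :=
    HasDerivAt.comp_const_add s 0 (by rw [add_zero]; exact (hP s).hasDerivAt)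
  have hi (v : Plane) : HasDerivAt (fun h => (inner ℝ v (P (s + h) - b) : ℝ))
      (inner ℝ v (deriv P s)) 0 := by
    have := (innerSL ℝ v).hasFDerivAt.comp_hasDerivAt 0 (hd.sub_const b)
    exact this
  have h0 : (inner ℝ τ (P (s + 0) - b) : ℝ) = 0 := by simp [hPs]
  have hγd : HasDerivAt γ 0 (inner ℝ τ (P (s + 0) - b)) := by
    have := (hγ.contDiffAt.differentiableAt (by simp)).hasDerivAt
    rw [hγ.deriv_zero] at this
    rw [h0]; exact this
  have h1 := hγd.comp 0 (hi τ)
  have h2 := (hi n).congr_of_eventuallyEq (hγ.eventually_comp hΩ hP.continuous hPs hPΩ)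
  rw [zero_mul] at h1
  exact h2.unique h1

end IsTangentGraph

lemma IsUniqueClosest.inner_deriv_eq_zero {S : Set Plane} {x b : Plane}
    (h : IsUniqueClosest S x b) {P : ℝ → Plane} {s : ℝ} (hP : Differentiable ℝ P) (hPs : P s = b)
    (hPS : ∀ u, P u ∈ S) : inner ℝ (x - b) (deriv P s) = 0 := by
  have hmin : IsLocalMin (fun u => ‖x - P u‖ ^ 2) s := by
    refine .of_forall fun u => ?_
    have : ‖x - P s‖ ≤ ‖x - P u‖ := by
      rw [hPs, ← dist_eq_norm, ← dist_eq_norm]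
      by_cases hu : P u = b
      · rw [hu]
      · exact (h.2 _ (hPS u) hu).le
    exact pow_le_pow_left₀ (norm_nonneg _) this 2
  have hd := ((hP s).hasDerivAt.const_sub x).norm_sq
  have := hmin.hasDerivAt_eq_zero hd
  rw [hPs, inner_neg_right] at this
  linarith

/-- The open disc about `x` that touches the boundary at `b` lies on one side of the boundary, so
that the side of `x` can be read off from the graph near `b`. -/
lemma IsTangentGraph.sideSign_mul {Ω : Set Plane} {x b τ n : Plane} {γ : ℝ → ℝ}
    (hγ : IsTangentGraph Ω b τ n γ) (hΩ : IsOpen Ω) (hb : IsUniqueClosest (frontier Ω) x b)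
    {ρ : ℝ} (hx : x - b = ρ • n) : sideSign Ω x * ‖b - x‖ = ρ := by
  have hn := hγ.norm_normal
  have hnorm : ‖b - x‖ = |ρ| := by rw [norm_sub_rev, hx, norm_smul, hn, mul_one, Real.norm_eq_abs]
  rcases eq_or_ne ρ 0 with rfl | hρ
  · rw [hnorm, abs_zero, mul_zero]
  have hr : 0 < dist x b := by
    rw [dist_comm, dist_eq_norm, hnorm]; exact abs_pos.2 hρ
  have hdisj : ∀ y ∈ Metric.ball x (dist x b), y ∉ frontier Ω := by
    intro y hy hyf
    rw [Metric.mem_ball, dist_comm] at hy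
    by_cases h : y = b
    · rw [h] at hy; exact lt_irrefl _ hy
    · exact lt_asymm hy (hb.2 y hyf h)
  have hcover : Metric.ball x (dist x b) ⊆ Ω ∪ (closure Ω)ᶜ := by
    intro y hy
    by_cases h : y ∈ closure Ω
    · left
      by_contra hyΩ
      exact hdisj y hy (by rw [hΩ.frontier_eq]; exact ⟨h, hyΩ⟩)
    · right; exact h
  have hpre : IsPreconnected (Metric.ball x (dist x b)) := (convex_ball _ _).isPreconnected
  have hdis : Disjoint Ω (closure Ω)ᶜ := disjoint_compl_right.mono_left subset_closure
  have hxx : x ∈ Metric.ball x (dist x b) := Metric.mem_ball_self hr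
  -- points of the segment from `b` to `x` close to `b`
  have hseg : ∀ᶠ ε in 𝓝[>] (0 : ℝ), b + ε • (x - b) ∈ Metric.ball x (dist x b) ∧
      (b + ε • (x - b) ∈ Ω ↔ 0 < ρ) := by
    have ht : Tendsto (fun ε : ℝ => b + ε • (x - b)) (𝓝[>] 0) (𝓝 b) := by
      have : Continuous fun ε : ℝ => b + ε • (x - b) := by fun_prop
      simpa using (this.tendsto 0).mono_left (nhdsWithin_le_nhds (s := Ioi 0))
    filter_upwards [ht.eventually hγ.eventually_mem_iff, Ioo_mem_nhdsGT (zero_lt_one' ℝ)]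
      with ε h1 h2
    constructor
    · rw [Metric.mem_ball, dist_eq_norm,
        show b + ε • (x - b) - x = -((1 - ε) • (x - b)) by module, norm_neg, norm_smul,
        Real.norm_eq_abs, abs_of_pos (by linarith [h2.2]), dist_eq_norm]
      rw [dist_eq_norm] at hr
      nlinarith [h2.1]
    · rw [h1, add_sub_cancel_left, hx, smul_smul, inner_smul_right, inner_smul_right,
        hγ.orthogonal, mul_zero, hγ.map_zero, real_inner_self_eq_norm_sq, hn]
      simp [h2.1]
  obtain ⟨ε, hε1, hε2⟩ := hseg.exists
  rw [hnorm]
  unfold sideSign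
  by_cases hxΩ : x ∈ Ω
  · have hsub := hpre.subset_left_of_subset_union hΩ isClosed_closure.isOpen_compl hdis hcover
      ⟨x, hxx, hxΩ⟩
    rw [if_pos hxΩ, one_mul, abs_of_pos (hε2.1 (hsub hε1))]
  · have hx2 : x ∈ (closure Ω)ᶜ := (hcover hxx).resolve_left hxΩ
    have hsub := hpre.subset_right_of_subset_union hΩ isClosed_closure.isOpen_compl hdis hcover
      ⟨x, hxx, hx2⟩
    have hnp : ¬ 0 < ρ := fun h => hsub hε1 (subset_closure (hε2.2 h))
    rw [if_neg hxΩ, if_neg (hdisj x hxx), abs_of_nonpos (not_lt.1 hnp)]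
    ring

namespace IsC5Region

variable {ι : Type*} {Ω : Set Plane} {p : ι → ℝ → Plane}

lemma mem_frontier (hΩ : IsC5Region Ω p) (i : ι) (s : ℝ) : p i s ∈ frontier Ω := by
  rw [hΩ.frontier_eq]; exact mem_iUnion.2 ⟨i, s, rfl⟩

lemma differentiable (hΩ : IsC5Region Ω p) (i : ι) : Differentiable ℝ (p i) :=
  (hΩ.contDiff i).differentiable (by simp)

lemma contDiff_deriv (hΩ : IsC5Region Ω p) (i : ι) : ContDiff ℝ 4 (deriv (p i)) :=
  (contDiff_succ_iff_deriv (n := 4).1 (by simpa using! hΩ.contDiff i)).2.2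

lemma exists_param (hΩ : IsC5Region Ω p) {b : Plane} (hb : b ∈ frontier Ω) :
    ∃ i, ∃ s ∈ Icc (0 : ℝ) 1, p i s = b := by
  rw [hΩ.frontier_eq] at hb
  obtain ⟨i, s, rfl⟩ := mem_iUnion.1 hb
  obtain ⟨u, hu, h⟩ := (hΩ.periodic i).exists_mem_Ico₀ one_pos s
  exact ⟨i, u, Ico_subset_Icc_self hu, h.symm⟩

lemma injective_mod_one (hΩ : IsC5Region Ω p) {i : ι} {s u : ℝ} (h : p i s = p i u) :
    Int.fract s = Int.fract u := by
  have hf (v : ℝ) : p i (Int.fract v) = p i v := by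
    have := (hΩ.periodic i).sub_int_mul_eq ⌊v⌋ (x := v)
    rw [mul_one] at this
    exact this
  refine hΩ.simple i ⟨Int.fract_nonneg _, Int.fract_lt_one _⟩
    ⟨Int.fract_nonneg _, Int.fract_lt_one _⟩ ?_
  rw [hf, hf, h]

/-- Boundary points whose parameters are apart are at a positive distance from each other. -/
lemma exists_dist_lower_bound [Finite ι] (hΩ : IsC5Region Ω p) {h₀ : ℝ} (h₀_pos : 0 < h₀) :
    ∃ d, 0 < d ∧
      (∀ i, ∀ s ∈ Icc (0 : ℝ) 1, ∀ h ∈ Icc (-(1 / 2) : ℝ) (1 / 2), h₀ ≤ |h| →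
        d ≤ dist (p i (s + h)) (p i s)) ∧
      ∀ i j, i ≠ j → ∀ s ∈ Icc (0 : ℝ) 1, ∀ u ∈ Icc (0 : ℝ) 1, d ≤ dist (p i s) (p j u) := by
  have hc (i : ι) : Continuous (p i) := (hΩ.contDiff i).continuous
  have hmin {A : Set (ℝ × ℝ)} (hA : IsCompact A) {f : ℝ × ℝ → ℝ} (hf : Continuous f)
      (hpos : ∀ v ∈ A, 0 < f v) : ∃ d, 0 < d ∧ ∀ v ∈ A, d ≤ f v := by
    rcases A.eq_empty_or_nonempty with rfl | hne
    · exact ⟨1, one_pos, by simp⟩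
    · obtain ⟨v, hv, hvm⟩ := hA.exists_isMinOn hne hf.continuousOn
      exact ⟨f v, hpos v hv, fun w hw => hvm hw⟩
  obtain ⟨d₁, hd₁, H₁⟩ := exists_pos_forall_of_finite (ι := ι)
    (P := fun i d => ∀ s ∈ Icc (0 : ℝ) 1, ∀ h ∈ Icc (-(1 / 2) : ℝ) (1 / 2), h₀ ≤ |h| →
        d ≤ dist (p i (s + h)) (p i s))
    (fun i c d _ hcd H s hs h hh hh0 => hcd.trans (H s hs h hh hh0)) fun i => by
      obtain ⟨d, hd, H⟩ := hmin
        (A := Icc (0 : ℝ) 1 ×ˢ (Icc (-(1 / 2) : ℝ) (1 / 2) ∩ {h | h₀ ≤ |h|}))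
        (isCompact_Icc.prod (isCompact_Icc.inter_right
          (isClosed_le continuous_const continuous_abs)))
        (f := fun v => dist (p i (v.1 + v.2)) (p i v.1)) (by have := hc i; fun_prop) (by
          rintro ⟨s, h⟩ ⟨-, hh, hh0⟩
          refine dist_pos.2 fun heq => ?_
          obtain ⟨z, hz⟩ := Int.fract_eq_fract.1 (hΩ.injective_mod_one heq)
          have hz' : h = z := by simpa using hz
          have h1 : |(z : ℝ)| ≤ 1 / 2 := by rw [← hz']; exact abs_le.2 hh
          have h2 : z = 0 := by
            by_contra hne
            have : (1 : ℝ) ≤ |(z : ℝ)| := by exact_mod_cast Int.one_le_abs hne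
            linarith
          have h3 : h₀ ≤ |h| := hh0
          rw [hz', h2] at h3
          simp at h3
          linarith)
      exact ⟨d, hd, fun s hs h hh hh0 => H (s, h) ⟨hs, hh, hh0⟩⟩
  obtain ⟨d₂, hd₂, H₂⟩ := exists_pos_forall_of_finite (ι := ι × ι)
    (P := fun v d => v.1 ≠ v.2 → ∀ s ∈ Icc (0 : ℝ) 1, ∀ u ∈ Icc (0 : ℝ) 1,
        d ≤ dist (p v.1 s) (p v.2 u))
    (fun i c d _ hcd H hne s hs h hh => hcd.trans (H hne s hs h hh)) fun ⟨i, j⟩ => by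
      by_cases hij : i = j
      · exact ⟨1, one_pos, fun h => absurd hij h⟩
      obtain ⟨d, hd, H⟩ := hmin (A := Icc (0 : ℝ) 1 ×ˢ Icc (0 : ℝ) 1)
        (isCompact_Icc.prod isCompact_Icc)
        (f := fun v => dist (p i v.1) (p j v.2)) (by have := hc i; have := hc j; fun_prop) (by
          rintro ⟨s, u⟩ -
          exact dist_pos.2 fun heq =>
            (hΩ.disjoint i j hij).ne_of_mem (mem_range_self s) (mem_range_self u) heq)
      exact ⟨d, hd, fun _ s hs u hu => H (s, u) ⟨hs, hu⟩⟩
  exact ⟨min d₁ d₂, lt_min hd₁ hd₂,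
    fun i s hs h hh hh0 => (min_le_left _ _).trans (H₁ i s hs h hh hh0),
    fun i j hij s hs u hu => (min_le_right _ _).trans (H₂ (i, j) hij s hs u hu)⟩

end IsC5Region

/-! ### Uniform local models of the boundary -/

lemma UniformlySmooth.exists_lipschitz {J : Type*} {m : ℕ} {f : J → ℝ → ℝ} {r : ℝ}
    (hf : UniformlySmooth (Icc (-r) r) (m + 1) f) :
    ∃ K, 0 ≤ K ∧ ∀ j, ∀ h ∈ Icc (-r) r, |f j h - f j 0| ≤ K * |h| := by
  obtain ⟨-, f', hd, hf'⟩ := hf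
  obtain ⟨K, hK⟩ := hf'.bounded
  refine ⟨max K 0, le_max_right _ _, fun j h hh => ?_⟩
  have h00 : (0 : ℝ) ∈ Icc (-r) r := ⟨by linarith [hh.1, hh.2], by linarith [hh.1, hh.2]⟩
  have := (convex_Icc (-r) r).norm_image_sub_le_of_norm_hasDerivWithin_le (C := max K 0)
    (fun x hx => (hd j x hx).hasDerivWithinAt) (fun x hx => (hK j x hx).trans (le_max_left _ _))
    h00 hh
  simpa using this

/-- A point of a boundary curve, given by its parameter `s` in `[0, 1]`, with an orthonormal frame
whose first vector points in the direction of the velocity. -/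
structure BoundaryFrame {ι : Type*} (p : ι → ℝ → Plane) where
  (i : ι) (s : ℝ) (τ n : Plane)
  mem : s ∈ Icc (0 : ℝ) 1
  norm_tangent : ‖τ‖ = 1
  norm_normal : ‖n‖ = 1
  orthogonal : inner ℝ τ n = 0
  tangent : inner ℝ τ (deriv (p i) s) = ‖deriv (p i) s‖

namespace BoundaryFrame

variable {ι : Type*} {p : ι → ℝ → Plane}

/-- Tangential coordinate along the curve. -/
noncomputable def X (j : BoundaryFrame p) (h : ℝ) : ℝ := inner ℝ j.τ (p j.i (j.s + h) - p j.i j.s)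

/-- Normal coordinate along the curve. -/
noncomputable def Y (j : BoundaryFrame p) (h : ℝ) : ℝ := inner ℝ j.n (p j.i (j.s + h) - p j.i j.s)

/-- Tangential component of the velocity. -/
noncomputable def X' (j : BoundaryFrame p) (h : ℝ) : ℝ := inner ℝ j.τ (deriv (p j.i) (j.s + h))

/-- Normal component of the velocity. -/
noncomputable def Y' (j : BoundaryFrame p) (h : ℝ) : ℝ := inner ℝ j.n (deriv (p j.i) (j.s + h))

lemma X_zero (j : BoundaryFrame p) : j.X 0 = 0 := by simp [X]

lemma Y_zero (j : BoundaryFrame p) : j.Y 0 = 0 := by simp [Y]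

lemma X'_zero (j : BoundaryFrame p) : j.X' 0 = ‖deriv (p j.i) j.s‖ := by
  simp only [X', add_zero]; exact j.tangent

lemma Y'_zero (j : BoundaryFrame p) : j.Y' 0 = 0 := by
  have h := Plane.norm_sq_eq j.norm_tangent j.norm_normal j.orthogonal (deriv (p j.i) j.s)
  rw [j.tangent] at h
  simp only [Y', add_zero]
  exact pow_eq_zero_iff (two_ne_zero) |>.1 (by linarith)

lemma hasDerivAt_X {Ω : Set Plane} (hΩ : IsC5Region Ω p) (j : BoundaryFrame p) (h : ℝ) :
    HasDerivAt j.X (j.X' h) h :=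
  (innerSL ℝ j.τ).hasFDerivAt.comp_hasDerivAt h ((HasDerivAt.comp_const_add j.s h
    (hΩ.differentiable j.i _).hasDerivAt).sub_const _)

lemma hasDerivAt_Y {Ω : Set Plane} (hΩ : IsC5Region Ω p) (j : BoundaryFrame p) (h : ℝ) :
    HasDerivAt j.Y (j.Y' h) h :=
  (innerSL ℝ j.n).hasFDerivAt.comp_hasDerivAt h ((HasDerivAt.comp_const_add j.s h
    (hΩ.differentiable j.i _).hasDerivAt).sub_const _)

lemma contDiff_X {Ω : Set Plane} (hΩ : IsC5Region Ω p) (j : BoundaryFrame p) :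
    ContDiff ℝ 5 j.X := by
  have := hΩ.contDiff j.i
  exact (innerSL ℝ j.τ).contDiff.comp
    (show ContDiff ℝ 5 fun h => p j.i (j.s + h) - p j.i j.s by fun_prop)

/-- The jet of the boundary and of the density `σ` in a frame, if the derivatives of `Y` and of the
density with respect to `X` are `G` and `H`. -/
def jet (G H : ℕ → ℝ → ℝ) : BoundaryJet where
  κ := G 2 0
  γ₃ := G 3 0
  γ₄ := G 4 0
  σ₀ := H 0 0
  σ₁ := H 1 0
  σ₂ := H 2 0
  σ₃ := H 3 0

end BoundaryFrame

/-- All boundary arcs of a region have models with the same constants, and the entries of the jet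
are the derivatives of the functions that represent the boundary and the density along the
tangent. -/
theorem IsC5Region.exists_arcModel {ι : Type*} [Finite ι] {Ω : Set Plane} {p : ι → ℝ → Plane}
    (hΩ : IsC5Region Ω p) {σ : Plane → ℝ} (hσ : ∀ i, ContDiff ℝ 4 (fun s => σ (p i s))) :
    ∃ K a h₀ r₀ : ℝ, 0 < a ∧ 0 < r₀ ∧ h₀ ≤ 1 / 2 ∧ ∀ j : BoundaryFrame p,
      ∃ (w : BoundaryJet) (U : ℝ → ℝ),
        ArcModel K a h₀ w j.X j.X' j.Y U (fun h => σ (p j.i (j.s + h))) ∧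
        (∀ ρ : ℝ, |ρ| ≤ r₀ → ∀ h ∈ Icc (-h₀) h₀, |2 * ρ * j.Y h - j.Y h ^ 2| ≤ j.X h ^ 2 / 2) ∧
        (∀ h ∈ Icc (-h₀) h₀, j.Y' h = U h * j.X' h) ∧
        (∀ γ : ℝ → ℝ, ContDiffAt ℝ 5 γ 0 → (∀ᶠ h in 𝓝 0, γ (j.X h) = j.Y h) →
          w.κ = iteratedDeriv 2 γ 0 ∧ w.γ₃ = iteratedDeriv 3 γ 0 ∧ w.γ₄ = iteratedDeriv 4 γ 0) ∧
        (∀ φ : ℝ → ℝ, (∀ᶠ h in 𝓝 0, φ (j.X h) = σ (p j.i (j.s + h))) →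
          w.σ₀ = φ 0 ∧ w.σ₁ = deriv φ 0 ∧ w.σ₂ = iteratedDeriv 2 φ 0) := by
  -- uniform smoothness of the velocity components and of the density
  have hinner (v : BoundaryFrame p → Plane) (hv : ∀ j, ‖v j‖ = 1) :
      UniformlySmooth (Icc (-(1 / 2)) (1 / 2)) 4
        (fun (j : BoundaryFrame p) h => (inner ℝ (v j) (deriv (p j.i) (j.s + h)) : ℝ)) :=
    uniformlySmooth_of_contDiff (m := 4) hΩ.contDiff_deriv (fun j : BoundaryFrame p => j.i)
      (fun j => j.s) (fun j => j.mem) (fun j => innerSL ℝ (v j))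
      (fun j => by rw [innerSL_apply_norm, hv j])
  have hX' : UniformlySmooth (Icc (-(1 / 2)) (1 / 2)) 4 (BoundaryFrame.X' (p := p)) :=
    hinner (fun j => j.τ) fun j => j.norm_tangent
  have hY' : UniformlySmooth (Icc (-(1 / 2)) (1 / 2)) 4 (BoundaryFrame.Y' (p := p)) :=
    hinner (fun j => j.n) fun j => j.norm_normal
  have hbdd (v : BoundaryFrame p → Plane) (hv : ∀ j, ‖v j‖ = 1) : ∃ K, ∀ j,
      ∀ h ∈ Icc (-(1 / 2) : ℝ) (1 / 2),
        |(inner ℝ (v j) (p j.i (j.s + h) - p j.i j.s) : ℝ)| ≤ K := by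
    obtain ⟨K, hK⟩ := exists_norm_le_of_continuous (fun i => (hΩ.contDiff i).continuous) (-1) 2
    refine ⟨K + K, fun j h hh => (abs_real_inner_le_norm _ _).trans ?_⟩
    rw [hv j, one_mul]
    exact (norm_sub_le _ _).trans (add_le_add
      (hK _ _ ⟨by linarith [j.mem.1, hh.1], by linarith [j.mem.2, hh.2]⟩)
      (hK _ _ ⟨by linarith [j.mem.1], by linarith [j.mem.2]⟩))
  have hX : UniformlySmooth (Icc (-(1 / 2)) (1 / 2)) 5 (BoundaryFrame.X (p := p)) :=
    ⟨hbdd (fun j => j.τ) fun j => j.norm_tangent, _, fun j h _ => j.hasDerivAt_X hΩ h, hX'⟩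
  have hY : UniformlySmooth (Icc (-(1 / 2)) (1 / 2)) 5 (BoundaryFrame.Y (p := p)) :=
    ⟨hbdd (fun j => j.n) fun j => j.norm_normal, _, fun j h _ => j.hasDerivAt_Y hΩ h, hY'⟩
  have hS : UniformlySmooth (Icc (-(1 / 2)) (1 / 2)) 4
      (fun (j : BoundaryFrame p) h => σ (p j.i (j.s + h))) := by
    have h := uniformlySmooth_of_contDiff (m := 4) hσ (fun j : BoundaryFrame p => j.i)
      (fun j => j.s) (fun j => j.mem) (fun _ => ContinuousLinearMap.id ℝ ℝ)
      (fun _ => ContinuousLinearMap.norm_id_le)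
    exact h
  -- the speed is bounded below, hence so is `X'` on a short interval
  obtain ⟨μ, hμ, hμb⟩ : ∃ μ, 0 < μ ∧ ∀ i, ∀ s ∈ Icc (0 : ℝ) 1, μ ≤ ‖deriv (p i) s‖ := by
    refine exists_pos_forall_of_finite (fun i c d _ hcd h s hs => hcd.trans (h s hs)) fun i => ?_
    obtain ⟨v, hv, hvm⟩ := isCompact_Icc.exists_isMinOn (nonempty_Icc.2 (zero_le_one' ℝ))
      (hΩ.contDiff_deriv i).continuous.norm.continuousOn
    exact ⟨_, norm_pos_iff.2 (hΩ.regular i v), fun w hw => hvm hw⟩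
  obtain ⟨L, hL, hLb⟩ := UniformlySmooth.exists_lipschitz (m := 3) hX'
  obtain ⟨M, hM, hMb⟩ := UniformlySmooth.exists_lipschitz (m := 4) hX
  set h₁ : ℝ := min (1 / 2) (μ / (2 * (L + 1))) with hh₁
  have h₁half : h₁ ≤ 1 / 2 := min_le_left _ _
  have hsub₁ : Icc (-h₁) h₁ ⊆ Icc (-(1 / 2)) (1 / 2) := Icc_subset_Icc (by linarith) h₁half
  have hX'pos : ∀ j : BoundaryFrame p, ∀ h ∈ Icc (-h₁) h₁, μ / 2 ≤ j.X' h := by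
    intro j h hh
    have h1 := hLb j h (hsub₁ hh)
    rw [j.X'_zero] at h1
    have h2 := hμb j.i j.s j.mem
    have h3 : |h| ≤ μ / (2 * (L + 1)) := (abs_le.2 hh).trans (min_le_right _ _)
    have h4 : L * |h| ≤ μ / 2 := by
      calc L * |h| ≤ (L + 1) * (μ / (2 * (L + 1))) := by gcongr; linarith
        _ = μ / 2 := by field_simp
    have h5 := (abs_le.1 (h1.trans h4)).1
    linarith
  have hμ2 : 0 < μ / 2 := half_pos hμ
  obtain ⟨G, hG0, hGd, hGb⟩ := UniformlySmooth.exists_chain (m := 5) hμ2 hX'pos (hX'.mono hsub₁)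
    (by norm_num) (hY.mono hsub₁)
  obtain ⟨H, hH0, hHd, hHb⟩ := UniformlySmooth.exists_chain (m := 4) hμ2 hX'pos (hX'.mono hsub₁)
    (by norm_num) (hS.mono hsub₁)
  have hunif {F : ℕ → BoundaryFrame p → ℝ → ℝ} {m : ℕ}
      (hF : ∀ k ≤ m, ∃ K, ∀ j, ∀ h ∈ Icc (-h₁) h₁, |F k j h| ≤ K) :
      ∃ K, ∀ k ≤ m, ∀ j, ∀ h ∈ Icc (-h₁) h₁, |F k j h| ≤ K := by
    obtain ⟨K, hK⟩ := exists_forall_of_finite (ι := Fin (m + 1))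
      (P := fun k K => ∀ j, ∀ h ∈ Icc (-h₁) h₁, |F k j h| ≤ K)
      (fun i K L hKL hi j h hh => (hi j h hh).trans hKL) (fun k => hF k (by omega))
    exact ⟨K, fun k hk => hK ⟨k, by omega⟩⟩
  obtain ⟨K₁, hK₁⟩ := hunif hGb
  obtain ⟨K₂, hK₂⟩ := hunif hHb
  set K := max 1 (max K₁ K₂) with hKdef
  have hK1 : 1 ≤ K := le_max_left _ _
  have hKG : ∀ k ≤ 5, ∀ j, ∀ h ∈ Icc (-h₁) h₁, |G k j h| ≤ K := fun k hk j h hh =>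
    (hK₁ k hk j h hh).trans ((le_max_left _ _).trans (le_max_right _ _))
  have hKH : ∀ k ≤ 4, ∀ j, ∀ h ∈ Icc (-h₁) h₁, |H k j h| ≤ K := fun k hk j h hh =>
    (hK₂ k hk j h hh).trans ((le_max_right _ _).trans (le_max_right _ _))
  have hK0 : 0 < K := one_pos.trans_le hK1
  -- on a shorter interval the height `Y ≤ K X²` is small compared with `X`
  set h₀ : ℝ := min h₁ (1 / (2 * (K * M + 1))) with hh₀
  have h₁pos : 0 < h₁ := lt_min (by norm_num) (by positivity)
  have h₀pos : 0 < h₀ := lt_min h₁pos (by positivity)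
  have h₀le : h₀ ≤ h₁ := min_le_left _ _
  have hsub₀ : Icc (-h₀) h₀ ⊆ Icc (-h₁) h₁ := Icc_subset_Icc (by linarith) h₀le
  have h0mem : (0 : ℝ) ∈ Icc (-h₁) h₁ := ⟨by linarith, h₁pos.le⟩
  refine ⟨K, μ / 2 * h₀, h₀, 1 / (8 * K), by positivity, by positivity, h₀le.trans h₁half,
    fun j => ⟨BoundaryFrame.jet (fun k => G k j) (fun k => H k j), G 1 j, ?_⟩⟩
  have hXd : ∀ h ∈ Icc (-h₀) h₀, HasDerivAt j.X (j.X' h) h := fun h _ => j.hasDerivAt_X hΩ h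
  have hXp : ∀ h ∈ Icc (-h₀) h₀, 0 < j.X' h := fun h hh => hμ2.trans_le (hX'pos j h (hsub₀ hh))
  have hG00 : G 0 j 0 = 0 := by rw [hG0, j.Y_zero]
  have hYd : ∀ h ∈ Icc (-h₁) h₁, j.Y' h = G 1 j h * j.X' h := by
    intro h hh
    have := hGd 0 (by norm_num) j h hh
    rw [hG0] at this
    exact (j.hasDerivAt_Y hΩ h).unique this
  have hG10 : G 1 j 0 = 0 := by
    have h1 := hYd 0 h0mem
    rw [j.Y'_zero] at h1
    exact (mul_eq_zero.1 h1.symm).resolve_right (hμ2.trans_le (hX'pos j 0 h0mem)).ne'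
  have hYsq : ∀ h ∈ Icc (-h₀) h₀, |j.Y h| ≤ K * j.X h ^ 2 := by
    intro h hh
    have := abs_sub_taylor_le j.X_zero hXd hXp 2 (G := fun k => G k j)
      (fun k hk x hx => hGd k (by omega) j x (hsub₀ hx))
      (fun x hx => hKG 2 (by norm_num) j x (hsub₀ hx)) h hh
    simpa [Finset.sum_range_succ, hG00, hG10, hG0] using this
  have hGc (k : ℕ) (hk : k < 5) : ContinuousOn (G k j) (Icc (-h₀) h₀) := fun h hh =>
    (hGd k hk j h (hsub₀ hh)).continuousAt.continuousWithinAt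
  have hXle : ∀ h ∈ Icc (-h₀) h₀, |j.X h| ≤ M * |h| := by
    intro h hh
    have := hMb j h (hsub₁ (hsub₀ hh))
    rwa [j.X_zero, sub_zero] at this
  have hnear : ∀ᶠ h in 𝓝 (0 : ℝ), h ∈ Icc (-h₁) h₁ := Icc_mem_nhds (by linarith) h₁pos
  refine ⟨⟨h₀pos, ?_, hXd, hXp, ?_, ?_, hGc 1 (by norm_num), ?_, ?_, ?_, ?_, ?_, ?_⟩, ?_,
    fun h hh => hYd h (hsub₀ hh), ?_, ?_⟩
  · exact ⟨hKG 2 (by norm_num) j 0 h0mem, hKG 3 (by norm_num) j 0 h0mem,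
      hKG 4 (by norm_num) j 0 h0mem, hKH 0 (by norm_num) j 0 h0mem, hKH 1 (by norm_num) j 0 h0mem,
      hKH 2 (by norm_num) j 0 h0mem, hKH 3 (by norm_num) j 0 h0mem⟩
  · have h1 := (hΩ.contDiff_deriv j.i).continuous
    have : Continuous j.X' := by unfold BoundaryFrame.X'; fun_prop
    exact this.continuousOn
  · exact fun h _ => (j.hasDerivAt_Y hΩ h).continuousAt.continuousWithinAt
  · have := (hσ j.i).continuous
    have : Continuous fun h => σ (p j.i (j.s + h)) := this.comp (continuous_const_add j.s)
    exact this.continuousOn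
  · obtain ⟨c, hc, hcX⟩ := exists_hasDerivAt_eq_slope j.X j.X' (show -h₀ < 0 by linarith)
      (fun x _ => (j.hasDerivAt_X hΩ x).continuousAt.continuousWithinAt)
      (fun x _ => j.hasDerivAt_X hΩ x)
    have h1 := hX'pos j c (hsub₀ ⟨hc.1.le, by linarith [hc.2]⟩)
    rw [hcX, j.X_zero, le_div_iff₀ (by linarith)] at h1
    linarith
  · obtain ⟨c, hc, hcX⟩ := exists_hasDerivAt_eq_slope j.X j.X' h₀pos
      (fun x _ => (j.hasDerivAt_X hΩ x).continuousAt.continuousWithinAt)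
      (fun x _ => j.hasDerivAt_X hΩ x)
    have h1 := hX'pos j c (hsub₀ ⟨by linarith [hc.1], hc.2.le⟩)
    rw [hcX, j.X_zero, le_div_iff₀ (by linarith)] at h1
    linarith
  · intro h hh
    have := abs_sub_taylor_le j.X_zero hXd hXp 5 (G := fun k => G k j)
      (fun k hk x hx => hGd k (by omega) j x (hsub₀ hx))
      (fun x hx => hKG 5 le_rfl j x (hsub₀ hx)) h hh
    refine (le_of_eq ?_).trans this
    simp [Finset.sum_range_succ, hG00, hG10, hG0, Nat.factorial, BoundaryFrame.jet]
    congr 1; ring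
  · intro h hh
    have := abs_sub_taylor_le j.X_zero hXd hXp 4 (G := fun k => G (k + 1) j)
      (fun k hk x hx => hGd (k + 1) (by omega) j x (hsub₀ hx))
      (fun x hx => hKG 5 le_rfl j x (hsub₀ hx)) h hh
    refine (le_of_eq ?_).trans this
    simp [Finset.sum_range_succ, hG10, Nat.factorial, BoundaryFrame.jet]
    congr 1; ring
  · intro h hh
    have := abs_sub_taylor_le j.X_zero hXd hXp 4 (G := fun k => H k j)
      (fun k hk x hx => hHd k (by omega) j x (hsub₀ hx))
      (fun x hx => hKH 4 le_rfl j x (hsub₀ hx)) h hh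
    refine (le_of_eq ?_).trans this
    simp [Finset.sum_range_succ, hH0, Nat.factorial, BoundaryFrame.jet]
    congr 1; ring
  · intro ρ hρ h hh
    have hY1 := hYsq h hh
    have hX1 : K * |j.X h| ≤ 1 / 2 := by
      have h1 : |h| ≤ 1 / (2 * (K * M + 1)) := (abs_le.2 hh).trans (min_le_right _ _)
      calc K * |j.X h| ≤ K * (M * |h|) := by gcongr; exact hXle h hh
        _ ≤ (K * M + 1) * |h| := by nlinarith [abs_nonneg h]
        _ ≤ (K * M + 1) * (1 / (2 * (K * M + 1))) := by gcongr
        _ = 1 / 2 := by field_simp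
    have hX2 : (K * |j.X h|) ^ 2 ≤ (1 / 2) ^ 2 := by gcongr
    calc |2 * ρ * j.Y h - j.Y h ^ 2| ≤ |2 * ρ * j.Y h| + |j.Y h ^ 2| := abs_sub _ _
      _ = 2 * |ρ| * |j.Y h| + |j.Y h| ^ 2 := by
        rw [abs_mul, abs_mul, abs_pow, abs_two]
      _ ≤ 2 * (1 / (8 * K)) * (K * j.X h ^ 2) + (K * j.X h ^ 2) ^ 2 := by gcongr
      _ = j.X h ^ 2 / 4 + (K * |j.X h|) ^ 2 * j.X h ^ 2 := by
        rw [mul_pow, mul_pow, sq_abs]; field_simp; ring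
      _ ≤ j.X h ^ 2 / 4 + (1 / 2) ^ 2 * j.X h ^ 2 := by gcongr
      _ = _ := by ring
  · intro γ hγ hγX
    have key {k : ℕ} (hk : k ≤ 5) : iteratedDeriv k γ 0 = G k j 0 :=
      iteratedDeriv_eq_chain (m := 5) (X' := j.X') (G := fun k => G k j) j.X_zero
        (hnear.mono fun h hh => ⟨j.hasDerivAt_X hΩ h, (hμ2.trans_le (hX'pos j h hh)).ne'⟩) hγ
        (by rw [hG0]; exact hγX) (fun k hk => hnear.mono fun h hh => hGd k hk j h hh) hk
    exact ⟨(key (by norm_num)).symm, (key (by norm_num)).symm, (key (by norm_num)).symm⟩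
  · intro φ hφX
    have hσc : ContDiff ℝ 4 fun h => σ (p j.i (j.s + h)) :=
      (hσ j.i).comp (contDiff_const.add contDiff_id)
    have hφ : ContDiffAt ℝ 4 φ 0 := contDiffAt_of_comp_eventuallyEq (m := 4) (by norm_num) j.X_zero
      ((j.contDiff_X hΩ).contDiffAt.of_le (by norm_num)) (j.hasDerivAt_X hΩ 0)
      (hμ2.trans_le (hX'pos j 0 h0mem)).ne' hσc.contDiffAt hφX
    have key {k : ℕ} (hk : k ≤ 4) : iteratedDeriv k φ 0 = H k j 0 :=
      iteratedDeriv_eq_chain (m := 4) (X' := j.X') (G := fun k => H k j) j.X_zero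
        (hnear.mono fun h hh => ⟨j.hasDerivAt_X hΩ h, (hμ2.trans_le (hX'pos j h hh)).ne'⟩) hφ
        (by rw [hH0]; exact hφX) (fun k hk => hnear.mono fun h hh => hHd k hk j h hh) hk
    refine ⟨?_, ?_, (key (by norm_num)).symm⟩
    · have := key (k := 0) (by norm_num)
      rw [iteratedDeriv_zero] at this; exact this.symm
    · have := key (k := 1) (by norm_num)
      rw [iteratedDeriv_one] at this; exact this.symm

/-! ### The layer at a fixed time, and the integral over time -/

lemma heatKernel_nonneg (y : Plane) {t : ℝ} (ht : 0 < t) : 0 ≤ heatKernel y t := by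
  unfold heatKernel; positivity

/-- At a distance `d` from the source the heat kernel is flat to every order as `t → 0`. -/
lemma heatKernel_le {d t : ℝ} (hd : 0 < d) (ht : 0 < t) (ht1 : t ≤ 1) {y : Plane} (hy : d ≤ ‖y‖) :
    heatKernel y t ≤ 384 / d ^ 6 * (t * √t) := by
  have h := cube_mul_exp_neg_le (u := d ^ 2 / (4 * t)) (by positivity)
  have he : Real.exp (-(‖y‖ ^ 2) / (4 * t)) ≤ Real.exp (-(d ^ 2 / (4 * t))) := by
    rw [neg_div, Real.exp_le_exp, neg_le_neg_iff]; gcongr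
  have h3 : Real.exp (-(d ^ 2 / (4 * t))) ≤ 384 * t ^ 3 / d ^ 6 := by
    rw [le_div_iff₀ (by positivity)]
    have : (d ^ 2 / (4 * t)) ^ 3 = d ^ 6 / (64 * t ^ 3) := by ring
    rw [this, div_mul_eq_mul_div, div_le_iff₀ (by positivity)] at h
    linarith
  have hpi : 1 ≤ 4 * Real.pi := by linarith [Real.pi_gt_three]
  have hts : t ≤ √t := Real.le_sqrt_of_sq_le (by nlinarith)
  unfold heatKernel
  calc _ ≤ 384 * t ^ 3 / d ^ 6 / (4 * Real.pi * t) := by gcongr; exact he.trans h3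
    _ ≤ 384 * t ^ 3 / d ^ 6 / t := by gcongr; nlinarith
    _ = 384 / d ^ 6 * (t * t) := by field_simp
    _ ≤ _ := by gcongr

/-- The integrand of `layerAtTime` on the curve `p i`. -/
noncomputable def curveIntegrand {ι : Type*} (p : ι → ℝ → Plane) (σ : Plane → ℝ) (x : Plane)
    (t : ℝ) (i : ι) (s : ℝ) : ℝ :=
  heatKernel (x - p i s) t * σ (p i s) * ‖deriv (p i) s‖

namespace IsC5Region

variable {ι : Type*} {Ω : Set Plane} {p : ι → ℝ → Plane} {σ : Plane → ℝ}

lemma continuous_curveIntegrand (hΩ : IsC5Region Ω p)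
    (hσ : ∀ i, ContDiff ℝ 4 (fun s => σ (p i s))) (x : Plane) (t : ℝ) (i : ι) :
    Continuous (curveIntegrand p σ x t i) := by
  have h1 := (hΩ.contDiff i).continuous
  have h2 := (hσ i).continuous
  have h3 := (hΩ.contDiff_deriv i).continuous
  have h4 : Continuous fun s => heatKernel (x - p i s) t := by unfold heatKernel; fun_prop
  exact (h4.mul h2).mul h3.norm

lemma periodic_curveIntegrand (hΩ : IsC5Region Ω p) (σ : Plane → ℝ) (x : Plane) (t : ℝ) (i : ι) :
    Function.Periodic (curveIntegrand p σ x t i) 1 := by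
  intro s
  have hd : deriv (p i) (s + 1) = deriv (p i) s := by
    rw [← deriv_comp_add_const]
    congr 1
    exact funext (hΩ.periodic i)
  unfold curveIntegrand
  rw [hΩ.periodic i s, hd]

/-- A boundary curve can be traversed starting half a period before any of its points. -/
lemma integral_curveIntegrand (hΩ : IsC5Region Ω p) (σ : Plane → ℝ) (x : Plane) (t : ℝ) (i : ι)
    (s : ℝ) : ∫ u in (0 : ℝ)..1, curveIntegrand p σ x t i u
      = ∫ h in (-(1 / 2) : ℝ)..(1 / 2), curveIntegrand p σ x t i (s + h) := by
  have h := (hΩ.periodic_curveIntegrand σ x t i).intervalIntegral_add_eq 0 (s + -(1 / 2))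
  rw [zero_add] at h
  rw [h, intervalIntegral.integral_comp_add_left (curveIntegrand p σ x t i)]
  congr 1; ring

/-- A uniform bound for the density and the speed. -/
lemma exists_density_bound [Finite ι] (hΩ : IsC5Region Ω p)
    (hσ : ∀ i, ContDiff ℝ 4 (fun s => σ (p i s))) :
    ∃ B, 0 ≤ B ∧ ∀ i, ∀ u ∈ Icc (-1 : ℝ) 2, |σ (p i u)| * ‖deriv (p i) u‖ ≤ B := by
  obtain ⟨B, hB⟩ := exists_norm_le_of_continuous (P := fun i u => |σ (p i u)| * ‖deriv (p i) u‖)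
    (fun i => (hσ i).continuous.abs.mul (hΩ.contDiff_deriv i).continuous.norm) (-1) 2
  exact ⟨max B 0, le_max_right _ _, fun i u hu =>
    (le_abs_self _).trans ((hB i u hu).trans (le_max_left _ _))⟩

end IsC5Region

lemma abs_curveIntegrand_le {ι : Type*} {p : ι → ℝ → Plane} {σ : Plane → ℝ} {B : ℝ} {i : ι}
    {u : ℝ} (hB : |σ (p i u)| * ‖deriv (p i) u‖ ≤ B) {d t : ℝ} (hd : 0 < d) (ht : 0 < t)
    (ht1 : t ≤ 1) {x : Plane} (hx : d ≤ ‖x - p i u‖) :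
    |curveIntegrand p σ x t i u| ≤ 384 / d ^ 6 * B * (t * √t) := by
  unfold curveIntegrand
  rw [abs_mul, abs_mul, abs_norm, abs_of_nonneg (heatKernel_nonneg _ ht), mul_assoc]
  calc _ ≤ 384 / d ^ 6 * (t * √t) * B := by
        gcongr
        · exact heatKernel_le hd ht ht1 hx
    _ = _ := by ring

/-- In the frame at the base point, the integrand is the one treated by `ArcModel`. -/
lemma BoundaryFrame.curveIntegrand_eq {ι : Type*} {p : ι → ℝ → Plane} (j : BoundaryFrame p)
    {x : Plane} {ρ : ℝ} (hx : x - p j.i j.s = ρ • j.n) (σ : Plane → ℝ) {t h u : ℝ}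
    (hpos : 0 < j.X' h) (hu : j.Y' h = u * j.X' h) :
    curveIntegrand p σ x t j.i (j.s + h)
      = 1 / (4 * Real.pi * t) * (Real.exp (-(j.X h ^ 2 + (j.Y h - ρ) ^ 2) / (4 * t))
        * (σ (p j.i (j.s + h)) * √(1 + u ^ 2)) * j.X' h) := by
  have hsub : x - p j.i (j.s + h) = ρ • j.n - (p j.i (j.s + h) - p j.i j.s) := by
    rw [← hx]; abel
  have h1 : ‖x - p j.i (j.s + h)‖ ^ 2 = j.X h ^ 2 + (j.Y h - ρ) ^ 2 := by
    have hX : (inner ℝ j.τ (x - p j.i (j.s + h)) : ℝ) = -j.X h := by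
      rw [hsub, inner_sub_right, inner_smul_right, j.orthogonal, mul_zero, zero_sub]; rfl
    have hY : (inner ℝ j.n (x - p j.i (j.s + h)) : ℝ) = ρ - j.Y h := by
      rw [hsub, inner_sub_right, inner_smul_right, real_inner_self_eq_norm_sq, j.norm_normal,
        one_pow, mul_one]; rfl
    rw [Plane.norm_sq_eq j.norm_tangent j.norm_normal j.orthogonal, hX, hY]
    ring
  have h2 : ‖deriv (p j.i) (j.s + h)‖ = √(1 + u ^ 2) * j.X' h := by
    have h3 := Plane.norm_sq_eq j.norm_tangent j.norm_normal j.orthogonal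
      (deriv (p j.i) (j.s + h))
    change _ = j.X' h ^ 2 + j.Y' h ^ 2 at h3
    rw [hu] at h3
    rw [← Real.sqrt_sq (norm_nonneg _), h3, show j.X' h ^ 2 + (u * j.X' h) ^ 2
      = (1 + u ^ 2) * j.X' h ^ 2 by ring, Real.sqrt_mul (by positivity), Real.sqrt_sq hpos.le]
  unfold curveIntegrand heatKernel
  rw [h1, h2]
  ring

/-- The layer at time `t`, for a frame whose tangent points in the direction of the velocity:
the near arc contributes the Gaussian mean of its jet, and everything else is negligible. -/
theorem IsC5Region.exists_layerAtTime_bound {ι : Type*} [Fintype ι] {Ω : Set Plane}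
    {p : ι → ℝ → Plane} (hΩ : IsC5Region Ω p) {σ : Plane → ℝ}
    (hσ : ∀ i, ContDiff ℝ 4 (fun s => σ (p i s))) :
    ∃ C, 0 ≤ C ∧ ∀ (j : BoundaryFrame p), ∃ w : BoundaryJet,
      (∀ γ : ℝ → ℝ, ContDiffAt ℝ 5 γ 0 → (∀ᶠ h in 𝓝 0, γ (j.X h) = j.Y h) →
          w.κ = iteratedDeriv 2 γ 0 ∧ w.γ₃ = iteratedDeriv 3 γ 0 ∧ w.γ₄ = iteratedDeriv 4 γ 0) ∧
      (∀ φ : ℝ → ℝ, (∀ᶠ h in 𝓝 0, φ (j.X h) = σ (p j.i (j.s + h))) →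
          w.σ₀ = φ 0 ∧ w.σ₁ = deriv φ 0 ∧ w.σ₂ = iteratedDeriv 2 φ 0) ∧
      ∀ (x : Plane) (ρ : ℝ), x - p j.i j.s = ρ • j.n →
        IsUniqueClosest (frontier Ω) x (p j.i j.s) → ∀ t, 0 < t → t ≤ 1 →
        |layerAtTime p σ x t - lineKernel ρ t * (w.mean₀ ρ + w.mean₁ ρ * t)| ≤ C * (t * √t) := by
  classical
  obtain ⟨K, a, h₀, r₀, ha, hr₀, hh₀, hmodel⟩ := hΩ.exists_arcModel hσ
  obtain ⟨B, hB0, hB⟩ := hΩ.exists_density_bound hσ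
  by_cases hpos : 0 < h₀
  swap
  · -- there are no frames: an arc model has a positive length
    exact ⟨0, le_rfl, fun j => absurd (hmodel j).choose_spec.choose_spec.1.pos hpos⟩
  obtain ⟨d, hd, hd1, hd2⟩ := hΩ.exists_dist_lower_bound hpos
  obtain ⟨C₁, hC₁, hnear⟩ := ArcModel.exists_integral_bound K ha
  set r₁ := min r₀ (d / 2) with hr₁def
  have hr₁ : 0 < r₁ := lt_min hr₀ (by positivity)
  obtain ⟨C₂, hC₂, hfar⟩ := BoundaryJet.exists_far_bound K hr₁
  set D := 384 / r₁ ^ 6 * B with hD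
  have hD0 : 0 ≤ D := by positivity
  refine ⟨C₁ + C₂ + (Fintype.card ι + 1) * D, by positivity, fun j => ?_⟩
  obtain ⟨w, U, hm, hsmall, hU, hγ, hφ⟩ := hmodel j
  refine ⟨w, hγ, hφ, fun x ρ hx hb t ht ht1 => ?_⟩
  have hts : 0 ≤ t * √t := by positivity
  have hF (i : ι) : Continuous (curveIntegrand p σ x t i) := hΩ.continuous_curveIntegrand hσ x t i
  have hρ : ‖x - p j.i j.s‖ = |ρ| := by
    rw [hx, norm_smul, j.norm_normal, mul_one, Real.norm_eq_abs]
  have hlayer : layerAtTime p σ x t = ∑ i, ∫ u in (0 : ℝ)..1, curveIntegrand p σ x t i u := rfl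
  -- a full curve or a part of one at distance `r₁` from the target
  have hcurve (i : ι) (hdist : ∀ u ∈ Icc (0 : ℝ) 1, r₁ ≤ ‖x - p i u‖) :
      |∫ u in (0 : ℝ)..1, curveIntegrand p σ x t i u| ≤ D * (t * √t) := by
    have := intervalIntegral.norm_integral_le_of_norm_le_const (a := (0 : ℝ)) (b := 1)
      (f := curveIntegrand p σ x t i) (C := D * (t * √t)) fun u hu => by
        rw [uIoc_of_le zero_le_one] at hu
        exact abs_curveIntegrand_le (hB i u ⟨by linarith [hu.1], by linarith [hu.2]⟩) hr₁ ht ht1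
          (hdist u (Ioc_subset_Icc_self hu))
    simpa using this
  rcases le_or_gt r₁ |ρ| with hρr | hρr
  · -- target away from the boundary
    have hdist (i : ι) (u : ℝ) : r₁ ≤ ‖x - p i u‖ := by
      refine hρr.trans ?_
      rw [← hρ, ← dist_eq_norm, ← dist_eq_norm]
      by_cases h : p i u = p j.i j.s
      · rw [h]
      · exact (hb.2 _ (hΩ.mem_frontier i u) h).le
    have h1 : |layerAtTime p σ x t| ≤ Fintype.card ι * (D * (t * √t)) := by
      rw [hlayer]
      refine (Finset.abs_sum_le_sum_abs _ _).trans ?_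
      refine (Finset.sum_le_card_nsmul _ _ _ fun i _ => hcurve i fun u _ => hdist i u).trans ?_
      rw [nsmul_eq_mul, Finset.card_univ]
    have h2 := hfar w hm.jet_le t ht ht1 ρ hρr
    calc _ ≤ |layerAtTime p σ x t| + |lineKernel ρ t * (w.mean₀ ρ + w.mean₁ ρ * t)| := abs_sub _ _
      _ ≤ Fintype.card ι * (D * (t * √t)) + C₂ * (t * √t) := add_le_add h1 h2
      _ = (C₂ + Fintype.card ι * D) * (t * √t) := by ring
      _ ≤ _ := mul_le_mul_of_nonneg_right (by linarith) hts
  · -- target near the boundary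
    have hρ0 : |ρ| ≤ r₀ := hρr.le.trans (min_le_left _ _)
    have hρd : |ρ| ≤ d / 2 := hρr.le.trans (min_le_right _ _)
    have hdist {y : Plane} (hy : d ≤ dist y (p j.i j.s)) : r₁ ≤ ‖x - y‖ := by
      have h1 : dist y (p j.i j.s) ≤ dist x y + dist x (p j.i j.s) := dist_triangle_left _ _ _
      rw [dist_eq_norm x, dist_eq_norm x, hρ] at h1
      exact (min_le_right _ _).trans (by linarith)
    have hother : |∑ i ∈ Finset.univ.erase j.i, ∫ u in (0 : ℝ)..1, curveIntegrand p σ x t i u|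
        ≤ Fintype.card ι * (D * (t * √t)) := by
      refine (Finset.abs_sum_le_sum_abs _ _).trans ?_
      refine (Finset.sum_le_card_nsmul _ _ (D * (t * √t)) fun i hi => hcurve i fun u hu =>
        hdist (hd2 i j.i (Finset.ne_of_mem_erase hi) u hu j.s j.mem)).trans ?_
      rw [nsmul_eq_mul]
      gcongr
      exact Finset.card_le_univ _
    have hF' : Continuous fun h => curveIntegrand p σ x t j.i (j.s + h) :=
      (hF j.i).comp (continuous_const_add j.s)
    have hpart {α β : ℝ} (hαβ : α ≤ β) (hα : -(1 / 2) ≤ α) (hβ : β ≤ 1 / 2)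
        (habs : ∀ h ∈ Ioc α β, h₀ ≤ |h|) :
        |∫ h in α..β, curveIntegrand p σ x t j.i (j.s + h)| ≤ D * (t * √t) * (β - α) := by
      have := intervalIntegral.norm_integral_le_of_norm_le_const (a := α) (b := β)
        (f := fun h => curveIntegrand p σ x t j.i (j.s + h)) (C := D * (t * √t)) fun h hh => by
          rw [uIoc_of_le hαβ] at hh
          have h1 := hd1 j.i j.s j.mem h ⟨by linarith [hh.1], by linarith [hh.2]⟩ (habs h hh)
          exact abs_curveIntegrand_le (hB j.i (j.s + h) ⟨by linarith [hh.1, j.mem.1],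
            by linarith [hh.2, j.mem.2]⟩) hr₁ ht ht1 (hdist h1)
      rwa [abs_of_nonneg (sub_nonneg.2 hαβ)] at this
    have hmid : ∫ h in (-h₀)..h₀, curveIntegrand p σ x t j.i (j.s + h)
        = 1 / (4 * Real.pi * t) * ∫ h in (-h₀)..h₀,
          Real.exp (-(j.X h ^ 2 + (j.Y h - ρ) ^ 2) / (4 * t))
            * (σ (p j.i (j.s + h)) * √(1 + U h ^ 2)) * j.X' h := by
      rw [← intervalIntegral.integral_const_mul]
      refine intervalIntegral.integral_congr fun h hh => ?_
      rw [uIcc_of_le (by linarith)] at hh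
      exact j.curveIntegrand_eq hx σ (hm.deriv_pos h hh) (hU h hh)
    have hmid2 : |(∫ h in (-h₀)..h₀, curveIntegrand p σ x t j.i (j.s + h))
        - lineKernel ρ t * (w.mean₀ ρ + w.mean₁ ρ * t)| ≤ C₁ * (t * √t) := by
      have h1 := hnear h₀ w j.X j.X' j.Y U _ hm t ht ht1 ρ (hsmall ρ hρ0)
      have h2 : lineKernel ρ t * (w.mean₀ ρ + w.mean₁ ρ * t) = 1 / (4 * Real.pi * t)
          * (Real.exp (-ρ ^ 2 / (4 * t)) * (√(4 * Real.pi * t)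
            * (w.mean₀ ρ + w.mean₁ ρ * t))) := by unfold lineKernel; ring
      have hpi : 1 ≤ 4 * Real.pi := by linarith [Real.pi_gt_three]
      rw [hmid, h2, ← mul_sub, abs_mul, abs_of_pos (by positivity)]
      calc _ ≤ 1 / (4 * Real.pi * t) * (C₁ * t ^ 2 * √t) := by gcongr
        _ ≤ 1 / t * (C₁ * t ^ 2 * √t) := by gcongr; nlinarith
        _ = _ := by field_simp
    have hself : |(∫ u in (0 : ℝ)..1, curveIntegrand p σ x t j.i u)
        - lineKernel ρ t * (w.mean₀ ρ + w.mean₁ ρ * t)| ≤ (C₁ + D) * (t * √t) := by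
      rw [hΩ.integral_curveIntegrand σ x t j.i j.s,
        ← intervalIntegral.integral_add_adjacent_intervals (b := -h₀)
          (hF'.intervalIntegrable _ _) (hF'.intervalIntegrable _ _),
        ← intervalIntegral.integral_add_adjacent_intervals (a := -h₀) (b := h₀)
          (hF'.intervalIntegrable _ _) (hF'.intervalIntegrable _ _)]
      have h1 := hpart (α := -(1 / 2)) (β := -h₀) (by linarith) le_rfl (by linarith)
        fun h hh => le_abs.2 (Or.inr (by linarith [hh.2]))
      have h2 := hpart (α := h₀) (β := 1 / 2) (by linarith) (by linarith) le_rfl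
        fun h hh => le_abs.2 (Or.inl hh.1.le)
      have h3 : D * (t * √t) * (-h₀ - -(1 / 2)) + D * (t * √t) * (1 / 2 - h₀) ≤ D * (t * √t) := by
        have := mul_nonneg (mul_nonneg hD0 hts) hpos.le
        nlinarith
      rw [abs_le] at h1 h2 hmid2 ⊢
      constructor <;> linarith [h1.1, h1.2, h2.1, h2.2, hmid2.1, hmid2.2]
    rw [hlayer, ← Finset.add_sum_erase _ _ (Finset.mem_univ j.i)]
    rw [abs_le] at hself hother ⊢
    have h4 : 0 ≤ C₂ * (t * √t) := by positivity
    constructor <;> linarith [hself.1, hself.2, hother.1, hother.2]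

/-- Transport of the oriented statement to an arbitrary tangent graph. Reversing the tangent changes
the signs of `γ₃` and `σ₁`, which enter through their product only. -/
theorem IsC5Region.exists_layerAtTime_bound_of_isTangentGraph {ι : Type*} [Fintype ι]
    {Ω : Set Plane} {p : ι → ℝ → Plane} (hΩ : IsC5Region Ω p) {σ : Plane → ℝ}
    (hσ : ∀ i, ContDiff ℝ 4 (fun s => σ (p i s))) :
    ∃ C, 0 ≤ C ∧ ∀ x b : Plane, IsUniqueClosest (frontier Ω) x b →
      ∀ (τ n : Plane) (γ : ℝ → ℝ), IsTangentGraph Ω b τ n γ →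
      ∃ (w : BoundaryJet) (ρ : ℝ), ρ = sideSign Ω x * ‖b - x‖ ∧ ρ ^ 2 = ‖b - x‖ ^ 2 ∧
        w.κ = iteratedDeriv 2 γ 0 ∧ w.γ₄ = iteratedDeriv 4 γ 0 ∧ w.σ₀ = σ b ∧
        w.σ₁ * w.γ₃ = deriv (alongTangent σ b τ n γ) 0 * iteratedDeriv 3 γ 0 ∧
        w.σ₂ = iteratedDeriv 2 (alongTangent σ b τ n γ) 0 ∧
        ∀ t, 0 < t → t ≤ 1 →
          |layerAtTime p σ x t - lineKernel ρ t * (w.mean₀ ρ + w.mean₁ ρ * t)|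
            ≤ C * (t * √t) := by
  obtain ⟨C, hC, H⟩ := hΩ.exists_layerAtTime_bound hσ
  refine ⟨C, hC, fun x b hb τ n γ hγ => ?_⟩
  obtain ⟨i, s, hs, hps⟩ := hΩ.exists_param hb.1
  have hfr := hΩ.mem_frontier i
  have hdiff := hΩ.differentiable i
  have hn0 := hγ.inner_normal_deriv_eq_zero hΩ.isOpen hdiff hps hfr
  have hx0 := hb.inner_deriv_eq_zero hdiff hps hfr
  -- the velocity is tangent, so the displacement to the target is normal
  have hvel := Plane.eq_add hγ.norm_tangent hγ.norm_normal hγ.orthogonal (deriv (p i) s)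
  rw [hn0, zero_smul, add_zero] at hvel
  have hv0 : (inner ℝ τ (deriv (p i) s) : ℝ) ≠ 0 := by
    intro h
    rw [h, zero_smul] at hvel
    exact hΩ.regular i s hvel
  have hxτ : (inner ℝ τ (x - b) : ℝ) = 0 := by
    rw [hvel, inner_smul_right, real_inner_comm τ (x - b)] at hx0
    exact (mul_eq_zero.1 hx0).resolve_left hv0
  set ρ : ℝ := inner ℝ n (x - b) with hρ
  have hx : x - b = ρ • n := by
    have := Plane.eq_add hγ.norm_tangent hγ.norm_normal hγ.orthogonal (x - b)
    rwa [hxτ, zero_smul, zero_add] at this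
  have hside := hγ.sideSign_mul hΩ.isOpen hb hx
  have hρ2 : ρ ^ 2 = ‖b - x‖ ^ 2 := by
    rw [norm_sub_rev, hx, norm_smul, hγ.norm_normal, mul_one, Real.norm_eq_abs, sq_abs]
  have habs : |(inner ℝ τ (deriv (p i) s) : ℝ)| = ‖deriv (p i) s‖ := by
    conv_rhs => rw [hvel, norm_smul, hγ.norm_tangent, mul_one, Real.norm_eq_abs]
  -- the statement for a positively oriented tangent
  have main : ∀ (τ : Plane) (γ : ℝ → ℝ), IsTangentGraph Ω b τ n γ →
      inner ℝ τ (deriv (p i) s) = ‖deriv (p i) s‖ → ∃ w : BoundaryJet,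
        w.κ = iteratedDeriv 2 γ 0 ∧ w.γ₃ = iteratedDeriv 3 γ 0 ∧ w.γ₄ = iteratedDeriv 4 γ 0 ∧
        w.σ₀ = σ b ∧ w.σ₁ = deriv (alongTangent σ b τ n γ) 0 ∧
        w.σ₂ = iteratedDeriv 2 (alongTangent σ b τ n γ) 0 ∧ ∀ t, 0 < t → t ≤ 1 →
          |layerAtTime p σ x t - lineKernel ρ t * (w.mean₀ ρ + w.mean₁ ρ * t)|
            ≤ C * (t * √t) := by
    intro τ γ hγ htan
    let j : BoundaryFrame p :=
      ⟨i, s, τ, n, hs, hγ.norm_tangent, hγ.norm_normal, hγ.orthogonal, htan⟩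
    obtain ⟨w, hw1, hw2, hw3⟩ := H j
    have hgraph : ∀ᶠ h in 𝓝 0, γ (j.X h) = j.Y h := by
      have := hγ.eventually_comp hΩ.isOpen hdiff.continuous hps hfr
      simpa only [BoundaryFrame.X, BoundaryFrame.Y, j, hps] using this
    obtain ⟨h2, h3, h4⟩ := hw1 γ hγ.contDiffAt hgraph
    obtain ⟨g0, g1, g2⟩ := hw2 (alongTangent σ b τ n γ) <| hgraph.mono fun h hh => by
      unfold alongTangent
      rw [hh]
      congr 1
      have := Plane.eq_add hγ.norm_tangent hγ.norm_normal hγ.orthogonal (p i (s + h) - b)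
      simp only [BoundaryFrame.X, BoundaryFrame.Y, j, hps]
      rw [add_assoc, ← this, add_sub_cancel]
    refine ⟨w, h2, h3, h4, ?_, g1, g2, hw3 x ρ (by simpa [j, hps] using hx)
      (by simpa [j, hps] using hb)⟩
    rw [g0]; simp [alongTangent, hγ.map_zero]
  rcases le_or_gt 0 (inner ℝ τ (deriv (p i) s) : ℝ) with hpos | hneg
  · obtain ⟨w, h2, h3, h4, g0, g1, g2, hw⟩ := main τ γ hγ (by rw [← habs, abs_of_nonneg hpos])
    exact ⟨w, ρ, hside.symm, hρ2, h2, h4, g0, by rw [g1, h3], g2, hw⟩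
  · obtain ⟨w, h2, h3, h4, g0, g1, g2, hw⟩ := main (-τ) (fun ξ => γ (-ξ)) hγ.neg_tangent
      (by rw [inner_neg_left, ← habs, abs_of_neg hneg])
    have halong : alongTangent σ b (-τ) n (fun ξ => γ (-ξ))
        = fun ξ => alongTangent σ b τ n γ (-ξ) := by
      ext ξ; simp [alongTangent]
    rw [iteratedDeriv_comp_neg] at h2 h3 h4
    rw [halong] at g1 g2
    rw [deriv_comp_neg] at g1
    rw [iteratedDeriv_comp_neg] at g2
    refine ⟨w, ρ, hside.symm, hρ2, ?_, ?_, g0, ?_, ?_, hw⟩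
    · simpa using h2
    · rw [h4]; norm_num
    · rw [g1, h3]; norm_num
    · simpa using g2

/-- The layer is measurable in time: it is a parametric integral of a jointly measurable function,
also at the times `t ≤ 0`, where the kernel takes junk values. -/
lemma IsC5Region.stronglyMeasurable_layerAtTime {ι : Type*} [Fintype ι] {Ω : Set Plane}
    {p : ι → ℝ → Plane} (hΩ : IsC5Region Ω p) {σ : Plane → ℝ}
    (hσ : ∀ i, ContDiff ℝ 4 (fun s => σ (p i s))) (x : Plane) :
    StronglyMeasurable (layerAtTime p σ x) := by
  have hlayer : layerAtTime p σ x
      = fun t => ∑ i, ∫ u in Ioc (0 : ℝ) 1, curveIntegrand p σ x t i u := by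
    ext t
    simp only [← intervalIntegral.integral_of_le (zero_le_one' ℝ)]
    rfl
  rw [hlayer]
  refine Finset.stronglyMeasurable_fun_sum _ fun i _ => ?_
  have hm : Measurable fun v : ℝ × ℝ => curveIntegrand p σ x v.1 i v.2 := by
    have h1 := (hΩ.contDiff i).continuous.measurable
    have h2 := (hσ i).continuous.measurable
    have h3 := (hΩ.contDiff_deriv i).continuous.measurable
    have h1' : Measurable fun v : ℝ × ℝ => p i v.2 := h1.comp measurable_snd
    have h2' : Measurable fun v : ℝ × ℝ => σ (p i v.2) := h2.comp measurable_snd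
    have h3' : Measurable fun v : ℝ × ℝ => deriv (p i) v.2 := h3.comp measurable_snd
    have h4 : Measurable fun v : ℝ × ℝ => heatKernel (x - p i v.2) v.1 := by
      unfold heatKernel; fun_prop
    exact (h4.mul h2').mul h3'.norm
  exact hm.stronglyMeasurable.integral_prod_right

theorem lemma4p1 {ι : Type*} [Fintype ι] (Ω : Set Plane) (p : ι → ℝ → Plane)
    (hΩ : IsC5Region Ω p) (σ : Plane → ℝ) (hσ : ∀ i, ContDiff ℝ 4 (fun s => σ (p i s))) :
    ∃ C δ₀ : ℝ, 0 < C ∧ 0 < δ₀ ∧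
      ∀ δ : ℝ, 0 < δ → δ < δ₀ →
      ∀ x b : Plane, IsUniqueClosest (frontier Ω) x b →
      ∀ (τ n : Plane) (γ : ℝ → ℝ), IsTangentGraph Ω b τ n γ →
      ∀ r c sgn κ γ₃ γ₄ σ₀ σ₁ σ₂ e E : ℝ,
        r = ‖b - x‖ → c = r / Real.sqrt δ → sgn = sideSign Ω x →
        κ = iteratedDeriv 2 γ 0 → γ₃ = iteratedDeriv 3 γ 0 → γ₄ = iteratedDeriv 4 γ 0 →
        σ₀ = σ b →
        σ₁ = deriv (alongTangent σ b τ n γ) 0 →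
        σ₂ = iteratedDeriv 2 (alongTangent σ b τ n γ) 0 →
        e = Real.exp (-c ^ 2 / 4) → E = erfc (c / 2) →
        IntervalIntegrable (layerAtTime p σ x) volume 0 δ ∧
        |localSingleLayer p σ δ x -
          -(Real.sqrt δ * (σ₀ / 2) * (c * E - 2 * e / Real.sqrt Real.pi)
            + sgn * δ * (c * κ * σ₀ / 4) * (c * E - 2 * e / Real.sqrt Real.pi)
            + δ ^ (3 / 2 : ℝ) * (σ₀ * κ ^ 2 / 12)
                * (2 * c ^ 3 * E - (4 * c ^ 2 + 1) * e / Real.sqrt Real.pi)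
            + δ ^ (3 / 2 : ℝ) * (σ₂ / 12)
                * (2 * (c ^ 2 - 2) * e / Real.sqrt Real.pi - c ^ 3 * E)
            + δ ^ 2 * sgn *
                (c * κ ^ 3 * σ₀ / 16
                    * (3 * c ^ 3 * E - (6 * c ^ 2 - 2) * e / Real.sqrt Real.pi)
                  + c * κ * σ₂ / 8
                    * (2 * (c ^ 2 - 2) * e / Real.sqrt Real.pi - c ^ 3 * E))
            + δ ^ 2 * sgn *
                (c * σ₀ * γ₄ / 48
                    * (2 * (c ^ 2 - 2) * e / Real.sqrt Real.pi - c ^ 3 * E)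
                  + c * σ₁ * γ₃ / 12
                    * (e * (2 * c ^ 2 - 4) / Real.sqrt Real.pi - c ^ 3 * E)))|
          ≤ C * δ ^ (5 / 2 : ℝ) := by
  obtain ⟨C, hC, H⟩ := hΩ.exists_layerAtTime_bound_of_isTangentGraph hσ
  refine ⟨C + 1, 1, by positivity, one_pos, fun δ hδ hδ1 x b hb τ n γ hγ => ?_⟩
  rintro r c sgn κ γ₃ γ₄ σ₀ σ₁ σ₂ e E hr hc hsgn rfl rfl rfl rfl rfl rfl he hE
  obtain ⟨w, ρ, hρ, hρ2, hκ, h4, h0, h13, h2, hlayer⟩ := H x b hb τ n γ hγ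
  rw [← hr] at hρ hρ2
  have hr0 : 0 ≤ r := hr ▸ norm_nonneg _
  have hs : 0 < √δ := Real.sqrt_pos.2 hδ
  have hkernel : lineKernel ρ = lineKernel r := by
    ext t; unfold lineKernel; rw [hρ2]
  rw [hkernel] at hlayer
  set m : ℝ → ℝ := fun t => lineKernel r t * (w.mean₀ ρ + w.mean₁ ρ * t) with hm
  have hm' : m = fun t => w.mean₀ ρ * lineKernel r t + w.mean₁ ρ * (lineKernel r t * t) := by
    ext t; simp only [hm]; ring
  have hi₀ := (intervalIntegrable_lineKernel r hδ.le).const_mul (w.mean₀ ρ)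
  have hi₁ := (intervalIntegrable_lineKernel_mul r hδ.le).const_mul (w.mean₁ ρ)
  have hmi : IntervalIntegrable m volume 0 δ := by rw [hm']; exact hi₀.add hi₁
  have hmv : ∫ t in (0 : ℝ)..δ, m t
      = w.mean₀ ρ * linePrimitive₀ r δ + w.mean₁ ρ * linePrimitive₁ r δ := by
    rw [hm', intervalIntegral.integral_add hi₀ hi₁, intervalIntegral.integral_const_mul,
      intervalIntegral.integral_const_mul, integral_lineKernel hr0 hδ,
      integral_lineKernel_mul hr0 hδ]
  have hbound : ∀ t ∈ uIoc 0 δ, ‖layerAtTime p σ x t - m t‖ ≤ C * (δ * √δ) := by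
    intro t ht
    rw [uIoc_of_le hδ.le] at ht
    refine (hlayer t ht.1 (ht.2.trans hδ1.le)).trans ?_
    have := ht.1.le
    have := ht.2
    gcongr
  have hdi : IntervalIntegrable (fun t => layerAtTime p σ x t - m t) volume 0 δ := by
    refine (intervalIntegrable_const (c := C * (δ * √δ))).mono_fun' ?_
      ((ae_restrict_mem measurableSet_uIoc).mono hbound)
    exact (hΩ.stronglyMeasurable_layerAtTime hσ x).aestronglyMeasurable.sub
      hmi.aestronglyMeasurable_restrict_uIoc
  have hli : IntervalIntegrable (layerAtTime p σ x) volume 0 δ := by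
    simpa using hdi.add hmi
  refine ⟨hli, ?_⟩
  have hδ2 : δ = √δ ^ 2 := (Real.sq_sqrt hδ.le).symm
  have hpow (k : ℕ) : δ ^ ((k : ℝ) / 2) = √δ ^ k := by
    rw [Real.sqrt_eq_rpow, ← Real.rpow_natCast, ← Real.rpow_mul hδ.le]; congr 1; ring
  have h3 : δ ^ (3 / 2 : ℝ) = √δ ^ 3 := by exact_mod_cast hpow 3
  have h5 : δ ^ (5 / 2 : ℝ) = √δ ^ 5 := by exact_mod_cast hpow 5
  have hrc : r = c * √δ := by rw [hc]; field_simp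
  have hexp : Real.exp (-r ^ 2 / (4 * δ)) = e := by
    rw [he]; congr 1; rw [hrc, mul_pow, Real.sq_sqrt hδ.le]; field_simp
  have herfc : erfc (r / (2 * √δ)) = E := by rw [hE, hc]; congr 1; field_simp
  have hrem : |localSingleLayer p σ δ x
      - (w.mean₀ ρ * linePrimitive₀ r δ + w.mean₁ ρ * linePrimitive₁ r δ)|
      ≤ (C + 1) * δ ^ (5 / 2 : ℝ) := by
    unfold localSingleLayer
    rw [← hmv, ← intervalIntegral.integral_sub hli hmi]
    refine (intervalIntegral.norm_integral_le_of_norm_le_const hbound).trans ?_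
    rw [sub_zero, abs_of_pos hδ, h5]
    calc C * (δ * √δ) * δ = C * √δ ^ 5 := by
          nth_rewrite 1 [hδ2]; nth_rewrite 3 [hδ2]; ring
      _ ≤ _ := by gcongr; linarith
  refine (le_of_eq ?_).trans hrem
  congr 2
  unfold linePrimitive₀ linePrimitive₁
  rw [hexp, herfc, h3]
  have hδ4 : δ ^ 2 = √δ ^ 4 := by nth_rewrite 1 [hδ2]; ring
  simp only [BoundaryJet.mean₀, BoundaryJet.mean₁, hκ, h4, h0, h13, h2]
  -- the sign is `±1`, or else the target lies on the boundary and `ρ = 0`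
  have hcases : sgn ^ 2 = 1 ∨ c = 0 := by
    by_cases hr00 : r = 0
    · right; rw [hc, hr00, zero_div]
    · left
      rw [hρ, ← hsgn, mul_pow] at hρ2
      exact mul_right_cancel₀ (pow_ne_zero 2 hr00) (by rw [hρ2, one_mul])
  rw [← hsgn, hrc] at hρ
  rw [hρ, hrc, hδ4]
  generalize √δ = S at hδ2 ⊢
  rw [hδ2]
  rcases hcases with h | h
  · rcases mul_eq_zero.1 (show (sgn - 1) * (sgn + 1) = 0 by linarith) with h' | h'
    · rw [sub_eq_zero.1 h']; ring
    · rw [eq_neg_of_add_eq_zero_left h']; ring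
  · rw [h]; ring
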